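/- Let $V$ be a finite non-empty vertex set and $E$ a finite set of directed edges (loops and multiple edges allowed); the edge $e$ goes from $i(e)$ to $t(e)$. For each $e\in E$ let $\psi_e(\xi)=T_e\xi+t_e$ be an affine map of $\mathbb{R}^2$ with $t_e\in\mathbb{R}^2$ and $$T_e=\begin{pmatrix}\pm a_e&0\\0&\pm b_e\end{pmatrix}\quad\text{or}\quad T_e=\begin{pmatrix}0&\pm a_e\\\pm b_e&0\end{pmatrix},\qquad 0<a_e,b_e<1 .$$ A word $w=w_1\cdots w_k\in E^k$, $k\ge1$, is admissible if $t(w_{j-1})=i(w_j)$ for $1<j\le k$; it goes from $i(w)=i(w_1)$ to $t(w)=t(w_k)$, written $i(w)\xrightarrow{w}t(w)$. Assume that the graph is strongly connected (for all $v,v'\in V$ there is an admissible word from $v$ to $v'$), and that the rectangular open set condition (ROSC) holds: for every $v\in V$ the sets $\psi_e((0,1)^2)$ with $i(e)=v$ are pairwise disjoint subsets of $(0,1)^2$. Let $(p_e)_{e\in E}$ be positive numbers with $\sum_{i(e)=v}p_e=1$ for all $v\in V$, and let $\{\mu_v\}_{v\in V}$ be the associated graph-directed self-affine measures, that is, Borel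 probability measures on $\mathbb{R}^2$ with $$\mu_v=\sum_{e:\,i(e)=v}p_e\,\mu_{t(e)}\circ\psi_e^{-1}\qquad(v\in V).$$ For a compactly supported Borel probability measure $\nu$ on $\mathbb{R}^n$, $q\ge0$ and $\delta>0$ put $\mathcal D^q_\delta(\nu)=\sum_Q\nu(Q)^q$, the sum over the closed cubes $Q$ of the $\delta$-mesh of $\mathbb{R}^n$ with $\nu(Q)>0$. The $L^q$-spectrum $\tau_\nu(q)$ is said to exist if the upper and lower limits of $\log\mathcal D^q_\delta(\nu)/(-\log\delta)$ as $\delta\to0+$ coincide, and it is then their common value. Let $\pi_x,\pi_y$ be the coordinate projections of $\mathbb{R}^2$. For an admissible word $w=w_1\cdots w_k$ put $p_w=p_{w_1}\cdots p_{w_k}$, $T_w=T_{w_1}\cdots T_{w_k}$ and $\psi_w=\psi_{w_1}\circ\cdots\circ\psi_{w_k}$, let $\alpha_1(w)\ge\alpha_2(w)$ be the singular values of $T_w$, and let $c_w,d_w$ be the width and the height of the rectangle $\psi_w([0,1]^2)$. Let $\pi_w=\pi_x$ if $c_w\ge d_w$ and $T_w$ is diagonal or if $c_w<d_w$ and $T_w$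 is anti-diagonal, and $\pi_w=\pi_y$ otherwise. For $s\in\mathbb{R}$ and $q\ge0$ put $$\tau_w(q)=\tau_{\mu_{t(w)}\circ\pi_w^{-1}}(q),\qquad \varphi^{s,q}(w)=p_w^q\,\alpha_1(w)^{\tau_w(q)}\,\alpha_2(w)^{s-\tau_w(q)},$$ let $A^{s,q}_k$ be the $V\times V$ matrix with entries $A^{s,q}_k(v,v')=\sum_{w\in E^k:\,v\xrightarrow{w}v'}\varphi^{s,q}(w)$ (the sum over admissible words), and let $P(s,q)=\lim_{k\to\infty}\|A^{s,q}_k\|^{1/k}$, where $\|A\|=\sum_{v,v'}|A(v,v')|$. Then for every $q\ge0$: (i) the $L^q$-spectra at $q$ of $\mu_v\circ\pi_x^{-1}$ and $\mu_v\circ\pi_y^{-1}$ exist and are finite for all $v\in V$, and the limit defining $P(s,q)$ exists and is finite for all $s\in\mathbb{R}$, so that $P(\cdot,q)$ is well defined; (ii) there is exactly one real number $\gamma(q)$ with $P(\gamma(q),q)=1$; (iii) for every $v\in V$ the $L^q$-spectrum $\tau_{\mu_v}(q)$ exists and equals $\gamma(q)$. -/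

import Mathlib

open MeasureTheory Filter Topology

noncomputable section

/-! ### `L^q`-spectra of measures on `ℝⁿ` -/

/-- The closed cube of the `δ`-mesh of `ℝⁿ` with index `k ∈ ℤⁿ`. -/
def meshCube {n : ℕ} (δ : ℝ) (k : Fin n → ℤ) : Set (Fin n → ℝ) :=
  {x | ∀ i, (k i : ℝ) * δ ≤ x i ∧ x i ≤ ((k i : ℝ) + 1) * δ}

open Classical in
/-- `D_δ^q(ν) = ∑_Q ν(Q)^q` over the closed cubes `Q` of the `δ`-mesh. Cubes of measure zero
contribute `0`, also for `q = 0`. The sum has finitely many non-zero terms when the finite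
measure `ν` is compactly supported. -/
def meshMoment {n : ℕ} (ν : Measure (Fin n → ℝ)) (q δ : ℝ) : ℝ :=
  ∑' k : Fin n → ℤ, if ν (meshCube δ k) = 0 then 0 else (ν (meshCube δ k)).toReal ^ q

/-- The upper `L^q`-spectrum, an extended real. -/
def upperLqSpectrum {n : ℕ} (ν : Measure (Fin n → ℝ)) (q : ℝ) : EReal :=
  limsup (fun δ : ℝ => ((Real.log (meshMoment ν q δ) / (-Real.log δ) : ℝ) : EReal)) (𝓝[>] 0)

/-- The lower `L^q`-spectrum, an extended real. -/
def lowerLqSpectrum {n : ℕ} (ν : Measure (Fin n → ℝ)) (q : ℝ) : EReal :=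
  liminf (fun δ : ℝ => ((Real.log (meshMoment ν q δ) / (-Real.log δ) : ℝ) : EReal)) (𝓝[>] 0)

/-- The `L^q`-spectrum of `ν` exists at `q` and equals the real number `τ`. -/
def HasLqSpectrum {n : ℕ} (ν : Measure (Fin n → ℝ)) (q τ : ℝ) : Prop :=
  lowerLqSpectrum ν q = (τ : EReal) ∧ upperLqSpectrum ν q = (τ : EReal)

/-- The value of the `L^q`-spectrum; meaningful when `HasLqSpectrum ν q τ` for some `τ`, and then
equal to `τ`. -/
def lqSpectrum {n : ℕ} (ν : Measure (Fin n → ℝ)) (q : ℝ) : ℝ :=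
  (upperLqSpectrum ν q).toReal

/-! ### Planar box-like self-affine GIFS -/

/-- `T` is `diag(±a, ±b)` with `0 < a, b < 1`. -/
def IsBoxDiagonal (T : Matrix (Fin 2) (Fin 2) ℝ) : Prop :=
  ∃ a b : ℝ, 0 < |a| ∧ |a| < 1 ∧ 0 < |b| ∧ |b| < 1 ∧ T = !![a, 0; 0, b]

/-- `T` is anti-diagonal with entries `±a, ±b`, where `0 < a, b < 1`. -/
def IsBoxAntiDiagonal (T : Matrix (Fin 2) (Fin 2) ℝ) : Prop :=
  ∃ a b : ℝ, 0 < |a| ∧ |a| < 1 ∧ 0 < |b| ∧ |b| < 1 ∧ T = !![0, a; b, 0]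

/-- A directed multigraph with vertices `V` and edges `E` (loops and multiple edges allowed),
with an affine map `ξ ↦ T_e ξ + t_e` of the plane on each edge `e`, where `T_e` is a contracting
non-singular diagonal or anti-diagonal matrix. -/
structure BoxLikeGIFS (V E : Type*) where
  /-- initial vertex -/
  src : E → V
  /-- terminal vertex -/
  tgt : E → V
  /-- linear part -/
  lin : E → Matrix (Fin 2) (Fin 2) ℝ
  /-- translation part -/
  trans : E → (Fin 2 → ℝ)
  boxLike : ∀ e, IsBoxDiagonal (lin e) ∨ IsBoxAntiDiagonal (lin e)

namespace BoxLikeGIFS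

variable {V E : Type*} (G : BoxLikeGIFS V E)

/-- The affine map `ψ_e`. -/
def psi (e : E) : (Fin 2 → ℝ) → (Fin 2 → ℝ) :=
  fun ξ => (G.lin e).mulVec ξ + G.trans e

/-- The word `w` is admissible and leads from `v` to `v'`. The empty word leads from each vertex
to itself. -/
def IsPath : V → List E → V → Prop
  | v, [], v' => v = v'
  | v, e :: w, v' => G.src e = v ∧ IsPath (G.tgt e) w v'

/-- Any two vertices, equal or not, are joined by an admissible word of length at least one. -/
def StronglyConnected : Prop :=
  ∀ v v' : V, ∃ w : List E, w ≠ [] ∧ G.IsPath v w v'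

/-- The rectangular open set condition. -/
def ROSC : Prop :=
  ∀ v : V,
    (⋃ e ∈ {e : E | G.src e = v}, G.psi e '' Set.univ.pi (fun _ => Set.Ioo (0 : ℝ) 1)) ⊆
      Set.univ.pi (fun _ => Set.Ioo (0 : ℝ) 1) ∧
    {e : E | G.src e = v}.PairwiseDisjoint
      (fun e => G.psi e '' Set.univ.pi (fun _ => Set.Ioo (0 : ℝ) 1))

open Classical in
/-- A positive vector with `∑_{i(e) = v} p_e = 1` for every vertex `v`. -/
def IsProbVector [Fintype E] (p : E → ℝ) : Prop :=
  (∀ e, 0 < p e) ∧ ∀ v : V, ∑ e with G.src e = v, p e = 1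

open Classical in
/-- Borel probability measures on the plane with
`μ_v = ∑_{i(e) = v} p_e · μ_{t(e)} ∘ ψ_e⁻¹` for every vertex `v`. -/
def IsSelfAffineFamily [Fintype E] (p : E → ℝ) (μ : V → Measure (Fin 2 → ℝ)) : Prop :=
  (∀ v, IsProbabilityMeasure (μ v)) ∧
    ∀ v, μ v = ∑ e with G.src e = v, ENNReal.ofReal (p e) • (μ (G.tgt e)).map (G.psi e)

/-- `T_w = T_{w_1} ⋯ T_{w_k}`. -/
def linWord (w : List E) : Matrix (Fin 2) (Fin 2) ℝ := (w.map G.lin).prod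

/-- `ψ_w = ψ_{w_1} ∘ ⋯ ∘ ψ_{w_k}`. -/
def psiWord : List E → (Fin 2 → ℝ) → (Fin 2 → ℝ)
  | [] => id
  | e :: w => G.psi e ∘ psiWord w

/-- The length of the side of the rectangle `ψ_w([0,1]²)` parallel to the `i`-th axis:
`i = 0` gives the width `c_w`, `i = 1` the height `d_w`. -/
def sideLength (i : Fin 2) (w : List E) : ℝ :=
  Metric.diam ((fun ξ : Fin 2 → ℝ => ξ i) '' (G.psiWord w '' Set.Icc 0 1))

open Classical in
/-- The coordinate selected by `π_w`: the one that `T_w` maps to the direction of the longest side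
of `ψ_w([0,1]²)`, with ties resolved in favour of the width. -/
def projIndex (w : List E) : Fin 2 :=
  if (G.linWord w).IsDiag then
    if G.sideLength 1 w ≤ G.sideLength 0 w then 0 else 1
  else
    if G.sideLength 1 w ≤ G.sideLength 0 w then 1 else 0

/-- The singular values of `T_w` in decreasing order: `i = 0` gives `α₁(w)`, `i = 1` gives
`α₂(w)`. -/
def alpha (i : ℕ) (w : List E) : ℝ :=
  (Matrix.toEuclideanLin (G.linWord w)).singularValues i

end BoxLikeGIFS

/-- The projection of a measure on the plane to the `i`-th axis, as a measure on `ℝ¹`: `i = 0`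
gives `μ^x`, `i = 1` gives `μ^y`. -/
def projMeasure (i : Fin 2) (μ : Measure (Fin 2 → ℝ)) : Measure (Fin 1 → ℝ) :=
  μ.map (fun ξ _ => ξ i)

namespace BoxLikeGIFS

variable {V E : Type*} (G : BoxLikeGIFS V E)

/-- `τ_w(q)`, for a word `w` with terminal vertex `v'`. -/
def tauWord (μ : V → Measure (Fin 2 → ℝ)) (q : ℝ) (w : List E) (v' : V) : ℝ :=
  lqSpectrum (projMeasure (G.projIndex w) (μ v')) q

/-- The modified singular value function `φ^{s,q}(w)`, for a word `w` with terminal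
vertex `v'`. -/
def phi (p : E → ℝ) (μ : V → Measure (Fin 2 → ℝ)) (s q : ℝ) (w : List E) (v' : V) : ℝ :=
  (w.map p).prod ^ q * G.alpha 0 w ^ G.tauWord μ q w v' * G.alpha 1 w ^ (s - G.tauWord μ q w v')

open Classical in
/-- The modified singular value function matrix `A_k^{s,q}`. Its `(v, v')` entry is the sum of
`φ^{s,q}(w)` over the admissible words `w` of length `k` from `v` to `v'`. -/
def svMatrix [Fintype E] (p : E → ℝ) (μ : V → Measure (Fin 2 → ℝ)) (s q : ℝ) (k : ℕ) :
    Matrix V V ℝ :=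
  Matrix.of fun v v' =>
    ∑ w : Fin k → E with G.IsPath v (List.ofFn w) v', G.phi p μ s q (List.ofFn w) v'

/-- `‖A_k^{s,q}‖^{1/k}`, where `‖A‖ = ∑ |a_{ij}|`. -/
def pressureSeq [Fintype V] [Fintype E] (p : E → ℝ) (μ : V → Measure (Fin 2 → ℝ)) (s q : ℝ)
    (k : ℕ) : ℝ :=
  (∑ v, ∑ v', |G.svMatrix p μ s q k v v'|) ^ (1 / (k : ℝ))

/-- The pressure `P(s, q) = lim_k ‖A_k^{s,q}‖^{1/k}`. -/
def pressure [Fintype V] [Fintype E] (p : E → ℝ) (μ : V → Measure (Fin 2 → ℝ)) (s q : ℝ) : ℝ :=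
  limUnder atTop (G.pressureSeq p μ s q)

end BoxLikeGIFS

end

/-!
Cut `μ_v` along the words `w` at which a side of the rectangle `ψ_w([0,1]²)` first falls below `δ`.

For the projections, cut along the side in the direction of projection. Every piece is an affine
image, of size about `δ`, of a projection of some `μ_{t(w)}`, and by strong connectivity all these
have comparable moments. As every `x ^ q` is sub- or superadditive, the moment at scale `δ ε` is, up
to a constant, at most (for `q ≥ 1`) or at least (for `q ≤ 1`) the product of those at scales `δ`
and `ε`, and Fekete's lemma yields the spectra. The spectra turn out to be constant along paths up
to the exchange of the coordinates, so `α₁(w)^{τ_w} α₂(w)^{s - τ_w}` is a product of quantities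
multiplicative in `w` and of a power of the shorter side. Hence `φ^{s,q}` is sub- or
supermultiplicative, according to the sign of the exponent of that power, the pressure exists, and
it is strictly decreasing in `s`.

For `μ_v` itself, cut along the shorter side. By the open set condition a mesh cube meets a bounded
number of pieces, and at scale `δ` the piece `ψ_w` looks like a projection of `μ_{t(w)}` at scale
`α₂(w) / α₁(w)`. So the moment of `μ_v` at scale `δ` is, up to subexponential factors, `δ^{-s}`
times the sum of `φ^{s,q}` over these words. That sum is bounded above when the pressure at `s` is
less than `1`, and bounded away from zero when it is greater than `1`, which pins the growth
exponent to the root of the pressure equation.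
-/

open scoped ENNReal

/-! ### Sums of `q`-th powers -/

open Classical in
/-- The power `x ↦ x ^ q` with the convention `0 ^ q = 0` also for `q = 0`, under which `L^q`-sums
disregard null sets. -/
noncomputable def qpow (q : ℝ) (x : ℝ≥0∞) : ℝ≥0∞ := if x = 0 then 0 else x ^ q

@[simp] lemma qpow_zero_right (q : ℝ) : qpow q 0 = 0 := if_pos rfl

lemma qpow_of_ne_zero {q : ℝ} {x : ℝ≥0∞} (hx : x ≠ 0) : qpow q x = x ^ q := if_neg hx

lemma qpow_of_pos {q : ℝ} (hq : 0 < q) (x : ℝ≥0∞) : qpow q x = x ^ q := by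
  rcases eq_or_ne x 0 with rfl | hx
  · rw [qpow_zero_right, ENNReal.zero_rpow_of_pos hq]
  · exact qpow_of_ne_zero hx

section qpow

variable {ι κ ω : Type*} {q : ℝ}

lemma qpow_mono (hq : 0 ≤ q) {x y : ℝ≥0∞} (hxy : x ≤ y) : qpow q x ≤ qpow q y := by
  rcases eq_or_ne x 0 with rfl | hx
  · simp
  · rw [qpow_of_ne_zero hx, qpow_of_ne_zero (hx.bot_lt.trans_le hxy).ne']
    exact ENNReal.rpow_le_rpow hxy hq

lemma qpow_mul (hq : 0 ≤ q) {c : ℝ≥0∞} (hc : c ≠ 0) (x : ℝ≥0∞) :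
    qpow q (c * x) = c ^ q * qpow q x := by
  rcases eq_or_ne x 0 with rfl | hx
  · simp
  · rw [qpow_of_ne_zero hx, qpow_of_ne_zero (mul_ne_zero hc hx), ENNReal.mul_rpow_of_nonneg _ _ hq]

lemma qpow_ne_top (hq : 0 ≤ q) {x : ℝ≥0∞} (hx : x ≠ ∞) : qpow q x ≠ ∞ := by
  rcases eq_or_ne x 0 with rfl | hx0
  · simp
  · rw [qpow_of_ne_zero hx0]
    exact ENNReal.rpow_ne_top_of_nonneg hq hx

lemma qpow_ne_zero (hq : 0 ≤ q) {x : ℝ≥0∞} (hx : x ≠ 0) : qpow q x ≠ 0 := by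
  simp [qpow_of_ne_zero hx, ENNReal.rpow_eq_zero_iff, hx, hq.not_gt]

lemma qpow_sum_le (hq : 0 ≤ q) (T : Finset κ) (h : κ → ℝ≥0∞) {N : ℕ} (hN : T.card ≤ N) :
    qpow q (∑ b ∈ T, h b) ≤ (N : ℝ≥0∞) ^ q * ∑ b ∈ T, qpow q (h b) := by
  rcases T.eq_empty_or_nonempty with rfl | hT
  · simp
  obtain ⟨b, hb, hmax⟩ := T.exists_max_image h hT
  have hN0 : (N : ℝ≥0∞) ≠ 0 := by exact_mod_cast (hT.card_pos.trans_le hN).ne'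
  calc qpow q (∑ b ∈ T, h b) ≤ qpow q (N * h b) := by
        refine qpow_mono hq ((Finset.sum_le_card_nsmul T h (h b) hmax).trans ?_)
        rw [nsmul_eq_mul]
        gcongr
    _ = (N : ℝ≥0∞) ^ q * qpow q (h b) := qpow_mul hq hN0 _
    _ ≤ (N : ℝ≥0∞) ^ q * ∑ b ∈ T, qpow q (h b) := by
        gcongr
        exact Finset.single_le_sum (f := fun b => qpow q (h b)) (fun _ _ => zero_le) hb

lemma sum_qpow_le (hq : 0 ≤ q) (T : Finset κ) (h : κ → ℝ≥0∞) {N : ℕ} (hN : T.card ≤ N) :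
    ∑ b ∈ T, qpow q (h b) ≤ (N : ℝ≥0∞) * qpow q (∑ b ∈ T, h b) := by
  refine (Finset.sum_le_card_nsmul T _ (qpow q (∑ b ∈ T, h b)) fun b hb => ?_).trans ?_
  · exact qpow_mono hq (Finset.single_le_sum (fun _ _ => zero_le) hb)
  · rw [nsmul_eq_mul]
    gcongr

lemma tsum_eq_sum_of_ne_zero_mem {T : Finset κ} {h : κ → ℝ≥0∞} (hT : ∀ b, h b ≠ 0 → b ∈ T) :
    ∑' b, h b = ∑ b ∈ T, h b :=
  tsum_eq_sum fun b hb => of_not_not (mt (hT b) hb)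

lemma qpow_tsum_le (hq : 0 ≤ q) {T : Finset κ} {h : κ → ℝ≥0∞} {N : ℕ} (hN : T.card ≤ N)
    (hT : ∀ b, h b ≠ 0 → b ∈ T) :
    qpow q (∑' b, h b) ≤ (N : ℝ≥0∞) ^ q * ∑' b, qpow q (h b) := by
  rw [tsum_eq_sum_of_ne_zero_mem hT]
  refine (qpow_sum_le hq T h hN).trans ?_
  gcongr
  exact ENNReal.sum_le_tsum T

lemma tsum_qpow_le (hq : 0 ≤ q) {T : Finset κ} {h : κ → ℝ≥0∞} {N : ℕ} (hN : T.card ≤ N)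
    (hT : ∀ b, h b ≠ 0 → b ∈ T) :
    ∑' b, qpow q (h b) ≤ (N : ℝ≥0∞) * qpow q (∑' b, h b) := by
  rw [tsum_eq_sum_of_ne_zero_mem hT, tsum_eq_sum_of_ne_zero_mem (T := T)]
  · exact sum_qpow_le hq T h hN
  · exact fun b hb => hT b (by rintro h0; simp [h0] at hb)

lemma tsum_ite_le {T : Finset ι} {N : ℕ} (hN : T.card ≤ N) {P : ι → Prop} [DecidablePred P]
    (hT : ∀ a, P a → a ∈ T) (c : ℝ≥0∞) : ∑' a, (if P a then c else 0) ≤ N * c := by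
  rw [tsum_eq_sum_of_ne_zero_mem (T := T) fun a ha => hT a (by simp_all)]
  refine (Finset.sum_le_card_nsmul T _ c fun a _ => ?_).trans ?_
  · split_ifs <;> simp
  · rw [nsmul_eq_mul]
    gcongr

open Classical in
lemma tsum_qpow_le_of_rel (hq : 0 ≤ q) (R : ι → κ → Prop) {N M : ℕ}
    (hN : ∀ a, ∃ T : Finset κ, T.card ≤ N ∧ ∀ b, R a b → b ∈ T)
    (hM : ∀ b, ∃ T : Finset ι, T.card ≤ M ∧ ∀ a, R a b → a ∈ T)
    {f : ι → ℝ≥0∞} {h : κ → ℝ≥0∞} (hf : ∀ a, f a ≤ ∑' b, if R a b then h b else 0) :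
    ∑' a, qpow q (f a) ≤ (N : ℝ≥0∞) ^ q * M * ∑' b, qpow q (h b) := by
  have hrow : ∀ a, qpow q (f a) ≤ (N : ℝ≥0∞) ^ q * ∑' b, if R a b then qpow q (h b) else 0 := by
    intro a
    obtain ⟨T, hT, hRT⟩ := hN a
    refine (qpow_mono hq (hf a)).trans ((qpow_tsum_le hq hT fun b hb => hRT b ?_).trans_eq ?_)
    · exact of_not_not fun h0 => hb (if_neg h0)
    · congr with b
      split_ifs <;> simp
  have hcol : ∀ b, ∑' a, (if R a b then qpow q (h b) else 0) ≤ M * qpow q (h b) := fun b =>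
    let ⟨_, hT, hRT⟩ := hM b
    tsum_ite_le hT hRT _
  calc ∑' a, qpow q (f a)
      ≤ (N : ℝ≥0∞) ^ q * ∑' a, ∑' b, if R a b then qpow q (h b) else 0 :=
        (ENNReal.tsum_le_tsum hrow).trans_eq ENNReal.tsum_mul_left
    _ = (N : ℝ≥0∞) ^ q * ∑' b, ∑' a, if R a b then qpow q (h b) else 0 := by
        rw [ENNReal.tsum_comm]
    _ ≤ (N : ℝ≥0∞) ^ q * ∑' b, M * qpow q (h b) := by
        gcongr with b
        exact hcol b
    _ = (N : ℝ≥0∞) ^ q * M * ∑' b, qpow q (h b) := by rw [ENNReal.tsum_mul_left, mul_assoc]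

lemma qpow_sum_mul_le (hq : 1 ≤ q) (s : Finset ω) {l : ω → ℝ≥0∞} (hl : ∑ w ∈ s, l w = 1)
    (x : ω → ℝ≥0∞) : qpow q (∑ w ∈ s, l w * x w) ≤ ∑ w ∈ s, l w * qpow q (x w) := by
  simp_rw [qpow_of_pos (zero_lt_one.trans_le hq)]
  exact ENNReal.rpow_arith_mean_le_arith_mean_rpow s l x hl hq

lemma sum_mul_qpow_le (hq : 0 ≤ q) (hq1 : q ≤ 1) (s : Finset ω) {l : ω → ℝ≥0∞}
    (hl : ∑ w ∈ s, l w = 1) (x : ω → ℝ≥0∞) :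
    ∑ w ∈ s, l w * qpow q (x w) ≤ qpow q (∑ w ∈ s, l w * x w) := by
  rcases hq.eq_or_lt with rfl | hq0
  · by_cases h0 : ∑ w ∈ s, l w * x w = 0
    · rw [h0, qpow_zero_right, nonpos_iff_eq_zero]
      refine Finset.sum_eq_zero fun w hw => ?_
      rcases mul_eq_zero.1 (Finset.sum_eq_zero_iff.1 h0 w hw) with h | h <;> simp [h]
    · rw [qpow_of_ne_zero h0, ENNReal.rpow_zero, ← hl]
      refine Finset.sum_le_sum fun w _ => mul_le_of_le_one_right' ?_
      simp only [qpow, ENNReal.rpow_zero]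
      split_ifs <;> simp
  · simp_rw [qpow_of_pos hq0]
    rw [← ENNReal.rpow_le_rpow_iff (one_div_pos.2 hq0)]
    have hmean := ENNReal.rpow_arith_mean_le_arith_mean_rpow s l (fun w => x w ^ q) hl
      ((one_le_div hq0).2 hq1)
    simpa only [← ENNReal.rpow_mul, mul_one_div_cancel hq0.ne', ENNReal.rpow_one] using hmean

lemma sum_div_sum_eq_one {s : Finset ω} {p : ω → ℝ≥0∞} (hp0 : ∑ w ∈ s, p w ≠ 0)
    (hp : ∑ w ∈ s, p w ≠ ∞) : ∑ w ∈ s, p w / ∑ w ∈ s, p w = 1 := by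
  simp_rw [div_eq_mul_inv]
  rw [← Finset.sum_mul, ENNReal.mul_inv_cancel hp0 hp]

lemma qpow_sum_mul_eq (hq : 0 ≤ q) {s : Finset ω} {p : ω → ℝ≥0∞} (hp0 : ∑ w ∈ s, p w ≠ 0)
    (hp : ∑ w ∈ s, p w ≠ ∞) (x : ω → ℝ≥0∞) :
    qpow q (∑ w ∈ s, p w * x w) =
      qpow q (∑ w ∈ s, p w) * qpow q (∑ w ∈ s, p w / (∑ w ∈ s, p w) * x w) := by
  rw [qpow_of_ne_zero hp0, ← qpow_mul hq hp0, Finset.mul_sum]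
  simp_rw [← mul_assoc, ENNReal.mul_div_cancel hp0 hp]

lemma tsum_sum_mul (s : Finset ω) (l : ω → ℝ≥0∞) (x : ω → κ → ℝ≥0∞) :
    ∑' k, ∑ w ∈ s, l w * x w k = ∑ w ∈ s, l w * ∑' k, x w k := by
  simp_rw [Summable.tsum_finsetSum fun _ _ => ENNReal.summable, ENNReal.tsum_mul_left]

lemma tsum_qpow_sum_mul_le (hq : 1 ≤ q) (s : Finset ω) {p : ω → ℝ≥0∞} (hp : ∑ w ∈ s, p w ≠ ∞)
    {x : ω → κ → ℝ≥0∞} {T : ℝ≥0∞} (hT : ∀ w ∈ s, ∑' k, qpow q (x w k) ≤ T) :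
    ∑' k, qpow q (∑ w ∈ s, p w * x w k) ≤ qpow q (∑ w ∈ s, p w) * T := by
  by_cases hp0 : ∑ w ∈ s, p w = 0
  · have : ∀ k, ∑ w ∈ s, p w * x w k = 0 := fun k =>
      Finset.sum_eq_zero fun w hw => by simp [Finset.sum_eq_zero_iff.1 hp0 w hw]
    simp [this]
  have hl := sum_div_sum_eq_one hp0 hp
  simp_rw [qpow_sum_mul_eq (zero_le_one.trans hq) hp0 hp, ENNReal.tsum_mul_left]
  gcongr
  calc ∑' k, qpow q (∑ w ∈ s, p w / (∑ w ∈ s, p w) * x w k)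
      ≤ ∑' k, ∑ w ∈ s, p w / (∑ w ∈ s, p w) * qpow q (x w k) :=
        ENNReal.tsum_le_tsum fun k => qpow_sum_mul_le hq s hl _
    _ = ∑ w ∈ s, p w / (∑ w ∈ s, p w) * ∑' k, qpow q (x w k) := tsum_sum_mul s _ _
    _ ≤ ∑ w ∈ s, p w / (∑ w ∈ s, p w) * T := Finset.sum_le_sum fun w hw => by
        gcongr
        exact hT w hw
    _ = T := by rw [← Finset.sum_mul, hl, one_mul]

lemma le_tsum_qpow_sum_mul (hq : 0 ≤ q) (hq1 : q ≤ 1) (s : Finset ω) {p : ω → ℝ≥0∞}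
    (hp : ∑ w ∈ s, p w ≠ ∞) {x : ω → κ → ℝ≥0∞} {T : ℝ≥0∞}
    (hT : ∀ w ∈ s, T ≤ ∑' k, qpow q (x w k)) :
    qpow q (∑ w ∈ s, p w) * T ≤ ∑' k, qpow q (∑ w ∈ s, p w * x w k) := by
  by_cases hp0 : ∑ w ∈ s, p w = 0
  · simp [hp0]
  have hl := sum_div_sum_eq_one hp0 hp
  simp_rw [qpow_sum_mul_eq hq hp0 hp, ENNReal.tsum_mul_left]
  gcongr
  calc T = ∑ w ∈ s, p w / (∑ w ∈ s, p w) * T := by rw [← Finset.sum_mul, hl, one_mul]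
    _ ≤ ∑ w ∈ s, p w / (∑ w ∈ s, p w) * ∑' k, qpow q (x w k) := Finset.sum_le_sum fun w hw => by
        gcongr
        exact hT w hw
    _ = ∑' k, ∑ w ∈ s, p w / (∑ w ∈ s, p w) * qpow q (x w k) := (tsum_sum_mul s _ _).symm
    _ ≤ ∑' k, qpow q (∑ w ∈ s, p w / (∑ w ∈ s, p w) * x w k) :=
        ENNReal.tsum_le_tsum fun k => sum_mul_qpow_le hq hq1 s hl _

end qpow

/-! ### Mesh cubes -/

/-- The index of a cube of the `δ`-mesh that contains `x`. -/
noncomputable def meshCell {n : ℕ} (δ : ℝ) (x : Fin n → ℝ) : Fin n → ℤ := fun i => ⌊x i / δ⌋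

/-- The indices of mesh cubes at sup-distance at most `C` from the index `k`. -/
noncomputable def nearIndices {n : ℕ} (C : ℕ) (k : Fin n → ℤ) : Finset (Fin n → ℤ) :=
  Fintype.piFinset fun i => Finset.Icc (k i - C) (k i + C)

lemma mem_nearIndices {n C : ℕ} {k l : Fin n → ℤ} :
    l ∈ nearIndices C k ↔ ∀ i, k i - C ≤ l i ∧ l i ≤ k i + C := by
  simp [nearIndices, Fintype.mem_piFinset]

lemma mem_nearIndices_comm {n C : ℕ} {k l : Fin n → ℤ} :
    l ∈ nearIndices C k ↔ k ∈ nearIndices C l := by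
  simp only [mem_nearIndices]
  exact forall_congr' fun i => by omega

lemma card_nearIndices {n : ℕ} (C : ℕ) (k : Fin n → ℤ) :
    (nearIndices C k).card = (2 * C + 1) ^ n := by
  have hcard : ∀ i, (Finset.Icc (k i - C) (k i + C)).card = 2 * C + 1 := fun i => by
    rw [Int.card_Icc]
    omega
  simp [nearIndices, Fintype.card_piFinset, hcard]

lemma mem_meshCube_meshCell {n : ℕ} {δ : ℝ} (hδ : 0 < δ) (x : Fin n → ℝ) :
    x ∈ meshCube δ (meshCell δ x) := fun _ =>
  ⟨(le_div_iff₀ hδ).1 (Int.floor_le _), ((div_lt_iff₀ hδ).1 (Int.lt_floor_add_one _)).le⟩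

lemma measurableSet_meshCube {n : ℕ} (δ : ℝ) (k : Fin n → ℤ) : MeasurableSet (meshCube δ k) := by
  have hpi : meshCube δ k = Set.univ.pi fun i => Set.Icc ((k i : ℝ) * δ) (((k i : ℝ) + 1) * δ) := by
    ext x
    simp only [meshCube, Set.mem_ofPred_eq, Set.mem_univ_pi, Set.mem_Icc]
  rw [hpi]
  exact MeasurableSet.univ_pi fun _ => measurableSet_Icc

lemma dist_le_of_mem_meshCube {n : ℕ} {δ : ℝ} (hδ : 0 ≤ δ) {k : Fin n → ℤ} {x y : Fin n → ℝ}
    (hx : x ∈ meshCube δ k) (hy : y ∈ meshCube δ k) : dist x y ≤ δ := by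
  refine (dist_pi_le_iff hδ).2 fun i => ?_
  rw [Real.dist_eq, abs_le]
  constructor <;> linarith [(hx i).1, (hx i).2, (hy i).1, (hy i).2]

lemma mem_nearIndices_of_dist_le {n C : ℕ} {δ : ℝ} (hδ : 0 < δ) {k l : Fin n → ℤ}
    {x y : Fin n → ℝ} (hx : x ∈ meshCube δ k) (hy : y ∈ meshCube δ l) (h : dist x y ≤ C * δ) :
    l ∈ nearIndices (C + 1) k := by
  have index_le : ∀ a b : ℤ, (a : ℝ) * δ ≤ (b + 1 + C) * δ → a ≤ b + 1 + C := fun a b hab => by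
    exact_mod_cast le_of_mul_le_mul_right hab hδ
  rw [mem_nearIndices]
  intro i
  obtain ⟨hlower, hupper⟩ :=
    abs_le.1 ((Real.dist_eq _ _).symm.trans_le ((dist_le_pi_dist x y i).trans h))
  have hk_le := index_le (k i) (l i) (by linarith [(hx i).1, (hy i).2])
  have hl_le := index_le (l i) (k i) (by linarith [(hx i).2, (hy i).1])
  push_cast
  omega

lemma exists_card_le_of_dist_le {Ω : Type*} {n m : ℕ} {K : Set Ω}
    {F : Ω → Fin n → ℝ} {F' : Ω → Fin m → ℝ} {δ δ' : ℝ} (hδ : 0 ≤ δ) (hδ' : 0 < δ') {C : ℕ}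
    (h : ∀ x ∈ K, ∀ y ∈ K, dist (F x) (F y) ≤ δ → dist (F' x) (F' y) ≤ C * δ')
    (k : Fin n → ℤ) :
    ∃ T : Finset (Fin m → ℤ), T.card ≤ (2 * (C + 1) + 1) ^ m ∧
      ∀ l, (∃ x ∈ K, F x ∈ meshCube δ k ∧ F' x ∈ meshCube δ' l) → l ∈ T := by
  by_cases hk : ∃ x ∈ K, F x ∈ meshCube δ k
  · obtain ⟨x, hxK, hx⟩ := hk
    refine ⟨nearIndices (C + 1) (meshCell δ' (F' x)), (card_nearIndices _ _).le, ?_⟩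
    rintro l ⟨y, hyK, hy, hyl⟩
    exact mem_nearIndices_of_dist_le hδ' (mem_meshCube_meshCell hδ' _) hyl
      (h x hxK y hyK (dist_le_of_mem_meshCube hδ hx hy))
  · exact ⟨∅, by simp, fun l ⟨y, hyK, hy, _⟩ => (hk ⟨y, hyK, hy⟩).elim⟩

/-! ### Moments of the image of a measure -/

/-- The sum `∑_Q μ(F⁻¹ Q)^q` over the closed cubes of the `δ`-mesh, as an extended non-negative
real. Working with preimages allows to compare the images of one measure in different spaces. -/
noncomputable def imageMoment {Ω : Type*} [MeasurableSpace Ω] {n : ℕ} (q : ℝ) (μ : Measure Ω)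
    (F : Ω → Fin n → ℝ) (δ : ℝ) : ℝ≥0∞ :=
  ∑' k : Fin n → ℤ, qpow q (μ (F ⁻¹' meshCube δ k))

/-- The factor between the `q`-th moments of images in `ℝⁿ` and `ℝᵐ` when a cube of one mesh meets
only cubes at index distance at most `C + 1` of the other. -/
noncomputable def momentRatio (q : ℝ) (C n m : ℕ) : ℝ≥0∞ :=
  (((2 * (C + 1) + 1) ^ m : ℕ) : ℝ≥0∞) ^ q * ((2 * (C + 1) + 1) ^ n : ℕ)

lemma momentRatio_ne_top {q : ℝ} (hq : 0 ≤ q) (C n m : ℕ) : momentRatio q C n m ≠ ∞ :=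
  ENNReal.mul_ne_top (ENNReal.rpow_ne_top_of_nonneg hq (ENNReal.natCast_ne_top _))
    (ENNReal.natCast_ne_top _)

section imageMoment

variable {Ω : Type*} [MeasurableSpace Ω] {n m : ℕ} {q : ℝ} {μ : Measure Ω}

lemma meshMoment_map [IsFiniteMeasure μ] (hq : 0 ≤ q) {F : Ω → Fin n → ℝ} (hF : Measurable F)
    (δ : ℝ) : meshMoment (μ.map F) q δ = (imageMoment q μ F δ).toReal := by
  rw [imageMoment, ENNReal.tsum_toReal_eq fun k => qpow_ne_top hq (measure_ne_top _ _)]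
  refine tsum_congr fun k => ?_
  rw [Measure.map_apply hF (measurableSet_meshCube _ _)]
  split_ifs with h
  · simp [h]
  · rw [qpow_of_ne_zero h, ENNReal.toReal_rpow]

open Classical in
lemma measure_preimage_le_tsum {K : Set Ω} (hK : μ Kᶜ = 0) (s : Set Ω) (F : Ω → Fin n → ℝ)
    {δ : ℝ} (hδ : 0 < δ) :
    μ s ≤ ∑' l, if ∃ x ∈ K, x ∈ s ∧ F x ∈ meshCube δ l then μ (F ⁻¹' meshCube δ l) else 0 := by
  set t : (Fin n → ℤ) → Set Ω := fun l =>
    if ∃ x ∈ K, x ∈ s ∧ F x ∈ meshCube δ l then F ⁻¹' meshCube δ l else ∅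
  have hcover : s ⊆ Kᶜ ∪ ⋃ l, t l := fun x hx => by
    by_cases hxK : x ∈ K
    · have hcell := mem_meshCube_meshCell hδ (F x)
      refine Or.inr (Set.mem_iUnion.2 ⟨meshCell δ (F x), ?_⟩)
      simp only [t, if_pos (⟨x, hxK, hx, hcell⟩ : ∃ y ∈ K, y ∈ s ∧ F y ∈ meshCube δ _)]
      exact hcell
    · exact Or.inl hxK
  calc μ s ≤ μ Kᶜ + ∑' l, μ (t l) :=
        (measure_mono hcover).trans ((measure_union_le _ _).trans
          (by gcongr; exact measure_iUnion_le _))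
    _ = ∑' l, if ∃ x ∈ K, x ∈ s ∧ F x ∈ meshCube δ l then μ (F ⁻¹' meshCube δ l) else 0 := by
        rw [hK, zero_add]
        exact tsum_congr fun l => by simp only [t]; split_ifs <;> simp

lemma imageMoment_le_of_dist_le (hq : 0 ≤ q) {K : Set Ω} (hK : μ Kᶜ = 0) {F : Ω → Fin n → ℝ}
    {F' : Ω → Fin m → ℝ} {δ δ' : ℝ} (hδ : 0 < δ) (hδ' : 0 < δ') {C : ℕ}
    (h : ∀ x ∈ K, ∀ y ∈ K, dist (F x) (F y) ≤ δ → dist (F' x) (F' y) ≤ C * δ')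
    (h' : ∀ x ∈ K, ∀ y ∈ K, dist (F' x) (F' y) ≤ δ' → dist (F x) (F y) ≤ C * δ) :
    imageMoment q μ F δ ≤ momentRatio q C n m * imageMoment q μ F' δ' := by
  refine tsum_qpow_le_of_rel hq (fun k l => ∃ x ∈ K, F x ∈ meshCube δ k ∧ F' x ∈ meshCube δ' l)
    (exists_card_le_of_dist_le hδ.le hδ' h) (fun l => ?_) fun k => ?_
  · simpa only [and_comm] using exists_card_le_of_dist_le hδ'.le hδ h' l
  · exact measure_preimage_le_tsum hK _ F' hδ'

lemma imageMoment_ne_zero [NeZero μ] (hq : 0 ≤ q) (F : Ω → Fin n → ℝ) {δ : ℝ} (hδ : 0 < δ) :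
    imageMoment q μ F δ ≠ 0 := by
  intro h
  rw [imageMoment, ENNReal.tsum_eq_zero] at h
  have hnull : ∀ k : Fin n → ℤ, μ (F ⁻¹' meshCube δ k) = 0 := fun k =>
    by_contra fun hk => qpow_ne_zero hq hk (h k)
  have hcover : Set.univ ⊆ ⋃ k, F ⁻¹' meshCube δ k := fun x _ =>
    Set.mem_iUnion.2 ⟨_, mem_meshCube_meshCell hδ (F x)⟩
  exact NeZero.ne μ (Measure.measure_univ_eq_zero.1
    (measure_mono_null hcover (measure_iUnion_null hnull)))

lemma imageMoment_ne_top [IsFiniteMeasure μ] (hq : 0 ≤ q) {K : Set Ω} (hK : μ Kᶜ = 0)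
    {F : Ω → Fin n → ℝ} {δ : ℝ} (hδ : 0 < δ) {B : ℝ}
    (hB : ∀ x ∈ K, ∀ y ∈ K, dist (F x) (F y) ≤ B) : imageMoment q μ F δ ≠ ∞ := by
  rcases K.eq_empty_or_nonempty with rfl | ⟨x, hx⟩
  · have hnull : ∀ s, μ s = 0 := fun s => measure_mono_null (by simp) hK
    simp [imageMoment, hnull]
  obtain ⟨C, hC⟩ := exists_nat_ge (B / δ)
  rw [imageMoment, tsum_eq_sum_of_ne_zero_mem (T := nearIndices (C + 1) (meshCell δ (F x)))]
  · exact ENNReal.sum_ne_top.2 fun k _ => qpow_ne_top hq (measure_ne_top _ _)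
  · intro k hk
    obtain ⟨y, hyK, hy⟩ : ∃ y ∈ K, F y ∈ meshCube δ k := by
      by_contra! hout
      have hnull : μ (F ⁻¹' meshCube δ k) = 0 :=
        measure_mono_null (fun y hy hyK => hout y hyK hy) hK
      exact hk (by rw [hnull, qpow_zero_right])
    exact mem_nearIndices_of_dist_le hδ (mem_meshCube_meshCell hδ _) hy
      ((hB x hx y hyK).trans ((div_le_iff₀ hδ).1 hC))

lemma imageMoment_le_of_scale (hq : 0 ≤ q) (F : Ω → Fin n → ℝ) {δ δ' : ℝ} (hδ : 0 < δ)
    (hδ' : 0 < δ') {C : ℕ} (h : δ ≤ C * δ') (h' : δ' ≤ C * δ) :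
    imageMoment q μ F δ ≤ momentRatio q C n n * imageMoment q μ F δ' :=
  imageMoment_le_of_dist_le hq (K := Set.univ) (by simp) hδ hδ' (fun _ _ _ _ hd => hd.trans h)
    (fun _ _ _ _ hd => hd.trans h')

end imageMoment

/-! ### Growth exponents -/

lemma hasLqSpectrum_of_tendsto {n : ℕ} {ν : Measure (Fin n → ℝ)} {q τ : ℝ}
    (h : Tendsto (fun δ : ℝ => Real.log (meshMoment ν q δ) / (-Real.log δ)) (𝓝[>] 0) (𝓝 τ)) :
    HasLqSpectrum ν q τ :=
  have hEReal := (continuous_coe_real_ereal.tendsto τ).comp h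
  ⟨hEReal.liminf_eq, hEReal.limsup_eq⟩

lemma lqSpectrum_eq_of_tendsto {n : ℕ} {ν : Measure (Fin n → ℝ)} {q τ : ℝ}
    (h : Tendsto (fun δ : ℝ => Real.log (meshMoment ν q δ) / (-Real.log δ)) (𝓝[>] 0) (𝓝 τ)) :
    lqSpectrum ν q = τ := by
  rw [lqSpectrum, (hasLqSpectrum_of_tendsto h).2, EReal.toReal_coe]

lemma exists_tendsto_div_of_almost_subadditive {x : ℕ → ℝ} {C : ℝ}
    (hstep : ∀ n, x n - C ≤ x (n + 1)) (h : ∀ m n, x (m + n) ≤ x m + x n + C) :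
    ∃ L, Tendsto (fun n : ℕ => x n / n) atTop (𝓝 L) := by
  have hsub : Subadditive fun n => x n + C := fun m n => by linarith [h m n]
  have hlower : ∀ n : ℕ, x 0 - n * C ≤ x n := by
    intro n
    induction n with
    | zero => simp
    | succ n ih =>
      push_cast
      linarith [hstep n]
  have hbdd : BddBelow (Set.range fun n : ℕ => (x n + C) / n) := by
    refine ⟨-|x 0| - 2 * |C|, ?_⟩
    rintro _ ⟨n, rfl⟩
    rcases n.eq_zero_or_pos with rfl | hn
    · simp only [Nat.cast_zero, div_zero]
      linarith [abs_nonneg (x 0), abs_nonneg C]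
    · have hn1 : (1 : ℝ) ≤ n := by exact_mod_cast hn
      dsimp only
      rw [le_div_iff₀ (by linarith)]
      have hx0 : |x 0| ≤ |x 0| * n := le_mul_of_one_le_right (abs_nonneg _) hn1
      have hCn : |C| ≤ |C| * n := le_mul_of_one_le_right (abs_nonneg _) hn1
      have hnC : n * C ≤ |C| * n := by
        rw [mul_comm]
        gcongr
        exact le_abs_self C
      linarith [hlower n, neg_abs_le (x 0), neg_abs_le C]
  have hlim := (hsub.tendsto_lim hbdd).sub (tendsto_const_div_atTop_nhds_zero_nat C)
  exact ⟨hsub.lim - 0, hlim.congr fun n => by ring⟩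

lemma exists_tendsto_div_of_almost_superadditive {x : ℕ → ℝ} {C : ℝ}
    (hstep : ∀ n, x (n + 1) ≤ x n + C) (h : ∀ m n, x m + x n - C ≤ x (m + n)) :
    ∃ L, Tendsto (fun n : ℕ => x n / n) atTop (𝓝 L) := by
  obtain ⟨L, hL⟩ := exists_tendsto_div_of_almost_subadditive (x := fun n => -x n) (C := C)
    (fun n => by linarith [hstep n]) (fun m n => by linarith [h m n])
  exact ⟨-L, hL.neg.congr fun n => by ring⟩

lemma exists_abs_sub_le_of_tendsto_div {x : ℕ → ℝ} {L : ℝ}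
    (h : Tendsto (fun n : ℕ => x n / n) atTop (𝓝 L)) {η : ℝ} (hη : 0 < η) :
    ∃ c : ℝ, 0 ≤ c ∧ ∀ n : ℕ, |x n - L * n| ≤ c + η * n := by
  obtain ⟨N, hN⟩ := eventually_atTop.1 (Metric.tendsto_nhds.1 h η hη)
  refine ⟨∑ n ∈ Finset.range (N + 1), |x n - L * n|,
    Finset.sum_nonneg fun _ _ => abs_nonneg _, fun n => ?_⟩
  rcases Nat.lt_or_ge n (N + 1) with hn | hn
  · have hterm := Finset.single_le_sum (f := fun n : ℕ => |x n - L * n|)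
      (fun _ _ => abs_nonneg _) (Finset.mem_range.2 hn)
    have hηn : 0 ≤ η * n := by positivity
    linarith
  · have hn0 : (0 : ℝ) < n := by exact_mod_cast N.succ_pos.trans_le hn
    have hdist := (hN n (by omega)).le
    rw [Real.dist_eq, div_sub' hn0.ne', abs_div, abs_of_pos hn0, div_le_iff₀ hn0,
      mul_comm (n : ℝ) L] at hdist
    exact hdist.trans (le_add_of_nonneg_left (Finset.sum_nonneg fun _ _ => abs_nonneg _))

lemma tendsto_neg_log_nhdsGT_zero : Tendsto (fun δ : ℝ => -Real.log δ) (𝓝[>] 0) atTop :=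
  tendsto_neg_atBot_atTop.comp Real.tendsto_log_nhdsGT_zero

lemma tendsto_log_div_of_abs_log_sub_le {D D' : ℝ → ℝ} {τ C : ℝ}
    (hC : ∀ δ, 0 < δ → |Real.log (D δ) - Real.log (D' δ)| ≤ C)
    (h : Tendsto (fun δ : ℝ => Real.log (D' δ) / (-Real.log δ)) (𝓝[>] 0) (𝓝 τ)) :
    Tendsto (fun δ : ℝ => Real.log (D δ) / (-Real.log δ)) (𝓝[>] 0) (𝓝 τ) := by
  have hdiff : Tendsto (fun δ : ℝ => (Real.log (D δ) - Real.log (D' δ)) / (-Real.log δ))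
      (𝓝[>] 0) (𝓝 0) := by
    refine squeeze_zero_norm' ?_ (tendsto_neg_log_nhdsGT_zero.const_div_atTop C)
    filter_upwards [Ioo_mem_nhdsGT (zero_lt_one : (0 : ℝ) < 1)] with δ hδ
    have hlog : 0 < -Real.log δ := by linarith [Real.log_neg hδ.1 hδ.2]
    rw [Real.norm_eq_abs, abs_div, abs_of_pos hlog]
    exact div_le_div_of_nonneg_right (hC δ hδ.1) hlog.le
  have hsum := hdiff.add h
  rw [zero_add] at hsum
  exact hsum.congr fun δ => by rw [← add_div, sub_add_cancel]

lemma tendsto_log_div_of_abs_le {D : ℝ → ℝ} {τ : ℝ}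
    (h : ∀ η > 0, ∃ c : ℝ, ∀ δ, 0 < δ → δ ≤ 1 →
      |Real.log (D δ) + τ * Real.log δ| ≤ c + η * (-Real.log δ)) :
    Tendsto (fun δ : ℝ => Real.log (D δ) / (-Real.log δ)) (𝓝[>] 0) (𝓝 τ) := by
  refine Metric.tendsto_nhds.2 fun η hη => ?_
  obtain ⟨c, hc⟩ := h (η / 2) (by linarith)
  filter_upwards [Ioo_mem_nhdsGT (zero_lt_one : (0 : ℝ) < 1),
    tendsto_neg_log_nhdsGT_zero.eventually_gt_atTop (2 * c / η)] with δ hδ hsmall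
  have hlog : 0 < -Real.log δ := by linarith [Real.log_neg hδ.1 hδ.2]
  have hdiff : Real.log (D δ) / (-Real.log δ) - τ =
      (Real.log (D δ) + τ * Real.log δ) / (-Real.log δ) := by
    rw [eq_div_iff hlog.ne', sub_mul, div_mul_cancel₀ _ hlog.ne']
    ring
  rw [Real.dist_eq, hdiff, abs_div, abs_of_pos hlog, div_lt_iff₀ hlog]
  rw [div_lt_iff₀ hη] at hsmall
  linarith [hc δ hδ.1 hδ.2.le]

/-- A positive function of the scale that changes by a bounded factor between scales of bounded
ratio. The growth exponent of such a function is determined by its values at dyadic scales. -/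
structure ScaleRegular (D : ℝ → ℝ) : Prop where
  pos : ∀ δ, 0 < δ → 0 < D δ
  exists_le_mul : ∀ C : ℕ, ∃ B : ℝ, ∀ δ δ' : ℝ, 0 < δ → 0 < δ' → δ ≤ C * δ' → δ' ≤ C * δ →
    D δ ≤ B * D δ'

namespace ScaleRegular

variable {D : ℝ → ℝ}

lemma exists_abs_log_sub_le (hD : ScaleRegular D) (C : ℕ) :
    ∃ B : ℝ, ∀ δ δ' : ℝ, 0 < δ → 0 < δ' → δ ≤ C * δ' → δ' ≤ C * δ →
      |Real.log (D δ) - Real.log (D δ')| ≤ B := by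
  obtain ⟨B, hB⟩ := hD.exists_le_mul C
  have log_sub_le : ∀ δ δ' : ℝ, 0 < δ → 0 < δ' → δ ≤ C * δ' → δ' ≤ C * δ →
      Real.log (D δ) - Real.log (D δ') ≤ Real.log B := by
    intro δ δ' hδ hδ' hle hle'
    have hDδ := hD.pos δ hδ
    have hDδ' := hD.pos δ' hδ'
    have hBD := hB δ δ' hδ hδ' hle hle'
    have hB0 : 0 < B := pos_of_mul_pos_left (hDδ.trans_le hBD) hDδ'.le
    rw [sub_le_iff_le_add, ← Real.log_mul hB0.ne' hDδ'.ne']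
    exact Real.log_le_log hDδ hBD
  refine ⟨Real.log B, fun δ δ' hδ hδ' hle hle' =>
    abs_le.2 ⟨?_, log_sub_le δ δ' hδ hδ' hle hle'⟩⟩
  linarith [log_sub_le δ' δ hδ' hδ hle' hle]

lemma exists_abs_log_dyadic_sub_le (hD : ScaleRegular D) :
    ∃ B : ℝ, ∀ n : ℕ, |Real.log (D ((1 / 2) ^ n)) - Real.log (D ((1 / 2) ^ (n + 1)))| ≤ B := by
  obtain ⟨B, hB⟩ := hD.exists_abs_log_sub_le 2
  refine ⟨B, fun n => ?_⟩
  have hpow : (0 : ℝ) < (1 / 2) ^ n := by positivity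
  refine hB _ _ hpow (by positivity) ?_ ?_ <;>
  · rw [pow_succ]
    push_cast
    linarith

lemma exists_abs_log_add_le_of_dyadic (hD : ScaleRegular D) {L : ℝ}
    (h : Tendsto (fun n : ℕ => Real.log (D ((1 / 2) ^ n)) / n) atTop (𝓝 L)) {η : ℝ}
    (hη : 0 < η) : ∃ c : ℝ, ∀ δ, 0 < δ → δ ≤ 1 →
      |Real.log (D δ) + L / Real.log 2 * Real.log δ| ≤ c + η * (-Real.log δ) := by
  have hlog2 : 0 < Real.log 2 := Real.log_pos (by norm_num)
  obtain ⟨B, hB⟩ := hD.exists_abs_log_sub_le 2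
  obtain ⟨c, -, hc⟩ := exists_abs_sub_le_of_tendsto_div h (mul_pos hη hlog2)
  refine ⟨B + c + |L|, fun δ hδ hδ1 => ?_⟩
  obtain ⟨n, hlt, hle⟩ := exists_nat_pow_near_of_lt_one hδ hδ1 (by norm_num : (0 : ℝ) < 1 / 2)
    (by norm_num)
  have hpow : (0 : ℝ) < (1 / 2) ^ n := by positivity
  have log_pow : ∀ k : ℕ, Real.log ((1 / 2 : ℝ) ^ k) = -(k * Real.log 2) := fun k => by
    rw [Real.log_pow, one_div, Real.log_inv]
    ring
  have hlower : -((n + 1) * Real.log 2) ≤ Real.log δ := by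
    have := Real.log_le_log (by positivity) hlt.le
    rw [log_pow] at this
    exact_mod_cast this
  have hupper : Real.log δ ≤ -(n * Real.log 2) := log_pow n ▸ Real.log_le_log hδ hle
  have hround : |L / Real.log 2 * Real.log δ + L * n| ≤ |L| := by
    have hfactor : L / Real.log 2 * Real.log δ + L * n =
        L * ((Real.log δ + n * Real.log 2) / Real.log 2) := by field_simp
    rw [hfactor, abs_mul]
    refine mul_le_of_le_one_right (abs_nonneg L) ?_
    rw [abs_div, abs_of_pos hlog2, div_le_one hlog2, abs_le]
    constructor <;> linarith
  have hscale := hB δ ((1 / 2) ^ n) hδ hpow (by push_cast; linarith)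
    (by rw [pow_succ] at hlt; push_cast; linarith)
  have hηn := mul_le_mul_of_nonneg_left hupper hη.le
  have hn := hc n
  rw [abs_le] at hround hscale hn ⊢
  constructor <;> linarith

lemma tendsto_of_dyadic (hD : ScaleRegular D) {L : ℝ}
    (h : Tendsto (fun n : ℕ => Real.log (D ((1 / 2) ^ n)) / n) atTop (𝓝 L)) :
    Tendsto (fun δ : ℝ => Real.log (D δ) / (-Real.log δ)) (𝓝[>] 0) (𝓝 (L / Real.log 2)) :=
  tendsto_log_div_of_abs_le fun _ hη => hD.exists_abs_log_add_le_of_dyadic h hη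

lemma exists_abs_log_add_le (hD : ScaleRegular D) {τ : ℝ}
    (h : Tendsto (fun δ : ℝ => Real.log (D δ) / (-Real.log δ)) (𝓝[>] 0) (𝓝 τ)) {η : ℝ}
    (hη : 0 < η) : ∃ c : ℝ, ∀ δ, 0 < δ → δ ≤ 1 →
      |Real.log (D δ) + τ * Real.log δ| ≤ c + η * (-Real.log δ) := by
  have hlog2 : Real.log 2 ≠ 0 := (Real.log_pos (by norm_num)).ne'
  have hpow : Tendsto (fun n : ℕ => (1 / 2 : ℝ) ^ n) atTop (𝓝[>] 0) :=
    tendsto_nhdsWithin_iff.2 ⟨tendsto_pow_atTop_nhds_zero_of_lt_one (by norm_num) (by norm_num),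
      Eventually.of_forall fun n => Set.mem_Ioi.2 (by positivity)⟩
  have hdyadic : Tendsto (fun n : ℕ => Real.log (D ((1 / 2) ^ n)) / n) atTop
      (𝓝 (τ * Real.log 2)) := by
    refine ((h.comp hpow).mul_const (Real.log 2)).congr fun n => ?_
    simp only [Function.comp_apply]
    rw [Real.log_pow, one_div, Real.log_inv, mul_neg, neg_neg, ← div_div, div_mul_cancel₀ _ hlog2]
  simpa only [mul_div_cancel_right₀ _ hlog2] using hD.exists_abs_log_add_le_of_dyadic hdyadic hη

end ScaleRegular

namespace BoxLikeGIFS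

variable {V E : Type*} (G : BoxLikeGIFS V E)

/-! ### Words and paths -/

/-- The terminal vertex of a word that starts at `v`. -/
def terminal : V → List E → V
  | v, [] => v
  | _, e :: w => terminal (G.tgt e) w

/-- The word `w` is admissible and starts at `v`. Together with `terminal` this replaces the ternary
relation `IsPath`, so that sums over paths need not fix the terminal vertex. -/
def IsPathFrom : V → List E → Prop
  | _, [] => True
  | v, e :: w => G.src e = v ∧ IsPathFrom (G.tgt e) w

lemma isPath_iff {v v' : V} {w : List E} :
    G.IsPath v w v' ↔ G.IsPathFrom v w ∧ G.terminal v w = v' := by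
  induction w generalizing v with
  | nil => simp [IsPath, IsPathFrom, terminal]
  | cons e w ih => simp [IsPath, IsPathFrom, terminal, ih, and_assoc]

@[simp] lemma terminal_nil (v : V) : G.terminal v [] = v := rfl

@[simp] lemma isPathFrom_nil (v : V) : G.IsPathFrom v [] := trivial

lemma terminal_append (v : V) (u w : List E) :
    G.terminal v (u ++ w) = G.terminal (G.terminal v u) w := by
  induction u generalizing v with
  | nil => rfl
  | cons e _ ih => exact ih _

lemma isPathFrom_append {v : V} {u w : List E} :
    G.IsPathFrom v (u ++ w) ↔ G.IsPathFrom v u ∧ G.IsPathFrom (G.terminal v u) w := by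
  induction u generalizing v with
  | nil => simp
  | cons e u ih => simp [IsPathFrom, terminal, ih, and_assoc]

lemma isPathFrom_singleton {v : V} {e : E} : G.IsPathFrom v [e] ↔ G.src e = v := by
  simp [IsPathFrom]

@[simp] lemma terminal_singleton (v : V) (e : E) : G.terminal v [e] = G.tgt e := rfl

section Fintype

variable [Fintype E]

open Classical in
/-- The edges that start at `v`. -/
noncomputable def outEdges (v : V) : Finset E := {e | G.src e = v}

@[simp] lemma mem_outEdges {v : V} {e : E} : e ∈ G.outEdges v ↔ G.src e = v := by
  simp [outEdges]

open Classical in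
/-- The admissible words of length `n` that start at `v`. -/
noncomputable def paths (n : ℕ) (v : V) : Finset (List E) :=
  {w ∈ (List.finite_length_eq E n).toFinset | G.IsPathFrom v w}

@[simp] lemma mem_paths {n : ℕ} {v : V} {w : List E} :
    w ∈ G.paths n v ↔ w.length = n ∧ G.IsPathFrom v w := by
  simp [paths]

lemma paths_zero (v : V) : G.paths 0 v = {[]} := by
  ext w
  simp only [mem_paths, List.length_eq_zero_iff, Finset.mem_singleton]
  exact ⟨fun h => h.1, fun h => ⟨h, h ▸ G.isPathFrom_nil v⟩⟩

lemma sum_paths_add {M : Type*} [AddCommMonoid M] (m n : ℕ) (v : V) (f : List E → M) :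
    ∑ w ∈ G.paths (m + n) v, f w =
      ∑ u ∈ G.paths m v, ∑ w ∈ G.paths n (G.terminal v u), f (u ++ w) := by
  rw [Finset.sum_sigma']
  symm
  refine Finset.sum_bij' (fun x _ => x.1 ++ x.2) (fun w _ => ⟨w.take m, w.drop m⟩) ?_ ?_ ?_
    (fun w _ => List.take_append_drop m w) fun _ _ => rfl
  · rintro ⟨u, w⟩ h
    simp only [Finset.mem_sigma, mem_paths] at h
    simp [h, isPathFrom_append]
  · intro w h
    rw [mem_paths] at h
    have hpath := h.2
    rw [← List.take_append_drop m w, isPathFrom_append] at hpath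
    simp [h, hpath]
  · rintro ⟨u, w⟩ h
    simp only [Finset.mem_sigma, mem_paths] at h
    simp [← h.1.1]

lemma sum_paths_one {M : Type*} [AddCommMonoid M] (v : V) (f : List E → M) :
    ∑ w ∈ G.paths 1 v, f w = ∑ e ∈ G.outEdges v, f [e] := by
  symm
  refine Finset.sum_bij (fun e _ => [e]) ?_ (by simp) ?_ fun _ _ => rfl
  · intro e he
    simpa [IsPathFrom] using he
  · intro w hw
    rw [mem_paths, List.length_eq_one_iff] at hw
    obtain ⟨⟨e, rfl⟩, h⟩ := hw
    exact ⟨e, by simpa [IsPathFrom] using h, rfl⟩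

lemma sum_paths_succ {M : Type*} [AddCommMonoid M] (n : ℕ) (v : V) (f : List E → M) :
    ∑ w ∈ G.paths (n + 1) v, f w =
      ∑ u ∈ G.paths n v, ∑ e ∈ G.outEdges (G.terminal v u), f (u ++ [e]) := by
  rw [sum_paths_add]
  exact Finset.sum_congr rfl fun u _ => G.sum_paths_one _ _

lemma sum_paths_succ' {M : Type*} [AddCommMonoid M] (n : ℕ) (v : V) (f : List E → M) :
    ∑ w ∈ G.paths (n + 1) v, f w =
      ∑ e ∈ G.outEdges v, ∑ w ∈ G.paths n (G.tgt e), f (e :: w) := by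
  rw [add_comm, sum_paths_add, sum_paths_one]
  rfl

end Fintype

end BoxLikeGIFS

/-! ### Stopping words -/

/-- A function of words that is `1` at the empty word and decreases by a factor in `[a, b]` with
every letter. -/
structure IsScale {E : Type*} (ρ : List E → ℝ) (a b : ℝ) : Prop where
  nil : ρ [] = 1
  lower_pos : 0 < a
  upper_pos : 0 < b
  upper_lt_one : b < 1
  le_snoc : ∀ u e, a * ρ u ≤ ρ (u ++ [e])
  snoc_le : ∀ u e, ρ (u ++ [e]) ≤ b * ρ u

namespace IsScale

variable {E : Type*} {ρ : List E → ℝ} {a b : ℝ}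

lemma pos (hρ : IsScale ρ a b) (w : List E) : 0 < ρ w := by
  induction w using List.reverseRecOn with
  | nil => simp [hρ.nil]
  | append_singleton u e ih => exact (mul_pos hρ.lower_pos ih).trans_le (hρ.le_snoc u e)

lemma snoc_lt (hρ : IsScale ρ a b) (u : List E) (e : E) : ρ (u ++ [e]) < ρ u :=
  (hρ.snoc_le u e).trans_lt (mul_lt_of_lt_one_left (hρ.pos u) hρ.upper_lt_one)

lemma append_le (hρ : IsScale ρ a b) (u w : List E) : ρ (u ++ w) ≤ ρ u := by
  induction w using List.reverseRecOn with
  | nil => simp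
  | append_singleton w e ih =>
    rw [← List.append_assoc]
    exact (hρ.snoc_lt _ e).le.trans ih

lemma le_pow (hρ : IsScale ρ a b) (w : List E) : ρ w ≤ b ^ w.length := by
  induction w using List.reverseRecOn with
  | nil => simp [hρ.nil]
  | append_singleton u e ih =>
    rw [List.length_append, List.length_singleton, pow_succ']
    exact (hρ.snoc_le u e).trans (mul_le_mul_of_nonneg_left ih hρ.upper_pos.le)

lemma pow_le (hρ : IsScale ρ a b) (w : List E) : a ^ w.length ≤ ρ w := by
  induction w using List.reverseRecOn with
  | nil => simp [hρ.nil]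
  | append_singleton u e ih =>
    rw [List.length_append, List.length_singleton, pow_succ']
    exact (mul_le_mul_of_nonneg_left ih hρ.lower_pos.le).trans (hρ.le_snoc u e)

lemma exists_length_lt (hρ : IsScale ρ a b) {δ : ℝ} (hδ : 0 < δ) :
    ∃ N : ℕ, ∀ u : List E, δ ≤ ρ u → u.length < N := by
  obtain ⟨N, hN⟩ := exists_pow_lt_of_lt_one hδ hρ.upper_lt_one
  refine ⟨N, fun u hu => lt_of_not_ge fun h => ?_⟩
  have hpow := pow_le_pow_of_le_one hρ.upper_pos.le hρ.upper_lt_one.le h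
  linarith [hρ.le_pow u]

end IsScale

namespace BoxLikeGIFS

variable {V E : Type*} {G : BoxLikeGIFS V E} {ρ : List E → ℝ} {a b δ : ℝ}

/-- `w` is a word from `v` at which `ρ` falls below `δ` for the first time. As `dropLast [] = []`,
the empty word never qualifies. -/
def IsStop (G : BoxLikeGIFS V E) (ρ : List E → ℝ) (δ : ℝ) (v : V) (w : List E) : Prop :=
  G.IsPathFrom v w ∧ ρ w < δ ∧ δ ≤ ρ w.dropLast

/-- `w` is a word from `v` along which `ρ` has not yet fallen below `δ`. -/
def IsLive (G : BoxLikeGIFS V E) (ρ : List E → ℝ) (δ : ℝ) (v : V) (w : List E) : Prop :=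
  G.IsPathFrom v w ∧ δ ≤ ρ w

lemma not_isStop_nil (v : V) : ¬ G.IsStop ρ δ v [] := fun h => absurd h.2.2 h.2.1.not_ge

lemma isLive_nil (hρ : IsScale ρ a b) (hδ1 : δ ≤ 1) (v : V) : G.IsLive ρ δ v [] :=
  ⟨G.isPathFrom_nil v, hρ.nil ▸ hδ1⟩

lemma isLive_or_isStop_concat (hρ : IsScale ρ a b) {v : V} {u : List E} {e : E} :
    G.IsLive ρ δ v (u ++ [e]) ∨ G.IsStop ρ δ v (u ++ [e]) ↔
      G.IsLive ρ δ v u ∧ G.src e = G.terminal v u := by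
  simp only [IsLive, IsStop, isPathFrom_append, isPathFrom_singleton, List.dropLast_concat]
  have hlt := hρ.snoc_lt u e
  constructor
  · rintro (⟨h, hδ⟩ | ⟨h, -, hδ⟩)
    exacts [⟨⟨h.1, hδ.trans hlt.le⟩, h.2⟩, ⟨⟨h.1, hδ⟩, h.2⟩]
  · rintro ⟨⟨hu, hδ⟩, he⟩
    exact (le_or_gt δ (ρ (u ++ [e]))).imp (fun h => ⟨⟨hu, he⟩, h⟩) fun h => ⟨⟨hu, he⟩, h, hδ⟩

lemma IsStop.mul_le (hρ : IsScale ρ a b) {v : V} {w : List E} (h : G.IsStop ρ δ v w) :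
    a * δ ≤ ρ w := by
  induction w using List.reverseRecOn with
  | nil => exact (not_isStop_nil v h).elim
  | append_singleton u e _ =>
    have hu : δ ≤ ρ u := by simpa only [List.dropLast_concat] using h.2.2
    exact (mul_le_mul_of_nonneg_left hu hρ.lower_pos.le).trans (hρ.le_snoc u e)

lemma IsStop.not_isPrefix (hρ : IsScale ρ a b) {v v' : V} {u w : List E} (hu : G.IsStop ρ δ v u)
    (hw : G.IsStop ρ δ v' w) (hne : u ≠ w) : ¬ u <+: w := by
  rintro ⟨t, rfl⟩
  induction t using List.reverseRecOn with
  | nil => simp at hne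
  | append_singleton t e _ =>
    have hlive : δ ≤ ρ (u ++ t) := by
      simpa only [← List.append_assoc, List.dropLast_concat] using hw.2.2
    linarith [hρ.append_le u t, hu.2.1]

section Finite

variable [Finite E]

lemma finite_isLive (hρ : IsScale ρ a b) (hδ : 0 < δ) (v : V) : {w | G.IsLive ρ δ v w}.Finite := by
  obtain ⟨N, hN⟩ := hρ.exists_length_lt hδ
  exact (List.finite_length_lt E N).subset fun w hw => hN w hw.2

lemma finite_isStop (hρ : IsScale ρ a b) (hδ : 0 < δ) (v : V) : {w | G.IsStop ρ δ v w}.Finite := by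
  obtain ⟨N, hN⟩ := hρ.exists_length_lt hδ
  refine (List.finite_length_le E N).subset fun w hw => ?_
  have hlen := hN _ hw.2.2
  rw [List.length_dropLast] at hlen
  simp only [Set.mem_ofPred_eq]
  omega

variable (G) in
/-- The finite set of words from `v` at which `ρ` falls below `δ`. -/
noncomputable def stopSet (hρ : IsScale ρ a b) (hδ : 0 < δ) (v : V) : Finset (List E) :=
  (finite_isStop (G := G) hρ hδ v).toFinset

variable (G) in
/-- The finite set of words from `v` along which `ρ` has not yet fallen below `δ`. -/
noncomputable def liveSet (hρ : IsScale ρ a b) (hδ : 0 < δ) (v : V) : Finset (List E) :=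
  (finite_isLive (G := G) hρ hδ v).toFinset

@[simp] lemma mem_stopSet {hρ : IsScale ρ a b} {hδ : 0 < δ} {v : V} {w : List E} :
    w ∈ G.stopSet hρ hδ v ↔ G.IsStop ρ δ v w := by
  simp [stopSet]

@[simp] lemma mem_liveSet {hρ : IsScale ρ a b} {hδ : 0 < δ} {v : V} {w : List E} :
    w ∈ G.liveSet hρ hδ v ↔ G.IsLive ρ δ v w := by
  simp [liveSet]

lemma disjoint_liveSet_stopSet (hρ : IsScale ρ a b) (hδ : 0 < δ) (v : V) :
    Disjoint (G.liveSet hρ hδ v) (G.stopSet hρ hδ v) :=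
  Finset.disjoint_left.2 fun _ hlive hfirst =>
    absurd (mem_liveSet.1 hlive).2 (mem_stopSet.1 hfirst).2.1.not_ge

end Finite

section Fintype

variable [Fintype E]

open Classical in
lemma sum_liveSet_snoc (hρ : IsScale ρ a b) (hδ : 0 < δ) (v : V) {M : Type*} [AddCommMonoid M]
    (f : List E → M) :
    ∑ u ∈ G.liveSet hρ hδ v, ∑ e ∈ G.outEdges (G.terminal v u), f (u ++ [e]) =
      ∑ w ∈ (G.liveSet hρ hδ v).erase [] ∪ G.stopSet hρ hδ v, f w := by
  rw [Finset.sum_sigma']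
  refine Finset.sum_bij (fun x _ => x.1 ++ [x.2]) ?_ ?_ ?_ fun _ _ => rfl
  · rintro ⟨u, e⟩ h
    simp only [Finset.mem_sigma, mem_liveSet, mem_outEdges] at h
    simpa using (isLive_or_isStop_concat hρ).2 h
  · rintro ⟨u, e⟩ _ ⟨u', e'⟩ _ h
    obtain ⟨rfl, he⟩ := List.append_inj' h rfl
    rw [show e = e' from List.singleton_inj.1 he]
  · intro w hw
    induction w using List.reverseRecOn with
    | nil => simp [not_isStop_nil] at hw
    | append_singleton u e _ =>
      refine ⟨⟨u, e⟩, ?_, rfl⟩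
      simp only [Finset.mem_sigma, mem_liveSet, mem_outEdges]
      exact (isLive_or_isStop_concat hρ).1 (by simpa using hw)

/-- The tree of live words and its leaves, the stopping words: every word other than the root is a
child of exactly one live word. -/
lemma add_sum_liveSet_snoc (hρ : IsScale ρ a b) (hδ : 0 < δ) (hδ1 : δ ≤ 1) (v : V) {M : Type*}
    [AddCommMonoid M] (f : List E → M) :
    f [] + ∑ u ∈ G.liveSet hρ hδ v, ∑ e ∈ G.outEdges (G.terminal v u), f (u ++ [e]) =
      ∑ u ∈ G.liveSet hρ hδ v, f u + ∑ w ∈ G.stopSet hρ hδ v, f w := by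
  classical
  rw [sum_liveSet_snoc, Finset.sum_union
      ((disjoint_liveSet_stopSet hρ hδ v).mono_left (Finset.erase_subset _ _)), ← add_assoc,
    Finset.add_sum_erase _ _ (mem_liveSet.2 (isLive_nil hρ hδ1 v))]

lemma eq_sum_stopSet (hρ : IsScale ρ a b) (hδ : 0 < δ) (hδ1 : δ ≤ 1) (v : V) {f : List E → ℝ≥0∞}
    (hfin : ∀ u, f u ≠ ∞)
    (hf : ∀ u, G.IsPathFrom v u → f u = ∑ e ∈ G.outEdges (G.terminal v u), f (u ++ [e])) :
    f [] = ∑ w ∈ G.stopSet hρ hδ v, f w := by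
  have htree := add_sum_liveSet_snoc (G := G) hρ hδ hδ1 v f
  have hchildren : ∑ u ∈ G.liveSet hρ hδ v, ∑ e ∈ G.outEdges (G.terminal v u), f (u ++ [e]) =
      ∑ u ∈ G.liveSet hρ hδ v, f u :=
    Finset.sum_congr rfl fun u hu => (hf u (mem_liveSet.1 hu).1).symm
  rw [hchildren, add_comm] at htree
  exact (ENNReal.add_right_inj (ENNReal.sum_ne_top.2 fun u _ => hfin u)).1 htree

lemma le_sum_stopSet (hρ : IsScale ρ a b) (hδ : 0 < δ) (hδ1 : δ ≤ 1) (v : V) {f : List E → ℝ}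
    (hf : ∀ u, G.IsLive ρ δ v u → f u ≤ ∑ e ∈ G.outEdges (G.terminal v u), f (u ++ [e])) :
    f [] ≤ ∑ w ∈ G.stopSet hρ hδ v, f w := by
  have htree := add_sum_liveSet_snoc (G := G) hρ hδ hδ1 v f
  have hchildren : ∑ u ∈ G.liveSet hρ hδ v, f u ≤
      ∑ u ∈ G.liveSet hρ hδ v, ∑ e ∈ G.outEdges (G.terminal v u), f (u ++ [e]) :=
    Finset.sum_le_sum fun u hu => hf u (mem_liveSet.1 hu)
  linarith

end Fintype

end BoxLikeGIFS

/-! ### Singular values of matrices with orthogonal columns -/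

section SingularValues

open Matrix

lemma image_singularValues_of_conjTranspose_mul {𝕜 m n : Type*} [RCLike 𝕜] [Fintype m]
    [Fintype n] [DecidableEq n] {A : Matrix m n 𝕜} {r : n → ℝ} (hr : ∀ i, 0 ≤ r i)
    (hA : Aᴴ * A = diagonal fun i => ((r i ^ 2 : ℝ) : 𝕜)) :
    (toEuclideanLin A).singularValues '' Set.Iio (Fintype.card n) = Set.range r := by
  classical
  set T := toEuclideanLin A with hT
  have hfin : Module.finrank 𝕜 (EuclideanSpace 𝕜 n) = Fintype.card n := by simp
  have hTT : LinearMap.adjoint T ∘ₗ T = toLin (EuclideanSpace.basisFun n 𝕜).toBasis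
      (EuclideanSpace.basisFun n 𝕜).toBasis (diagonal fun i => ((r i ^ 2 : ℝ) : 𝕜)) := by
    rw [hT, ← toEuclideanLin_conjTranspose_eq_adjoint, ← hA, toEuclideanLin_eq_toLin_orthonormal,
      toEuclideanLin_eq_toLin_orthonormal,
      Matrix.toLin_mul _ (EuclideanSpace.basisFun m 𝕜).toBasis]
  refine Set.Subset.antisymm ?_ ?_
  · rintro _ ⟨k, hk, rfl⟩
    have heig := T.hasEigenvalue_adjoint_comp_self_sq_singularValues (n := k) (hfin.symm ▸ hk)
    rw [hTT, hasEigenvalue_toLin_diagonal_iff] at heig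
    obtain ⟨i, hi⟩ := heig
    exact ⟨i, (sq_eq_sq₀ (hr i) (T.singularValues_nonneg k)).1 (by exact_mod_cast hi)⟩
  · rintro _ ⟨i, rfl⟩
    have heig : Module.End.HasEigenvalue (LinearMap.adjoint T ∘ₗ T) ((r i ^ 2 : ℝ) : 𝕜) := by
      rw [hTT, hasEigenvalue_toLin_diagonal_iff]
      exact ⟨i, rfl⟩
    obtain ⟨k, hk⟩ := T.isSymmetric_adjoint_comp_self.exists_eigenvalues_eq hfin heig
    refine ⟨k, k.2, (sq_eq_sq₀ (T.singularValues_nonneg k) (hr i)).1 ?_⟩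
    rw [T.sq_singularValues_fin hfin]
    exact_mod_cast hk

lemma singularValues_eq_max_min_of_conjTranspose_mul {𝕜 : Type*} [RCLike 𝕜]
    {A : Matrix (Fin 2) (Fin 2) 𝕜} {r : Fin 2 → ℝ} (hr : ∀ i, 0 ≤ r i)
    (hA : Aᴴ * A = diagonal fun i => ((r i ^ 2 : ℝ) : 𝕜)) :
    (toEuclideanLin A).singularValues 0 = max (r 0) (r 1) ∧
      (toEuclideanLin A).singularValues 1 = min (r 0) (r 1) := by
  have hanti := (toEuclideanLin A).singularValues_antitone zero_le_one
  have himage := image_singularValues_of_conjTranspose_mul hr hA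
  have hIio : Set.Iio (Fintype.card (Fin 2)) = {0, 1} := by
    ext k
    simp only [Fintype.card_fin, Set.mem_Iio, Set.mem_insert_iff, Set.mem_singleton_iff]
    omega
  have hrange : Set.range r = {r 0, r 1} := by
    ext x
    simp [Fin.exists_fin_two, eq_comm]
  rw [hIio, hrange, Set.image_pair, Set.pair_eq_pair_iff] at himage
  rcases himage with ⟨h0, h1⟩ | ⟨h0, h1⟩ <;> rw [h0, h1] at hanti ⊢
  · exact ⟨(max_eq_left hanti).symm, (min_eq_right hanti).symm⟩
  · exact ⟨(max_eq_right hanti).symm, (min_eq_left hanti).symm⟩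

end SingularValues

namespace BoxLikeGIFS

variable {V E : Type*} (G : BoxLikeGIFS V E)

/-! ### Coordinates of the maps -/

open Classical in
/-- `0` if `T_e` is diagonal, `1` if it is anti-diagonal. -/
noncomputable def flip (e : E) : Fin 2 := if IsBoxDiagonal (G.lin e) then 0 else 1

/-- The non-zero entry of the `i`-th row of `T_e`. -/
noncomputable def ratio (e : E) (i : Fin 2) : ℝ := G.lin e i (i + G.flip e)

lemma lin_apply (e : E) (i j : Fin 2) :
    G.lin e i j = if j = i + G.flip e then G.ratio e i else 0 := by
  by_cases h : IsBoxDiagonal (G.lin e)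
  · have hflip : G.flip e = 0 := by simp [flip, h]
    obtain ⟨a, b, -, -, -, -, hT⟩ := h
    fin_cases i <;> fin_cases j <;> simp [hflip, ratio, hT]
  · have hflip : G.flip e = 1 := by simp [flip, h]
    obtain ⟨a, b, -, -, -, -, hT⟩ := (G.boxLike e).resolve_left h
    fin_cases i <;> fin_cases j <;> simp [hflip, ratio, hT]

lemma abs_ratio_mem_Ioo (e : E) (i : Fin 2) : |G.ratio e i| ∈ Set.Ioo 0 1 := by
  by_cases h : IsBoxDiagonal (G.lin e)
  · have hflip : G.flip e = 0 := by simp [flip, h]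
    obtain ⟨a, b, ha, ha1, hb, hb1, hT⟩ := h
    fin_cases i <;> simp_all [ratio]
  · have hflip : G.flip e = 1 := by simp [flip, h]
    obtain ⟨a, b, ha, ha1, hb, hb1, hT⟩ := (G.boxLike e).resolve_left h
    fin_cases i <;> simp_all [ratio]

lemma psi_apply (e : E) (ξ : Fin 2 → ℝ) (i : Fin 2) :
    G.psi e ξ i = G.ratio e i * ξ (i + G.flip e) + G.trans e i := by
  simp only [psi, Pi.add_apply, Matrix.mulVec, dotProduct, lin_apply, ite_mul, zero_mul,
    Finset.sum_ite_eq', Finset.mem_univ, if_true]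

/-- The parity of the number of anti-diagonal factors of `T_w`. -/
noncomputable def flipWord (w : List E) : Fin 2 := (w.map G.flip).sum

/-- The coordinate on which the `i`-th coordinate of `ψ_w` depends. -/
noncomputable def inputCoord (w : List E) (i : Fin 2) : Fin 2 := i + G.flipWord w

/-- The non-zero entry of the `i`-th row of `T_w`. -/
noncomputable def coef : List E → Fin 2 → ℝ
  | [], _ => 1
  | e :: w, i => G.ratio e i * coef w (i + G.flip e)

/-- The length of the side of `ψ_w([0,1]²)` parallel to the `i`-th axis. -/
noncomputable def side (w : List E) (i : Fin 2) : ℝ := |G.coef w i|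

@[simp] lemma inputCoord_nil (i : Fin 2) : G.inputCoord [] i = i := by simp [inputCoord, flipWord]

lemma inputCoord_cons (e : E) (w : List E) (i : Fin 2) :
    G.inputCoord (e :: w) i = G.inputCoord w (i + G.flip e) := by
  simp [inputCoord, flipWord, add_assoc]

lemma inputCoord_injective (w : List E) : Function.Injective (G.inputCoord w) :=
  add_left_injective _

lemma coef_append (u w : List E) (i : Fin 2) :
    G.coef (u ++ w) i = G.coef u i * G.coef w (G.inputCoord u i) := by
  induction u generalizing i with
  | nil => simp [coef]
  | cons e u ih => simp [coef, ih, inputCoord_cons, mul_assoc]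

@[simp] lemma side_nil (i : Fin 2) : G.side [] i = 1 := by simp [side, coef]

lemma side_append (u w : List E) (i : Fin 2) :
    G.side (u ++ w) i = G.side u i * G.side w (G.inputCoord u i) := by
  simp [side, coef_append, abs_mul]

lemma side_singleton (e : E) (i : Fin 2) : G.side [e] i = |G.ratio e i| := by simp [side, coef]

lemma side_pos (w : List E) (i : Fin 2) : 0 < G.side w i := by
  induction w generalizing i with
  | nil => simp
  | cons e w ih =>
    rw [← List.singleton_append, side_append, side_singleton]
    exact mul_pos (G.abs_ratio_mem_Ioo e i).1 (ih _)

lemma linWord_apply (w : List E) (i j : Fin 2) :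
    G.linWord w i j = if j = G.inputCoord w i then G.coef w i else 0 := by
  induction w generalizing i with
  | nil => simp [linWord, coef, Matrix.one_apply, eq_comm]
  | cons e w ih =>
    have hcons : G.linWord (e :: w) = G.lin e * G.linWord w := by simp [linWord]
    rw [hcons, Matrix.mul_apply, inputCoord_cons]
    simp only [lin_apply, ite_mul, zero_mul, Finset.sum_ite_eq', Finset.mem_univ, if_true]
    simp only [ih, coef, mul_ite, mul_zero]

lemma psiWord_append (u w : List E) : G.psiWord (u ++ w) = G.psiWord u ∘ G.psiWord w := by
  induction u with
  | nil => rfl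
  | cons e u ih => simp [psiWord, ih, Function.comp_assoc]

lemma psiWord_singleton (e : E) : G.psiWord [e] = G.psi e := by simp [psiWord]

lemma psiWord_sub (w : List E) (ξ η : Fin 2 → ℝ) (i : Fin 2) :
    G.psiWord w ξ i - G.psiWord w η i =
      G.coef w i * (ξ (G.inputCoord w i) - η (G.inputCoord w i)) := by
  induction w generalizing i with
  | nil => simp [psiWord, coef]
  | cons e w ih =>
    simp only [psiWord, Function.comp_apply, psi_apply, coef, inputCoord_cons]
    rw [mul_assoc, ← ih]
    ring

lemma dist_psiWord (w : List E) (ξ η : Fin 2 → ℝ) (i : Fin 2) :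
    dist (G.psiWord w ξ i) (G.psiWord w η i) =
      G.side w i * dist (ξ (G.inputCoord w i)) (η (G.inputCoord w i)) := by
  rw [Real.dist_eq, psiWord_sub, abs_mul, Real.dist_eq, side]

lemma continuous_psi (e : E) : Continuous (G.psi e) := by
  refine continuous_pi fun i => ?_
  simp_rw [psi_apply]
  fun_prop

lemma continuous_psiWord (w : List E) : Continuous (G.psiWord w) := by
  induction w with
  | nil => exact continuous_id
  | cons e w ih => exact (G.continuous_psi e).comp ih

lemma sideLength_eq (i : Fin 2) (w : List E) : G.sideLength i w = G.side w i := by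
  change Metric.diam ((fun ξ : Fin 2 → ℝ => ξ i) '' (G.psiWord w '' Set.Icc 0 1)) = _
  set S := (fun ξ : Fin 2 → ℝ => ξ i) '' (G.psiWord w '' Set.Icc 0 1)
  have hle : ∀ x ∈ S, ∀ y ∈ S, dist x y ≤ G.side w i := by
    rintro _ ⟨_, ⟨ξ, hξ, rfl⟩, rfl⟩ _ ⟨_, ⟨η, hη, rfl⟩, rfl⟩
    dsimp only
    rw [dist_psiWord]
    exact mul_le_of_le_one_right (G.side_pos w i).le
      (Real.dist_le_of_mem_Icc_01 ⟨hξ.1 _, hξ.2 _⟩ ⟨hη.1 _, hη.2 _⟩)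
  refine le_antisymm (Metric.diam_le_of_forall_dist_le (G.side_pos w i).le hle) ?_
  have hzero : G.psiWord w 0 i ∈ S := ⟨_, ⟨0, ⟨le_rfl, zero_le_one⟩, rfl⟩, rfl⟩
  have hone : G.psiWord w 1 i ∈ S := ⟨_, ⟨1, ⟨zero_le_one, le_rfl⟩, rfl⟩, rfl⟩
  calc G.side w i = dist (G.psiWord w 1 i) (G.psiWord w 0 i) := by simp [dist_psiWord]
    _ ≤ Metric.diam S := Metric.dist_le_diam_of_mem (Metric.isBounded_iff.2 ⟨_, hle⟩) hone hzero

lemma isDiag_linWord_iff (w : List E) : (G.linWord w).IsDiag ↔ G.flipWord w = 0 := by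
  have hc : G.coef w 0 ≠ 0 := abs_pos.1 (G.side_pos w 0)
  constructor
  · intro h
    by_contra h0
    have hidx : G.inputCoord w 0 = 1 := by
      rw [inputCoord, zero_add]
      omega
    have hentry : G.linWord w 0 1 = 0 := h (show (0 : Fin 2) ≠ 1 by decide)
    rw [linWord_apply, if_pos hidx.symm] at hentry
    exact hc hentry
  · intro h i j hij
    rw [linWord_apply, if_neg]
    rw [inputCoord, h, add_zero]
    exact hij.symm

/-- The direction of the longest side of `ψ_w([0,1]²)`. -/
noncomputable def longDir (w : List E) : Fin 2 :=
  open Classical in if G.side w 1 ≤ G.side w 0 then 0 else 1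

lemma projIndex_eq (w : List E) : G.projIndex w = G.inputCoord w (G.longDir w) := by
  simp only [projIndex, isDiag_linWord_iff, sideLength_eq, longDir, inputCoord]
  by_cases h : G.flipWord w = 0
  · simp [h]
  · have hflip : G.flipWord w = 1 := by omega
    by_cases hside : G.side w 1 ≤ G.side w 0 <;> simp [hflip, hside]

/-- The length of the shortest side of `ψ_w([0,1]²)`. -/
noncomputable def shortSide (w : List E) : ℝ := min (G.side w 0) (G.side w 1)

/-- The length of the longest side of `ψ_w([0,1]²)`. -/
noncomputable def longSide (w : List E) : ℝ := max (G.side w 0) (G.side w 1)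

lemma shortSide_pos (w : List E) : 0 < G.shortSide w := lt_min (G.side_pos w 0) (G.side_pos w 1)

lemma shortSide_le_side (w : List E) (i : Fin 2) : G.shortSide w ≤ G.side w i := by
  fin_cases i
  · exact min_le_left _ _
  · exact min_le_right _ _

lemma le_shortSide_iff {w : List E} {x : ℝ} : x ≤ G.shortSide w ↔ ∀ i, x ≤ G.side w i := by
  simp [shortSide, Fin.forall_fin_two]

lemma side_longDir (w : List E) : G.side w (G.longDir w) = G.longSide w := by
  rw [longSide, longDir]
  split_ifs with h
  · rw [max_eq_left h]
  · rw [max_eq_right (not_le.1 h).le]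

lemma side_longDir_add_one (w : List E) : G.side w (G.longDir w + 1) = G.shortSide w := by
  rw [shortSide, longDir]
  split_ifs with h
  · rw [min_eq_right h]
    rfl
  · rw [min_eq_left (not_le.1 h).le]
    rfl

lemma shortSide_le_longSide (w : List E) : G.shortSide w ≤ G.longSide w := min_le_max

lemma side_le_longSide (w : List E) (i : Fin 2) : G.side w i ≤ G.longSide w := by
  fin_cases i
  · exact le_max_left _ _
  · exact le_max_right _ _

lemma shortSide_mul_le (u w : List E) : G.shortSide u * G.shortSide w ≤ G.shortSide (u ++ w) := by
  rw [le_shortSide_iff]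
  intro i
  rw [side_append]
  exact mul_le_mul (G.shortSide_le_side u i) (G.shortSide_le_side w _) (G.shortSide_pos w).le
    (G.side_pos u i).le

lemma linWord_conjTranspose_mul_self (w : List E) :
    (G.linWord w).conjTranspose * G.linWord w =
      Matrix.diagonal fun j => ((G.side w (j + G.flipWord w) ^ 2 : ℝ) : ℝ) := by
  ext j k
  rw [Matrix.mul_apply, Matrix.diagonal_apply]
  simp only [Matrix.conjTranspose_apply, linWord_apply, star_trivial, Fin.sum_univ_two, inputCoord,
    side, sq_abs]
  by_cases hflip : G.flipWord w = 0
  · fin_cases j <;> fin_cases k <;> simp [hflip, sq]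
  · have hflip : G.flipWord w = 1 := by omega
    fin_cases j <;> fin_cases k <;> simp [hflip, sq]

lemma alpha_eq (w : List E) : G.alpha 0 w = G.longSide w ∧ G.alpha 1 w = G.shortSide w := by
  have h := singularValues_eq_max_min_of_conjTranspose_mul (fun j => (G.side_pos w _).le)
    (G.linWord_conjTranspose_mul_self w)
  rw [alpha, alpha, h.1, h.2, longSide, shortSide]
  by_cases hflip : G.flipWord w = 0
  · simp [hflip]
  · have hflip : G.flipWord w = 1 := by omega
    simp [hflip, max_comm, min_comm]

/-- All contraction ratios `|ratio e i|` lie in `[a, b] ⊆ (0, 1)`. -/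
structure HasRatioBounds (a b : ℝ) : Prop where
  lower_pos : 0 < a
  upper_pos : 0 < b
  upper_lt_one : b < 1
  le_ratio : ∀ e i, a ≤ |G.ratio e i|
  ratio_le : ∀ e i, |G.ratio e i| ≤ b

lemma exists_hasRatioBounds [Finite E] : ∃ a b, G.HasRatioBounds a b := by
  cases isEmpty_or_nonempty E
  · exact ⟨1 / 2, 1 / 2, by norm_num, by norm_num, by norm_num, isEmptyElim, isEmptyElim⟩
  obtain ⟨x, hx⟩ := Finite.exists_min fun x : E × Fin 2 => |G.ratio x.1 x.2|
  obtain ⟨y, hy⟩ := Finite.exists_max fun x : E × Fin 2 => |G.ratio x.1 x.2|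
  exact ⟨_, _, (G.abs_ratio_mem_Ioo x.1 x.2).1, (G.abs_ratio_mem_Ioo y.1 y.2).1,
    (G.abs_ratio_mem_Ioo y.1 y.2).2, fun e i => hx (e, i), fun e i => hy (e, i)⟩

namespace HasRatioBounds

variable {G} {a b : ℝ}

lemma isScale_side (h : G.HasRatioBounds a b) (i : Fin 2) :
    IsScale (fun w => G.side w i) a b where
  nil := G.side_nil i
  lower_pos := h.lower_pos
  upper_pos := h.upper_pos
  upper_lt_one := h.upper_lt_one
  le_snoc u e := by
    rw [side_append, side_singleton, mul_comm]
    exact mul_le_mul_of_nonneg_left (h.le_ratio e _) (G.side_pos u i).le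
  snoc_le u e := by
    rw [side_append, side_singleton, mul_comm b]
    exact mul_le_mul_of_nonneg_left (h.ratio_le e _) (G.side_pos u i).le

lemma isScale_shortSide (h : G.HasRatioBounds a b) : IsScale G.shortSide a b where
  nil := by simp [shortSide]
  lower_pos := h.lower_pos
  upper_pos := h.upper_pos
  upper_lt_one := h.upper_lt_one
  le_snoc u e := by
    rw [le_shortSide_iff]
    intro i
    exact (mul_le_mul_of_nonneg_left (G.shortSide_le_side u i) h.lower_pos.le).trans
      ((h.isScale_side i).le_snoc u e)
  snoc_le u e := by
    rw [← G.side_longDir_add_one u]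
    exact (G.shortSide_le_side _ _).trans ((h.isScale_side _).snoc_le u e)

end HasRatioBounds

end BoxLikeGIFS

/-! ### The support of a self-affine measure -/

lemma mapsTo_cthickening_of_lipschitzWith {X Y : Type*} [PseudoMetricSpace X]
    [PseudoMetricSpace Y] {f : X → Y} {K : NNReal} (hf : LipschitzWith K f) {s : Set X}
    (hs : IsCompact s) {t : Set Y} (hst : Set.MapsTo f s t) {R : ℝ} (hR : 0 ≤ R) :
    Set.MapsTo f (Metric.cthickening R s) (Metric.cthickening (K * R) t) := by
  intro x hx
  rw [hs.cthickening_eq_biUnion_closedBall hR, Set.mem_iUnion₂] at hx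
  obtain ⟨y, hy, hxy⟩ := hx
  exact Metric.mem_cthickening_of_dist_le _ _ _ _ (hst hy)
    ((hf.dist_le_mul x y).trans (mul_le_mul_of_nonneg_left hxy K.coe_nonneg))

lemma tendsto_measure_compl_cthickening_atTop {X : Type*} [PseudoMetricSpace X]
    [MeasurableSpace X] [OpensMeasurableSpace X] (μ : Measure X) [IsFiniteMeasure μ] {s : Set X}
    (hs : s.Nonempty) : Tendsto (fun R : ℝ => μ (Metric.cthickening R s)ᶜ) atTop (𝓝 0) := by
  have hempty : ⋂ R : ℝ, (Metric.cthickening R s)ᶜ = ∅ := by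
    rw [← Set.compl_iUnion, Set.compl_empty_iff, Set.eq_univ_iff_forall]
    obtain ⟨y, hy⟩ := hs
    exact fun x => Set.mem_iUnion.2
      ⟨dist x y, Metric.mem_cthickening_of_dist_le _ _ _ _ hy le_rfl⟩
  have hlim := tendsto_measure_iInter_atTop (μ := μ)
    (fun R : ℝ => Metric.isClosed_cthickening.measurableSet.compl.nullMeasurableSet)
    (fun _ _ h => Set.compl_subset_compl.2 (Metric.cthickening_mono h s))
    ⟨0, measure_ne_top _ _⟩
  rwa [hempty, measure_empty] at hlim

namespace BoxLikeGIFS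

variable {V E : Type*} {G : BoxLikeGIFS V E}

/-- The open unit square. -/
def openSquare : Set (Fin 2 → ℝ) := Set.univ.pi fun _ => Set.Ioo (0 : ℝ) 1

lemma closure_openSquare : closure openSquare = Set.Icc 0 1 := by
  simp only [openSquare, closure_pi_set, closure_Ioo (zero_ne_one (α := ℝ)), Set.pi_univ_Icc]
  rfl

lemma psiWord_injective (G : BoxLikeGIFS V E) (w : List E) :
    Function.Injective (G.psiWord w) := by
  intro ξ η h
  ext j
  have hsub := G.psiWord_sub w ξ η (j - G.flipWord w)
  have hj : G.inputCoord w (j - G.flipWord w) = j := by simp [inputCoord]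
  have hcoef : G.coef w (j - G.flipWord w) ≠ 0 := abs_pos.1 (G.side_pos w _)
  rw [h, sub_self, hj, zero_eq_mul, sub_eq_zero] at hsub
  exact hsub.resolve_left hcoef

lemma psi_injective (G : BoxLikeGIFS V E) (e : E) : Function.Injective (G.psi e) := by
  rw [← psiWord_singleton]
  exact G.psiWord_injective _

namespace ROSC

lemma mapsTo_psi_openSquare (hrosc : G.ROSC) (e : E) :
    Set.MapsTo (G.psi e) openSquare openSquare := fun ξ hξ =>
  (hrosc (G.src e)).1 (Set.mem_biUnion (show e ∈ {e' | G.src e' = G.src e} from rfl) ⟨ξ, hξ, rfl⟩)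

lemma mapsTo_psi (hrosc : G.ROSC) (e : E) :
    Set.MapsTo (G.psi e) (Set.Icc 0 1) (Set.Icc 0 1) := by
  rw [← closure_openSquare]
  exact (hrosc.mapsTo_psi_openSquare e).closure (G.continuous_psi e)

lemma mapsTo_psiWord_openSquare (hrosc : G.ROSC) (w : List E) :
    Set.MapsTo (G.psiWord w) openSquare openSquare := by
  induction w with
  | nil => exact Set.mapsTo_id _
  | cons e w ih => exact (hrosc.mapsTo_psi_openSquare e).comp ih

lemma disjoint_psiWord (hrosc : G.ROSC) {v : V} {u w : List E} (hu : G.IsPathFrom v u)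
    (hw : G.IsPathFrom v w) (huw : ¬ u <+: w) (hwu : ¬ w <+: u) :
    Disjoint (G.psiWord u '' openSquare) (G.psiWord w '' openSquare) := by
  induction u generalizing v w with
  | nil => simp at huw
  | cons e u ih =>
    cases w with
    | nil => simp at hwu
    | cons e' w =>
      simp only [psiWord, Set.image_comp]
      by_cases he : e = e'
      · subst he
        exact (Set.disjoint_image_iff (G.psi_injective e)).2
          (ih hu.2 hw.2 (by simpa using huw) (by simpa using hwu))
      · exact ((hrosc v).2 hu.1 hw.1 he).mono
          (Set.image_mono (hrosc.mapsTo_psiWord_openSquare u).image_subset)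
          (Set.image_mono (hrosc.mapsTo_psiWord_openSquare w).image_subset)

end ROSC

lemma HasRatioBounds.lipschitzWith_psi {a b : ℝ} (h : G.HasRatioBounds a b) (e : E) :
    LipschitzWith b.toNNReal (G.psi e) := by
  refine LipschitzWith.of_dist_le_mul fun ξ η => ?_
  rw [Real.coe_toNNReal _ h.upper_pos.le, dist_pi_le_iff (by have := h.upper_pos; positivity)]
  intro i
  rw [psi_apply, psi_apply, dist_add_right, Real.dist_eq, ← mul_sub, abs_mul]
  exact mul_le_mul (h.ratio_le e i) (dist_le_pi_dist ξ η _) (abs_nonneg _) h.upper_pos.le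

/-- The weight `p_w` of a word. -/
def weight (p : E → ℝ) (w : List E) : ℝ := (w.map p).prod

@[simp] lemma weight_nil (p : E → ℝ) : weight p [] = 1 := by simp [weight]

lemma weight_append (p : E → ℝ) (u w : List E) : weight p (u ++ w) = weight p u * weight p w := by
  simp [weight]

section Measure

variable [Fintype E] {p : E → ℝ} {μ : V → Measure (Fin 2 → ℝ)}

lemma IsProbVector.weight_pos (hp : G.IsProbVector p) (w : List E) : 0 < weight p w :=
  List.prod_pos (by simpa using fun e _ => hp.1 e)

lemma IsProbVector.sum_outEdges (hp : G.IsProbVector p) (v : V) :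
    ∑ e ∈ G.outEdges v, ENNReal.ofReal (p e) = 1 := by
  rw [← ENNReal.ofReal_sum_of_nonneg fun e _ => (hp.1 e).le, outEdges, hp.2 v, ENNReal.ofReal_one]

namespace IsSelfAffineFamily

lemma apply (hμ : G.IsSelfAffineFamily p μ) (v : V) {A : Set (Fin 2 → ℝ)}
    (hA : MeasurableSet A) : μ v A =
      ∑ e ∈ G.outEdges v, ENNReal.ofReal (p e) * μ (G.tgt e) (G.psi e ⁻¹' A) := by
  conv_lhs => rw [hμ.2 v]
  simp only [Measure.coe_finsetSum, Finset.sum_apply, Measure.smul_apply, smul_eq_mul, outEdges]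
  refine Finset.sum_congr rfl fun e _ => ?_
  rw [Measure.map_apply (G.continuous_psi e).measurable hA]

lemma weight_mul_apply (hp : G.IsProbVector p) (hμ : G.IsSelfAffineFamily p μ) (v : V)
    {A : Set (Fin 2 → ℝ)} (hA : MeasurableSet A) (u : List E) :
    ENNReal.ofReal (weight p u) * μ (G.terminal v u) (G.psiWord u ⁻¹' A) =
      ∑ e ∈ G.outEdges (G.terminal v u), ENNReal.ofReal (weight p (u ++ [e])) *
        μ (G.terminal v (u ++ [e])) (G.psiWord (u ++ [e]) ⁻¹' A) := by
  rw [hμ.apply _ ((G.continuous_psiWord u).measurable hA), Finset.mul_sum]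
  refine Finset.sum_congr rfl fun e _ => ?_
  rw [weight_append, ENNReal.ofReal_mul (hp.weight_pos u).le, terminal_append, psiWord_append,
    psiWord_singleton, terminal_singleton, mul_assoc, Set.preimage_comp]
  simp [weight]

lemma apply_eq_sum_stopSet (hp : G.IsProbVector p) (hμ : G.IsSelfAffineFamily p μ)
    {ρ : List E → ℝ} {a b : ℝ} (hρ : IsScale ρ a b) {δ : ℝ} (hδ : 0 < δ) (hδ1 : δ ≤ 1) (v : V)
    {A : Set (Fin 2 → ℝ)} (hA : MeasurableSet A) :
    μ v A = ∑ w ∈ G.stopSet hρ hδ v,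
      ENNReal.ofReal (weight p w) * μ (G.terminal v w) (G.psiWord w ⁻¹' A) := by
  have := hμ.1
  have hsum := eq_sum_stopSet (G := G) hρ hδ hδ1 v
    (f := fun u => ENNReal.ofReal (weight p u) * μ (G.terminal v u) (G.psiWord u ⁻¹' A))
    (fun u => ENNReal.mul_ne_top ENNReal.ofReal_ne_top (measure_ne_top _ _))
    (fun u _ => hμ.weight_mul_apply hp v hA u)
  simpa [psiWord] using hsum

lemma weight_mul_le (hp : G.IsProbVector p) (hμ : G.IsSelfAffineFamily p μ) {v : V}
    {w : List E} (hw : G.IsPathFrom v w) {A : Set (Fin 2 → ℝ)} (hA : MeasurableSet A) :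
    ENNReal.ofReal (weight p w) * μ (G.terminal v w) (G.psiWord w ⁻¹' A) ≤ μ v A := by
  induction w using List.reverseRecOn with
  | nil => simp [psiWord]
  | append_singleton u e ih =>
    rw [isPathFrom_append, isPathFrom_singleton] at hw
    refine le_trans ?_ (ih hw.1)
    rw [hμ.weight_mul_apply hp v hA u]
    exact Finset.single_le_sum (f := fun e => ENNReal.ofReal (weight p (u ++ [e])) *
        μ (G.terminal v (u ++ [e])) (G.psiWord (u ++ [e]) ⁻¹' A)) (fun _ _ => zero_le)
        (G.mem_outEdges.2 hw.2)

lemma measure_compl_cthickening_pow_le (hrosc : G.ROSC) (hp : G.IsProbVector p)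
    (hμ : G.IsSelfAffineFamily p μ) {a b : ℝ} (hab : G.HasRatioBounds a b) {R : ℝ} (hR : 0 ≤ R)
    {ε : ℝ≥0∞} (hε : ∀ v, μ v (Metric.cthickening R (Set.Icc 0 1))ᶜ ≤ ε) (n : ℕ) (v : V) :
    μ v (Metric.cthickening (b ^ n * R) (Set.Icc 0 1))ᶜ ≤ ε := by
  induction n generalizing v with
  | zero => simpa using hε v
  | succ n ih =>
    have hb := hab.upper_pos
    rw [hμ.apply v Metric.isClosed_cthickening.measurableSet.compl]
    calc ∑ e ∈ G.outEdges v, ENNReal.ofReal (p e) *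
          μ (G.tgt e) (G.psi e ⁻¹' (Metric.cthickening (b ^ (n + 1) * R) (Set.Icc 0 1))ᶜ)
        ≤ ∑ e ∈ G.outEdges v, ENNReal.ofReal (p e) * ε := by
          gcongr with e
          refine (measure_mono (Set.compl_subset_compl.2 ?_)).trans (ih (G.tgt e))
          have hmaps := mapsTo_cthickening_of_lipschitzWith (hab.lipschitzWith_psi e)
            isCompact_Icc (hrosc.mapsTo_psi e) (R := b ^ n * R) (by positivity)
          rwa [Real.coe_toNNReal _ hb.le, ← mul_assoc, ← pow_succ'] at hmaps
      _ = ε := by rw [← Finset.sum_mul, hp.sum_outEdges, one_mul]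

/-- The mass far away from the unit square is small, and pulling it back along long words does not
increase it while every neighbourhood of the square absorbs it. -/
lemma measure_compl_cthickening_eq_zero [Finite V] (hrosc : G.ROSC) (hp : G.IsProbVector p)
    (hμ : G.IsSelfAffineFamily p μ) (v : V) {r : ℝ} (hr : 0 < r) :
    μ v (Metric.cthickening r (Set.Icc 0 1))ᶜ = 0 := by
  have := hμ.1
  obtain ⟨a, b, hab⟩ := G.exists_hasRatioBounds
  refine nonpos_iff_eq_zero.1 (le_of_forall_gt_imp_ge_of_dense fun ε hε => ?_)
  obtain ⟨R, hRε, hR⟩ := ((eventually_all.2 fun v => (tendsto_measure_compl_cthickening_atTop (μ v)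
    (Set.nonempty_Icc.2 zero_le_one)).eventually_le_const hε).and (eventually_ge_atTop 0)).exists
  have hlim : Tendsto (fun n : ℕ => b ^ n * R) atTop (𝓝 (0 * R)) :=
    (tendsto_pow_atTop_nhds_zero_of_lt_one hab.upper_pos.le hab.upper_lt_one).mul_const R
  rw [zero_mul] at hlim
  obtain ⟨n, hn⟩ := (hlim.eventually_le_const hr).exists
  exact (measure_mono (Set.compl_subset_compl.2 (Metric.cthickening_mono hn _))).trans
    (hμ.measure_compl_cthickening_pow_le hrosc hp hab hR hRε n v)

lemma measure_compl_eq_zero [Finite V] (hrosc : G.ROSC) (hp : G.IsProbVector p)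
    (hμ : G.IsSelfAffineFamily p μ) (v : V) : μ v (Set.Icc 0 1)ᶜ = 0 := by
  have := hμ.1
  have hone : ∀ r > 0, μ v (Metric.cthickening r (Set.Icc 0 1)) = 1 := fun r hr =>
    (prob_compl_eq_zero_iff Metric.isClosed_cthickening.measurableSet).1
      (hμ.measure_compl_cthickening_eq_zero hrosc hp v hr)
  have hlim := tendsto_measure_cthickening_of_isClosed (μ := μ v) (s := Set.Icc 0 1)
    ⟨1, one_pos, measure_ne_top _ _⟩ isClosed_Icc
  rw [prob_compl_eq_zero_iff measurableSet_Icc]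
  exact tendsto_nhds_unique (l := 𝓝[>] (0 : ℝ)) (hlim.mono_left nhdsWithin_le_nhds)
    (tendsto_const_nhds.congr' (eventually_mem_nhdsWithin.mono fun r hr => (hone r hr).symm))

end IsSelfAffineFamily

end Measure

end BoxLikeGIFS

/-! ### Moments of a measure that is composed of small pieces -/

lemma tsum_qpow_le_of_le_sum_nearIndices {q : ℝ} (hq : 0 ≤ q) {n C : ℕ}
    {f g : (Fin n → ℤ) → ℝ≥0∞} (hfg : ∀ l, f l ≤ ∑ k ∈ nearIndices (C + 1) l, g k) :
    ∑' l, qpow q (f l) ≤ momentRatio q C n n * ∑' k, qpow q (g k) := by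
  classical
  refine tsum_qpow_le_of_rel hq (fun l k => k ∈ nearIndices (C + 1) l)
    (fun l => ⟨nearIndices (C + 1) l, (card_nearIndices _ _).le, fun _ => id⟩)
    (fun k => ⟨nearIndices (C + 1) k, (card_nearIndices _ _).le,
      fun _ => mem_nearIndices_comm.1⟩)
    fun l => (hfg l).trans_eq ?_
  rw [tsum_eq_sum_of_ne_zero_mem (T := nearIndices (C + 1) l) (by simp +contextual)]
  exact Finset.sum_congr rfl fun k hk => (if_pos hk).symm

open Classical in
/-- The indices `w ∈ W` for which the image under `F w` of the base point `x₀` lies in the cell `l`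
of the `δ`-mesh. -/
noncomputable def inCell {Ω ω : Type*} {n : ℕ} (W : Finset ω) (F : ω → Ω → Fin n → ℝ) (δ : ℝ)
    (x₀ : Ω) (l : Fin n → ℤ) : Finset ω :=
  {w ∈ W | meshCell δ (F w x₀) = l}

section inCell

variable {Ω ω : Type*} {n : ℕ} {W : Finset ω} {F : ω → Ω → Fin n → ℝ} {δ : ℝ} {x₀ : Ω}

lemma mem_inCell {l : Fin n → ℤ} {w : ω} :
    w ∈ inCell W F δ x₀ l ↔ w ∈ W ∧ meshCell δ (F w x₀) = l := by
  simp [inCell]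

lemma inCell_subset (l : Fin n → ℤ) : inCell W F δ x₀ l ⊆ W := fun _ hw => (mem_inCell.1 hw).1

lemma mem_meshCube_of_mem_inCell (hδ : 0 < δ) {l : Fin n → ℤ} {w : ω}
    (hw : w ∈ inCell W F δ x₀ l) : F w x₀ ∈ meshCube δ l :=
  (mem_inCell.1 hw).2 ▸ mem_meshCube_meshCell hδ _

lemma tsum_inCell (x₀ : Ω) (y : ω → ℝ≥0∞) :
    ∑' l, ∑ w ∈ inCell W F δ x₀ l, y w = ∑ w ∈ W, y w := by
  classical
  simp_rw [inCell, Finset.sum_filter]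
  rw [Summable.tsum_finsetSum fun _ _ => ENNReal.summable]
  refine Finset.sum_congr rfl fun w _ => ?_
  rw [tsum_eq_single (meshCell δ (F w x₀)) fun l hl => if_neg hl.symm, if_pos rfl]

end inCell

/-- The image of `ν` under `F` is composed of the images under the maps `F' w` of probability
measures `ν' w` on `K`, with weights `c w`, and each piece has diameter at most `δ`. -/
structure HasPieces {Ω Ω' ω : Type*} [MeasurableSpace Ω] [MeasurableSpace Ω'] {n : ℕ}
    (ν : Measure Ω') (F : Ω' → Fin n → ℝ) (W : Finset ω) (c : ω → ℝ≥0∞) (ν' : ω → Measure Ω)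
    (F' : ω → Ω → Fin n → ℝ) (K : Set Ω) (δ : ℝ) : Prop where
  prob : ∀ w, IsProbabilityMeasure (ν' w)
  null : ∀ w, ν' w Kᶜ = 0
  apply_eq : ∀ (δ' : ℝ) (k : Fin n → ℤ),
    ν (F ⁻¹' meshCube δ' k) = ∑ w ∈ W, c w * ν' w (F' w ⁻¹' meshCube δ' k)
  ne_top : ∀ w, c w ≠ ∞
  dist_le : ∀ w ∈ W, ∀ x ∈ K, ∀ y ∈ K, dist (F' w x) (F' w y) ≤ δ
  pos : 0 < δ

namespace HasPieces

variable {Ω Ω' ω : Type*} [MeasurableSpace Ω] [MeasurableSpace Ω'] {n : ℕ} {W : Finset ω}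
  {F' : ω → Ω → Fin n → ℝ} {δ : ℝ} {ν : Measure Ω'} {F : Ω' → Fin n → ℝ} {c : ω → ℝ≥0∞}
  {ν' : ω → Measure Ω} {K : Set Ω} {x₀ : Ω} {q : ℝ}

lemma exists_mem (h : HasPieces ν F W c ν' F' K δ) {w : ω} {A : Set Ω} (hA : ν' w A ≠ 0) :
    ∃ x ∈ K, x ∈ A := by
  by_contra! hdisj
  exact hA (measure_mono_null (fun y hy hyK => hdisj y hyK hy) (h.null w))

lemma one_le_sum_nearIndices (h : HasPieces ν F W c ν' F' K δ) (hx₀ : x₀ ∈ K)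
    {l : Fin n → ℤ} {w : ω} (hw : w ∈ inCell W F' δ x₀ l) :
    1 ≤ ∑ k ∈ nearIndices 2 l, ν' w (F' w ⁻¹' meshCube δ k) := by
  have := h.prob w
  calc (1 : ℝ≥0∞) = ν' w K := by
        rw [← measure_univ (μ := ν' w)]
        exact (measure_congr (by simpa [ae_iff_measure_eq, ae_eq_univ] using h.null w)).symm
    _ ≤ ν' w (⋃ k ∈ nearIndices 2 l, F' w ⁻¹' meshCube δ k) := by
        refine measure_mono fun x hx => Set.mem_biUnion (x := meshCell δ (F' w x)) ?_
          (mem_meshCube_meshCell h.pos _)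
        refine mem_nearIndices_of_dist_le (C := 1) h.pos (mem_meshCube_of_mem_inCell h.pos hw)
          (mem_meshCube_meshCell h.pos _) ?_
        simpa using h.dist_le w (inCell_subset l hw) x₀ hx₀ x hx
    _ ≤ _ := measure_biUnion_finset_le _ _

lemma tsum_qpow_inCell_le (h : HasPieces ν F W c ν' F' K δ) (hq : 0 ≤ q) (hx₀ : x₀ ∈ K) :
    ∑' l, qpow q (∑ w ∈ inCell W F' δ x₀ l, c w) ≤
      momentRatio q 1 n n * imageMoment q ν F δ := by
  refine tsum_qpow_le_of_le_sum_nearIndices hq fun l => ?_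
  calc ∑ w ∈ inCell W F' δ x₀ l, c w
      ≤ ∑ w ∈ inCell W F' δ x₀ l, ∑ k ∈ nearIndices 2 l, c w * ν' w (F' w ⁻¹' meshCube δ k) :=
        Finset.sum_le_sum fun w hw => by
          rw [← Finset.mul_sum]
          exact le_mul_of_one_le_right' (h.one_le_sum_nearIndices hx₀ hw)
    _ = ∑ k ∈ nearIndices 2 l, ∑ w ∈ inCell W F' δ x₀ l, c w * ν' w (F' w ⁻¹' meshCube δ k) :=
        Finset.sum_comm
    _ ≤ ∑ k ∈ nearIndices 2 l, ν (F ⁻¹' meshCube δ k) := by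
        gcongr with k
        rw [h.apply_eq]
        exact Finset.sum_le_sum_of_subset (inCell_subset l)

lemma imageMoment_le_tsum_qpow_inCell (h : HasPieces ν F W c ν' F' K δ) (hq : 0 ≤ q)
    (hx₀ : x₀ ∈ K) :
    imageMoment q ν F δ ≤
      momentRatio q 1 n n * ∑' l, qpow q (∑ w ∈ inCell W F' δ x₀ l, c w) := by
  refine tsum_qpow_le_of_le_sum_nearIndices hq fun l => ?_
  rw [h.apply_eq, ← tsum_inCell (F := F') (δ := δ) x₀,
    tsum_eq_sum_of_ne_zero_mem (T := nearIndices 2 l) fun k hk => ?_]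
  · gcongr with k _ w
    have := h.prob w
    exact mul_le_of_le_one_right' prob_le_one
  · obtain ⟨w, hw, hw0⟩ := Finset.exists_ne_zero_of_sum_ne_zero hk
    obtain ⟨x, hxK, hx⟩ := h.exists_mem (right_ne_zero_of_mul hw0)
    refine mem_nearIndices_of_dist_le (C := 1) h.pos hx (mem_meshCube_of_mem_inCell h.pos hw) ?_
    simpa using h.dist_le w (inCell_subset k hw) x hxK x₀ hx₀

lemma mem_nearIndices_of_ne_zero (h : HasPieces ν F W c ν' F' K δ) (hx₀ : x₀ ∈ K) {δ' : ℝ}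
    (hδ' : 0 ≤ δ') (hle : δ' ≤ δ) {k l : Fin n → ℤ}
    (h0 : ∑ w ∈ inCell W F' δ x₀ l, c w * ν' w (F' w ⁻¹' meshCube δ' k) ≠ 0) :
    l ∈ nearIndices 3 (meshCell δ fun i => (k i : ℝ) * δ') := by
  obtain ⟨w, hw, hw0⟩ := Finset.exists_ne_zero_of_sum_ne_zero h0
  obtain ⟨x, hxK, hx⟩ := h.exists_mem (right_ne_zero_of_mul hw0)
  refine mem_nearIndices_of_dist_le (C := 2) h.pos (mem_meshCube_meshCell h.pos _)
    (mem_meshCube_of_mem_inCell h.pos hw) ?_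
  have hcorner : (fun i => (k i : ℝ) * δ') ∈ meshCube δ' k := fun i => ⟨le_rfl, by linarith⟩
  calc dist (fun i => (k i : ℝ) * δ') (F' w x₀)
      ≤ dist (fun i => (k i : ℝ) * δ') (F' w x) + dist (F' w x) (F' w x₀) := dist_triangle _ _ _
    _ ≤ δ' + δ := add_le_add (dist_le_of_mem_meshCube hδ' hcorner hx)
        (h.dist_le w (inCell_subset l hw) x hxK x₀ hx₀)
    _ ≤ (2 : ℕ) * δ := by push_cast; linarith

lemma imageMoment_le_mul (h : HasPieces ν F W c ν' F' K δ) (hq : 1 ≤ q) (hx₀ : x₀ ∈ K)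
    {δ' : ℝ} (hδ' : 0 ≤ δ') (hle : δ' ≤ δ) {T : ℝ≥0∞}
    (hT : ∀ w ∈ W, imageMoment q (ν' w) (F' w) δ' ≤ T) :
    imageMoment q ν F δ' ≤
      ((2 * 3 + 1) ^ n : ℕ) ^ q * (momentRatio q 1 n n * imageMoment q ν F δ * T) := by
  have hq0 : 0 ≤ q := zero_le_one.trans hq
  calc imageMoment q ν F δ' ≤ ∑' k, ((2 * 3 + 1) ^ n : ℕ) ^ q * ∑' l,
        qpow q (∑ w ∈ inCell W F' δ x₀ l, c w * ν' w (F' w ⁻¹' meshCube δ' k)) := by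
        refine ENNReal.tsum_le_tsum fun k => ?_
        rw [h.apply_eq, ← tsum_inCell (F := F') (δ := δ) x₀]
        exact qpow_tsum_le hq0 (card_nearIndices _ _).le
          fun l hl => h.mem_nearIndices_of_ne_zero hx₀ hδ' hle hl
    _ = ((2 * 3 + 1) ^ n : ℕ) ^ q * ∑' l, ∑' k,
        qpow q (∑ w ∈ inCell W F' δ x₀ l, c w * ν' w (F' w ⁻¹' meshCube δ' k)) := by
        rw [ENNReal.tsum_mul_left, ENNReal.tsum_comm]
    _ ≤ ((2 * 3 + 1) ^ n : ℕ) ^ q * ∑' l, qpow q (∑ w ∈ inCell W F' δ x₀ l, c w) * T := by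
        gcongr with l
        exact tsum_qpow_sum_mul_le hq _ (ENNReal.sum_ne_top.2 fun w _ => h.ne_top w)
          fun w hw => hT w (inCell_subset l hw)
    _ ≤ _ := by
        rw [ENNReal.tsum_mul_right]
        gcongr
        exact h.tsum_qpow_inCell_le hq0 hx₀

lemma imageMoment_mul_le (h : HasPieces ν F W c ν' F' K δ) (hq : 0 ≤ q) (hq1 : q ≤ 1)
    (hx₀ : x₀ ∈ K) {δ' : ℝ} (hδ' : 0 ≤ δ') (hle : δ' ≤ δ) {T : ℝ≥0∞}
    (hT : ∀ w ∈ W, T ≤ imageMoment q (ν' w) (F' w) δ') :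
    imageMoment q ν F δ * T ≤
      momentRatio q 1 n n * (((2 * 3 + 1) ^ n : ℕ) * imageMoment q ν F δ') := by
  calc imageMoment q ν F δ * T
      ≤ momentRatio q 1 n n * (∑' l, qpow q (∑ w ∈ inCell W F' δ x₀ l, c w) * T) := by
        rw [ENNReal.tsum_mul_right, ← mul_assoc]
        gcongr
        exact h.imageMoment_le_tsum_qpow_inCell hq hx₀
    _ ≤ momentRatio q 1 n n * ∑' l, ∑' k,
        qpow q (∑ w ∈ inCell W F' δ x₀ l, c w * ν' w (F' w ⁻¹' meshCube δ' k)) := by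
        gcongr with l
        exact le_tsum_qpow_sum_mul hq hq1 _ (ENNReal.sum_ne_top.2 fun w _ => h.ne_top w)
          fun w hw => hT w (inCell_subset l hw)
    _ = momentRatio q 1 n n * ∑' k, ∑' l,
        qpow q (∑ w ∈ inCell W F' δ x₀ l, c w * ν' w (F' w ⁻¹' meshCube δ' k)) := by
        rw [ENNReal.tsum_comm]
    _ ≤ _ := by
        gcongr
        rw [imageMoment, ← ENNReal.tsum_mul_left]
        refine ENNReal.tsum_le_tsum fun k => ?_
        rw [h.apply_eq, ← tsum_inCell (F := F') (δ := δ) x₀]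
        exact tsum_qpow_le hq (card_nearIndices _ _).le
          fun l hl => h.mem_nearIndices_of_ne_zero hx₀ hδ' hle hl

end HasPieces

/-! ### Existence of the spectra of the projections -/

/-- The `i`-th coordinate, as a point of `ℝ¹`. -/
def coordMap (i : Fin 2) : (Fin 2 → ℝ) → Fin 1 → ℝ := fun ξ _ => ξ i

lemma dist_coordMap (i : Fin 2) (ξ η : Fin 2 → ℝ) :
    dist (coordMap i ξ) (coordMap i η) = dist (ξ i) (η i) := dist_pi_const _ _

lemma measurable_coordMap (i : Fin 2) : Measurable (coordMap i) :=
  measurable_pi_lambda _ fun _ => measurable_pi_apply i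

lemma dist_apply_le_one_of_mem_Icc {ξ η : Fin 2 → ℝ} (hξ : ξ ∈ Set.Icc (0 : Fin 2 → ℝ) 1)
    (hη : η ∈ Set.Icc (0 : Fin 2 → ℝ) 1) (i : Fin 2) : dist (ξ i) (η i) ≤ 1 :=
  Real.dist_le_of_mem_Icc_01 ⟨hξ.1 i, hξ.2 i⟩ ⟨hη.1 i, hη.2 i⟩

lemma exists_ne_top_forall {ι : Type*} [Finite ι] {P : ι → ℝ≥0∞ → Prop}
    (hmono : ∀ i C C', C ≤ C' → P i C → P i C') (h : ∀ i, ∃ C, C ≠ ∞ ∧ P i C) :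
    ∃ C : ℝ≥0∞, C ≠ ∞ ∧ ∀ i, P i C := by
  have := Fintype.ofFinite ι
  choose C hC hP using h
  refine ⟨∑ i, C i, ENNReal.sum_ne_top.2 fun i _ => hC i, fun i => hmono i _ _ ?_ (hP i)⟩
  exact Finset.single_le_sum (fun _ _ => zero_le) (Finset.mem_univ i)

lemma log_toReal_le_of_le_mul {x y C : ℝ≥0∞} (hx : 0 < x.toReal) (hy : 0 < y.toReal) (hC : C ≠ ∞)
    (h : x ≤ C * y) : Real.log x.toReal ≤ Real.log y.toReal + |Real.log C.toReal| := by
  have hxy := ENNReal.toReal_mono (ENNReal.mul_ne_top hC (ENNReal.toReal_pos_iff.1 hy).2.ne) h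
  rw [ENNReal.toReal_mul] at hxy
  have hC0 : 0 < C.toReal := pos_of_mul_pos_left (hx.trans_le hxy) hy.le
  have hlog := Real.log_le_log hx hxy
  rw [Real.log_mul hC0.ne' hy.ne'] at hlog
  linarith [le_abs_self (Real.log C.toReal)]

lemma abs_log_toReal_sub_le {x y C : ℝ≥0∞} (hx : 0 < x.toReal) (hy : 0 < y.toReal) (hC : C ≠ ∞)
    (h : x ≤ C * y) (h' : y ≤ C * x) :
    |Real.log x.toReal - Real.log y.toReal| ≤ |Real.log C.toReal| :=
  abs_sub_le_iff.2 ⟨by linarith [log_toReal_le_of_le_mul hx hy hC h],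
    by linarith [log_toReal_le_of_le_mul hy hx hC h']⟩

lemma scaleRegular_imageMoment {Ω : Type*} [MeasurableSpace Ω] {n : ℕ} {q : ℝ} (hq : 0 ≤ q)
    {ν : Measure Ω} [IsProbabilityMeasure ν] {K : Set Ω} (hK : ν Kᶜ = 0) {F : Ω → Fin n → ℝ}
    {B : ℝ} (hB : ∀ x ∈ K, ∀ y ∈ K, dist (F x) (F y) ≤ B) :
    ScaleRegular fun δ => (imageMoment q ν F δ).toReal where
  pos δ hδ :=
    ENNReal.toReal_pos (imageMoment_ne_zero hq F hδ) (imageMoment_ne_top hq hK hδ hB)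
  exists_le_mul C := by
    refine ⟨(momentRatio q C n n).toReal, fun δ δ' hδ hδ' h h' => ?_⟩
    rw [← ENNReal.toReal_mul]
    exact ENNReal.toReal_mono
      (ENNReal.mul_ne_top (momentRatio_ne_top hq _ _ _) (imageMoment_ne_top hq hK hδ' hB))
      (imageMoment_le_of_scale hq F hδ hδ' h h')

namespace BoxLikeGIFS

variable {V E : Type*} {G : BoxLikeGIFS V E} {p : E → ℝ} {μ : V → Measure (Fin 2 → ℝ)} {q : ℝ}

lemma imageMoment_coordMap_comp_psiWord_comparable (hq : 0 ≤ q) (ν : Measure (Fin 2 → ℝ))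
    (w : List E) (i : Fin 2) {δ δ' : ℝ} (hδ : 0 < δ) (hδ' : 0 < δ') {C : ℕ}
    (hle : δ ≤ C * (G.side w i * δ')) (hge : G.side w i * δ' ≤ C * δ) :
    imageMoment q ν (coordMap i ∘ G.psiWord w) δ ≤
        momentRatio q C 1 1 * imageMoment q ν (coordMap (G.inputCoord w i)) δ' ∧
      imageMoment q ν (coordMap (G.inputCoord w i)) δ' ≤
        momentRatio q C 1 1 * imageMoment q ν (coordMap i ∘ G.psiWord w) δ := by
  have hs := G.side_pos w i
  have hdist : ∀ x y, dist ((coordMap i ∘ G.psiWord w) x) ((coordMap i ∘ G.psiWord w) y) =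
      G.side w i * dist (coordMap (G.inputCoord w i) x) (coordMap (G.inputCoord w i) y) := by
    simp [dist_coordMap, dist_psiWord]
  have hcontract : ∀ x ∈ Set.univ, ∀ y ∈ Set.univ,
      dist ((coordMap i ∘ G.psiWord w) x) ((coordMap i ∘ G.psiWord w) y) ≤ δ →
      dist (coordMap (G.inputCoord w i) x) (coordMap (G.inputCoord w i) y) ≤ C * δ' := by
    intro x _ y _ h
    rw [hdist] at h
    exact le_of_mul_le_mul_left (by linarith) hs
  have hexpand : ∀ x ∈ Set.univ, ∀ y ∈ Set.univ,
      dist (coordMap (G.inputCoord w i) x) (coordMap (G.inputCoord w i) y) ≤ δ' →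
      dist ((coordMap i ∘ G.psiWord w) x) ((coordMap i ∘ G.psiWord w) y) ≤ C * δ := by
    intro x _ y _ h
    rw [hdist]
    exact (mul_le_mul_of_nonneg_left h hs.le).trans hge
  exact ⟨imageMoment_le_of_dist_le hq (by simp) hδ hδ' hcontract hexpand,
    imageMoment_le_of_dist_le hq (by simp) hδ' hδ hexpand hcontract⟩

lemma imageMoment_id_le_comp_psiWord (hq : 0 ≤ q) (ν : Measure (Fin 2 → ℝ)) (w : List E) {δ : ℝ}
    (hδ : 0 < δ) {C : ℕ} (hle : ∀ i, 1 ≤ C * G.side w i) (hge : ∀ i, G.side w i ≤ C) :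
    imageMoment q ν id δ ≤ momentRatio q C 2 2 * imageMoment q ν (G.psiWord w) δ := by
  refine imageMoment_le_of_dist_le hq (K := Set.univ) (by simp) hδ hδ
    (fun x _ y _ h => (dist_pi_le_iff (by positivity)).2 fun i => ?_)
    (fun x _ y _ h => (dist_pi_le_iff (by positivity)).2 fun j => ?_)
  · rw [dist_psiWord]
    exact mul_le_mul (hge i) ((dist_le_pi_dist x y _).trans h) dist_nonneg (by positivity)
  · set i := j - G.flipWord w with hi
    have hinput : G.inputCoord w i = j := by simp [hi, inputCoord]
    have hdist := (dist_le_pi_dist (G.psiWord w x) (G.psiWord w y) i).trans h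
    rw [dist_psiWord, hinput] at hdist
    calc dist (x j) (y j) ≤ C * G.side w i * dist (x j) (y j) :=
          le_mul_of_one_le_left dist_nonneg (hle i)
      _ ≤ C * δ := by
          rw [mul_assoc]
          exact mul_le_mul_of_nonneg_left hdist (by positivity)

/-- A word from `terminal v w` back to `v` that undoes the exchange of coordinates made by `w`: if
`u` leads back to `v`, so does `u ++ w ++ u`, and together with `w` it contains every letter an
even number of times. -/
lemma StronglyConnected.exists_return_word (hconn : G.StronglyConnected) (v : V) (w : List E)
    (hw : G.IsPathFrom v w) : ∃ u, G.IsPathFrom (G.terminal v w) u ∧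
      G.terminal (G.terminal v w) u = v ∧ ∀ i, G.inputCoord u (G.inputCoord w i) = i := by
  obtain ⟨u, -, hu⟩ := hconn (G.terminal v w) v
  rw [isPath_iff] at hu
  refine ⟨u ++ w ++ u, by simp [isPathFrom_append, hu, hw], by simp [terminal_append, hu],
    fun i => ?_⟩
  have hcancel : ∀ i x y : Fin 2, i + x + (y + x + y) = i := by decide
  simp only [inputCoord, flipWord, List.map_append, List.sum_append, hcancel]

variable [Fintype E]

namespace IsSelfAffineFamily

lemma weight_rpow_mul_imageMoment_le (hμ : G.IsSelfAffineFamily p μ) (hp : G.IsProbVector p)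
    (hq : 0 ≤ q) {n : ℕ} {F : (Fin 2 → ℝ) → Fin n → ℝ} (hF : Measurable F) {v : V} {w : List E}
    (hw : G.IsPathFrom v w) (δ : ℝ) :
    ENNReal.ofReal (weight p w) ^ q * imageMoment q (μ (G.terminal v w)) (F ∘ G.psiWord w) δ ≤
      imageMoment q (μ v) F δ := by
  rw [imageMoment, ← ENNReal.tsum_mul_left]
  refine ENNReal.tsum_le_tsum fun k => ?_
  rw [← qpow_mul hq (by simpa using hp.weight_pos w), Set.preimage_comp]
  exact qpow_mono hq (hμ.weight_mul_le hp hw (hF (measurableSet_meshCube _ _)))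

lemma exists_imageMoment_terminal_le (hμ : G.IsSelfAffineFamily p μ) (hp : G.IsProbVector p)
    (hq : 0 ≤ q) {n m : ℕ} {F : (Fin 2 → ℝ) → Fin n → ℝ} {F' : (Fin 2 → ℝ) → Fin m → ℝ}
    (hF : Measurable F) {w : List E} {B : ℝ≥0∞} (hB : B ≠ ∞)
    (h : ∀ ν : Measure (Fin 2 → ℝ), ∀ δ, 0 < δ →
      imageMoment q ν F' δ ≤ B * imageMoment q ν (F ∘ G.psiWord w) δ) :
    ∃ C : ℝ≥0∞, C ≠ ∞ ∧ ∀ v, G.IsPathFrom v w → ∀ δ, 0 < δ →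
      imageMoment q (μ (G.terminal v w)) F' δ ≤ C * imageMoment q (μ v) F δ := by
  set r := ENNReal.ofReal (weight p w) ^ q
  have hr0 : r ≠ 0 := (ENNReal.rpow_pos (by simpa using hp.weight_pos w) ENNReal.ofReal_ne_top).ne'
  have hrtop : r ≠ ∞ := ENNReal.rpow_ne_top_of_nonneg hq ENNReal.ofReal_ne_top
  refine ⟨B * r⁻¹, ENNReal.mul_ne_top hB (ENNReal.inv_ne_top.2 hr0), fun v hw δ hδ => ?_⟩
  rw [mul_assoc]
  refine (h _ δ hδ).trans (mul_le_mul_right ?_ _)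
  exact (ENNReal.mul_le_iff_le_inv hr0 hrtop).1 (hμ.weight_rpow_mul_imageMoment_le hp hq hF hw δ)

lemma exists_imageMoment_coordMap_terminal_le (hμ : G.IsSelfAffineFamily p μ)
    (hp : G.IsProbVector p) (hq : 0 ≤ q) (w : List E) (i : Fin 2) :
    ∃ C : ℝ≥0∞, C ≠ ∞ ∧ ∀ v, G.IsPathFrom v w → ∀ δ, 0 < δ →
      imageMoment q (μ (G.terminal v w)) (coordMap (G.inputCoord w i)) δ ≤
        C * imageMoment q (μ v) (coordMap i) δ := by
  have hs := G.side_pos w i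
  obtain ⟨N, hN⟩ := exists_nat_ge (max (1 / G.side w i) (G.side w i))
  have hlower : 1 ≤ N * G.side w i := (div_le_iff₀ hs).1 ((le_max_left _ _).trans hN)
  have hupper : G.side w i ≤ N := (le_max_right _ _).trans hN
  exact hμ.exists_imageMoment_terminal_le hp hq (measurable_coordMap i)
    (momentRatio_ne_top hq N 1 1) fun ν δ hδ => (imageMoment_coordMap_comp_psiWord_comparable hq ν
      w i hδ hδ (by nlinarith) (by nlinarith)).2

lemma exists_imageMoment_id_terminal_le (hμ : G.IsSelfAffineFamily p μ) (hp : G.IsProbVector p)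
    (hq : 0 ≤ q) (w : List E) : ∃ C : ℝ≥0∞, C ≠ ∞ ∧ ∀ v, G.IsPathFrom v w → ∀ δ, 0 < δ →
      imageMoment q (μ (G.terminal v w)) id δ ≤ C * imageMoment q (μ v) id δ := by
  obtain ⟨N, hN⟩ := exists_nat_ge (max (1 / G.shortSide w) (G.longSide w))
  have hlower : 1 ≤ N * G.shortSide w :=
    (div_le_iff₀ (G.shortSide_pos w)).1 ((le_max_left _ _).trans hN)
  have hupper : G.longSide w ≤ N := (le_max_right _ _).trans hN
  exact hμ.exists_imageMoment_terminal_le hp hq measurable_id (momentRatio_ne_top hq N 2 2)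
    fun ν δ hδ => imageMoment_id_le_comp_psiWord hq ν w hδ
      (fun i => hlower.trans (mul_le_mul_of_nonneg_left (G.shortSide_le_side w i) (by positivity)))
      fun i => (G.side_le_longSide w i).trans hupper

variable [Finite V]

lemma exists_forall_imageMoment_coordMap_terminal_le (hμ : G.IsSelfAffineFamily p μ)
    (hp : G.IsProbVector p) (hq : 0 ≤ q) :
    ∃ C : ℝ≥0∞, C ≠ ∞ ∧ ∀ v w i, G.IsPathFrom v w → ∀ δ, 0 < δ →
      imageMoment q (μ (G.terminal v w)) (coordMap (G.inputCoord w i)) δ ≤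
        C * imageMoment q (μ v) (coordMap i) δ := by
  obtain ⟨C, hC, h⟩ := exists_ne_top_forall (ι := (V × Fin 2) × (V × Fin 2))
    (P := fun ⟨⟨v, i⟩, ⟨v', i'⟩⟩ C => ∀ w, G.IsPathFrom v w → G.terminal v w = v' →
      G.inputCoord w i = i' → ∀ δ, 0 < δ →
        imageMoment q (μ v') (coordMap i') δ ≤ C * imageMoment q (μ v) (coordMap i) δ)
    (fun _ _ _ hCC' h w hw hv hi δ hδ => (h w hw hv hi δ hδ).trans (by gcongr)) (by
      rintro ⟨⟨v, i⟩, ⟨v', i'⟩⟩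
      by_cases hex : ∃ w, G.IsPathFrom v w ∧ G.terminal v w = v' ∧ G.inputCoord w i = i'
      · obtain ⟨w, hw, rfl, rfl⟩ := hex
        obtain ⟨C, hC, h⟩ := hμ.exists_imageMoment_coordMap_terminal_le hp hq w i
        exact ⟨C, hC, fun _ _ _ _ δ hδ => h v hw δ hδ⟩
      · exact ⟨0, by simp, fun w hw hv hi => (hex ⟨w, hw, hv, hi⟩).elim⟩)
  exact ⟨C, hC, fun v w i hw => h ((v, i), (_, _)) w hw rfl rfl⟩

lemma exists_imageMoment_coordMap_comparable (hμ : G.IsSelfAffineFamily p μ)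
    (hconn : G.StronglyConnected) (hp : G.IsProbVector p) (hq : 0 ≤ q) :
    ∃ C : ℝ≥0∞, C ≠ ∞ ∧ ∀ v w i, G.IsPathFrom v w → ∀ δ, 0 < δ →
      imageMoment q (μ (G.terminal v w)) (coordMap (G.inputCoord w i)) δ ≤
        C * imageMoment q (μ v) (coordMap i) δ ∧
      imageMoment q (μ v) (coordMap i) δ ≤
        C * imageMoment q (μ (G.terminal v w)) (coordMap (G.inputCoord w i)) δ := by
  obtain ⟨C, hC, h⟩ := hμ.exists_forall_imageMoment_coordMap_terminal_le hp hq
  refine ⟨C, hC, fun v w i hw δ hδ => ⟨h v w i hw δ hδ, ?_⟩⟩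
  obtain ⟨u, hu, hterm, hinput⟩ := hconn.exists_return_word v w hw
  simpa [hterm, hinput] using h (G.terminal v w) u (G.inputCoord w i) hu δ hδ

lemma exists_imageMoment_id_comparable (hμ : G.IsSelfAffineFamily p μ)
    (hconn : G.StronglyConnected) (hp : G.IsProbVector p) (hq : 0 ≤ q) :
    ∃ C : ℝ≥0∞, C ≠ ∞ ∧ ∀ v v' δ, 0 < δ →
      imageMoment q (μ v') id δ ≤ C * imageMoment q (μ v) id δ := by
  obtain ⟨C, hC, h⟩ := exists_ne_top_forall (ι := V × V)
    (P := fun ⟨v, v'⟩ C => ∀ δ, 0 < δ → imageMoment q (μ v') id δ ≤ C * imageMoment q (μ v) id δ)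
    (fun _ _ _ hCC' h δ hδ => (h δ hδ).trans (by gcongr)) (by
      rintro ⟨v, v'⟩
      obtain ⟨u, -, hu⟩ := hconn v v'
      rw [isPath_iff] at hu
      obtain ⟨C, hC, h⟩ := hμ.exists_imageMoment_id_terminal_le hp hq u
      exact ⟨C, hC, fun δ hδ => hu.2 ▸ h v hu.1 δ hδ⟩)
  exact ⟨C, hC, fun v v' => h (v, v')⟩

lemma exists_imageMoment_stop_comparable (hμ : G.IsSelfAffineFamily p μ)
    (hconn : G.StronglyConnected) (hp : G.IsProbVector p) (hq : 0 ≤ q) :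
    ∃ C : ℝ≥0∞, C ≠ ∞ ∧ ∀ v w i δ ε, 0 < δ → 0 < ε → G.IsStop (fun u => G.side u i) δ v w →
      imageMoment q (μ (G.terminal v w)) (coordMap i ∘ G.psiWord w) (δ * ε) ≤
          C * imageMoment q (μ v) (coordMap i) ε ∧
        imageMoment q (μ v) (coordMap i) ε ≤
          C * imageMoment q (μ (G.terminal v w)) (coordMap i ∘ G.psiWord w) (δ * ε) := by
  obtain ⟨a, b, hab⟩ := G.exists_hasRatioBounds
  obtain ⟨C, hC, hcomp⟩ := hμ.exists_imageMoment_coordMap_comparable hconn hp hq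
  obtain ⟨N, hN⟩ := exists_nat_ge (1 / a)
  have hNa : 1 ≤ N * a := (div_le_iff₀ hab.lower_pos).1 hN
  refine ⟨momentRatio q N 1 1 * C, ENNReal.mul_ne_top (momentRatio_ne_top hq N 1 1) hC,
    fun v w i δ ε hδ hε hw => ?_⟩
  have hlower : a * δ ≤ G.side w i := hw.mul_le (hab.isScale_side i)
  have hle : δ ≤ N * G.side w i := by nlinarith
  have hge : G.side w i ≤ N * δ := by nlinarith [hw.2.1]
  have hpsi := imageMoment_coordMap_comp_psiWord_comparable (G := G) hq (μ (G.terminal v w)) w i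
    (mul_pos hδ hε) hε (C := N) (by nlinarith) (by nlinarith)
  have hterm := hcomp v w i hw.1 ε hε
  constructor
  · rw [mul_assoc]
    exact hpsi.1.trans (mul_le_mul_right hterm.1 _)
  · rw [mul_comm _ C, mul_assoc]
    exact hterm.2.trans (mul_le_mul_right hpsi.2 _)

lemma hasPieces_coordMap (hμ : G.IsSelfAffineFamily p μ) (hrosc : G.ROSC) (hp : G.IsProbVector p)
    {a b : ℝ} (hab : G.HasRatioBounds a b) (v : V) (i : Fin 2) {δ : ℝ} (hδ : 0 < δ) (hδ1 : δ ≤ 1) :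
    HasPieces (μ v) (coordMap i) (G.stopSet (hab.isScale_side i) hδ v)
      (fun w => ENNReal.ofReal (weight p w)) (fun w => μ (G.terminal v w))
      (fun w => coordMap i ∘ G.psiWord w) (Set.Icc 0 1) δ where
  prob _ := hμ.1 _
  null _ := hμ.measure_compl_eq_zero hrosc hp _
  apply_eq _ _ := hμ.apply_eq_sum_stopSet hp (hab.isScale_side i) hδ hδ1 v
    (measurable_coordMap i (measurableSet_meshCube _ _))
  ne_top _ := ENNReal.ofReal_ne_top
  dist_le w hw x hx y hy := by
    rw [Function.comp_apply, Function.comp_apply, dist_coordMap, dist_psiWord]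
    exact (mul_le_of_le_one_right (G.side_pos w i).le
      (dist_apply_le_one_of_mem_Icc hx hy _)).trans (mem_stopSet.1 hw).2.1.le
  pos := hδ

lemma exists_imageMoment_coordMap_mul_le (hμ : G.IsSelfAffineFamily p μ)
    (hconn : G.StronglyConnected) (hrosc : G.ROSC) (hp : G.IsProbVector p) (hq : 1 ≤ q) :
    ∃ C : ℝ≥0∞, C ≠ ∞ ∧ ∀ v i δ ε, 0 < δ → δ ≤ 1 → 0 < ε → ε ≤ 1 →
      imageMoment q (μ v) (coordMap i) (δ * ε) ≤
        C * (imageMoment q (μ v) (coordMap i) δ * imageMoment q (μ v) (coordMap i) ε) := by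
  have hq0 : 0 ≤ q := zero_le_one.trans hq
  obtain ⟨a, b, hab⟩ := G.exists_hasRatioBounds
  obtain ⟨C, hC, hfirst⟩ := hμ.exists_imageMoment_stop_comparable hconn hp hq0
  refine ⟨((2 * 3 + 1) ^ 1 : ℕ) ^ q * momentRatio q 1 1 1 * C,
    ENNReal.mul_ne_top (ENNReal.mul_ne_top (ENNReal.rpow_ne_top_of_nonneg hq0
      (ENNReal.natCast_ne_top _)) (momentRatio_ne_top hq0 _ _ _)) hC,
    fun v i δ ε hδ hδ1 hε hε1 => ?_⟩
  refine ((hμ.hasPieces_coordMap hrosc hp hab v i hδ hδ1).imageMoment_le_mul hq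
    (Set.left_mem_Icc.2 zero_le_one) (by positivity) (mul_le_of_le_one_right hδ.le hε1)
    fun w hw => (hfirst v w i δ ε hδ hε (mem_stopSet.1 hw)).1).trans_eq ?_
  ring

lemma exists_mul_imageMoment_coordMap_le (hμ : G.IsSelfAffineFamily p μ)
    (hconn : G.StronglyConnected) (hrosc : G.ROSC) (hp : G.IsProbVector p) (hq : 0 ≤ q)
    (hq1 : q ≤ 1) :
    ∃ C : ℝ≥0∞, C ≠ ∞ ∧ ∀ v i δ ε, 0 < δ → δ ≤ 1 → 0 < ε → ε ≤ 1 →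
      imageMoment q (μ v) (coordMap i) δ * imageMoment q (μ v) (coordMap i) ε ≤
        C * imageMoment q (μ v) (coordMap i) (δ * ε) := by
  obtain ⟨a, b, hab⟩ := G.exists_hasRatioBounds
  obtain ⟨C, hC, hfirst⟩ := hμ.exists_imageMoment_stop_comparable hconn hp hq
  have hC1 : C + 1 ≠ ∞ := by finiteness
  refine ⟨(C + 1) * momentRatio q 1 1 1 * ((2 * 3 + 1) ^ 1 : ℕ),
    ENNReal.mul_ne_top (ENNReal.mul_ne_top hC1 (momentRatio_ne_top hq _ _ _))
      (ENNReal.natCast_ne_top _), fun v i δ ε hδ hδ1 hε hε1 => ?_⟩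
  set M := imageMoment q (μ v) (coordMap i)
  have hpiece : ∀ w ∈ G.stopSet (hab.isScale_side i) hδ v, M ε / (C + 1) ≤
      imageMoment q (μ (G.terminal v w)) (coordMap i ∘ G.psiWord w) (δ * ε) := fun w hw =>
    ENNReal.div_le_of_le_mul' ((hfirst v w i δ ε hδ hε (mem_stopSet.1 hw)).2.trans
      (by gcongr; exact le_self_add))
  calc M δ * M ε = (C + 1) * (M δ * (M ε / (C + 1))) := by
        rw [mul_left_comm, ENNReal.mul_div_cancel (by simp) hC1]
    _ ≤ (C + 1) * (momentRatio q 1 1 1 * (((2 * 3 + 1) ^ 1 : ℕ) * M (δ * ε))) := by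
        refine mul_le_mul_right ?_ _
        exact (hμ.hasPieces_coordMap hrosc hp hab v i hδ hδ1).imageMoment_mul_le hq hq1
          (Set.left_mem_Icc.2 zero_le_one) (by positivity) (mul_le_of_le_one_right hδ.le hε1) hpiece
    _ = _ := by ring

lemma scaleRegular_coordMap (hμ : G.IsSelfAffineFamily p μ) (hrosc : G.ROSC)
    (hp : G.IsProbVector p) (hq : 0 ≤ q) (v : V) (i : Fin 2) :
    ScaleRegular fun δ => (imageMoment q (μ v) (coordMap i) δ).toReal :=
  have := hμ.1 v
  scaleRegular_imageMoment hq (hμ.measure_compl_eq_zero hrosc hp v) (B := 1) fun x hx y hy =>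
    (dist_coordMap i x y).trans_le (dist_apply_le_one_of_mem_Icc hx hy i)

lemma scaleRegular_id (hμ : G.IsSelfAffineFamily p μ) (hrosc : G.ROSC) (hp : G.IsProbVector p)
    (hq : 0 ≤ q) (v : V) : ScaleRegular fun δ => (imageMoment q (μ v) id δ).toReal :=
  have := hμ.1 v
  scaleRegular_imageMoment hq (hμ.measure_compl_eq_zero hrosc hp v) (B := 1) fun _ hx _ hy =>
    (dist_pi_le_iff zero_le_one).2 (dist_apply_le_one_of_mem_Icc hx hy)

lemma exists_tendsto_log_imageMoment_dyadic_div (hμ : G.IsSelfAffineFamily p μ)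
    (hconn : G.StronglyConnected) (hrosc : G.ROSC) (hp : G.IsProbVector p) (hq : 0 ≤ q) (v : V)
    (i : Fin 2) : ∃ L, Tendsto (fun n : ℕ =>
      Real.log (imageMoment q (μ v) (coordMap i) ((1 / 2) ^ n)).toReal / n) atTop (𝓝 L) := by
  have hreg := hμ.scaleRegular_coordMap hrosc hp hq v i
  obtain ⟨B, hB⟩ := hreg.exists_abs_log_dyadic_sub_le
  set x : ℕ → ℝ≥0∞ := fun n => imageMoment q (μ v) (coordMap i) ((1 / 2) ^ n) with hx
  have hx0 : ∀ n, 0 < (x n).toReal := fun n => hreg.pos _ (by positivity)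
  have hmul0 : ∀ m n, 0 < (x m * x n).toReal := fun m n => by
    rw [ENNReal.toReal_mul]
    exact mul_pos (hx0 m) (hx0 n)
  have hlog : ∀ m n, Real.log (x m * x n).toReal = Real.log (x m).toReal + Real.log (x n).toReal :=
    fun m n => by rw [ENNReal.toReal_mul, Real.log_mul (hx0 m).ne' (hx0 n).ne']
  have hpow : ∀ n : ℕ, (0 : ℝ) < (1 / 2) ^ n ∧ (1 / 2 : ℝ) ^ n ≤ 1 := fun n =>
    ⟨by positivity, pow_le_one₀ (by norm_num) (by norm_num)⟩
  rcases le_total 1 q with hq1 | hq1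
  · obtain ⟨C, hC, hmul⟩ := hμ.exists_imageMoment_coordMap_mul_le hconn hrosc hp hq1
    refine exists_tendsto_div_of_almost_subadditive (C := max B |Real.log C.toReal|)
      (fun n => by linarith [(abs_le.1 (hB n)).2, le_max_left B |Real.log C.toReal|]) fun m n => ?_
    have hsub : x (m + n) ≤ C * (x m * x n) := by
      simpa only [hx, pow_add] using hmul v i _ _ (hpow m).1 (hpow m).2 (hpow n).1 (hpow n).2
    linarith [log_toReal_le_of_le_mul (hx0 _) (hmul0 m n) hC hsub, hlog m n,
      le_max_right B |Real.log C.toReal|]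
  · obtain ⟨C, hC, hmul⟩ := hμ.exists_mul_imageMoment_coordMap_le hconn hrosc hp hq hq1
    refine exists_tendsto_div_of_almost_superadditive (C := max B |Real.log C.toReal|)
      (fun n => by linarith [(abs_le.1 (hB n)).1, le_max_left B |Real.log C.toReal|]) fun m n => ?_
    have hsuper : x m * x n ≤ C * x (m + n) := by
      simpa only [hx, pow_add] using hmul v i _ _ (hpow m).1 (hpow m).2 (hpow n).1 (hpow n).2
    linarith [log_toReal_le_of_le_mul (hmul0 m n) (hx0 _) hC hsuper, hlog m n,
      le_max_right B |Real.log C.toReal|]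

end IsSelfAffineFamily

/-- The `L^q`-spectrum of the `i`-th projection of `μ_v`. -/
noncomputable def tau (μ : V → Measure (Fin 2 → ℝ)) (q : ℝ) (v : V) (i : Fin 2) : ℝ :=
  lqSpectrum (projMeasure i (μ v)) q

namespace IsSelfAffineFamily

variable [Finite V]

lemma tendsto_log_meshMoment_projMeasure (hμ : G.IsSelfAffineFamily p μ)
    (hconn : G.StronglyConnected) (hrosc : G.ROSC) (hp : G.IsProbVector p) (hq : 0 ≤ q) (v : V)
    (i : Fin 2) : Tendsto (fun δ : ℝ => Real.log (meshMoment (projMeasure i (μ v)) q δ) /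
      (-Real.log δ)) (𝓝[>] 0) (𝓝 (tau μ q v i)) := by
  have := hμ.1 v
  obtain ⟨L, hL⟩ := hμ.exists_tendsto_log_imageMoment_dyadic_div hconn hrosc hp hq v i
  have hlim : Tendsto (fun δ : ℝ => Real.log (meshMoment (projMeasure i (μ v)) q δ) /
      (-Real.log δ)) (𝓝[>] 0) (𝓝 (L / Real.log 2)) :=
    ((hμ.scaleRegular_coordMap hrosc hp hq v i).tendsto_of_dyadic hL).congr fun δ => by
      rw [← meshMoment_map hq (measurable_coordMap i)]
      rfl
  rwa [tau, lqSpectrum_eq_of_tendsto hlim]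

lemma tendsto_log_imageMoment_coordMap (hμ : G.IsSelfAffineFamily p μ)
    (hconn : G.StronglyConnected) (hrosc : G.ROSC) (hp : G.IsProbVector p) (hq : 0 ≤ q) (v : V)
    (i : Fin 2) : Tendsto (fun δ : ℝ => Real.log (imageMoment q (μ v) (coordMap i) δ).toReal /
      (-Real.log δ)) (𝓝[>] 0) (𝓝 (tau μ q v i)) := by
  have := hμ.1 v
  refine (hμ.tendsto_log_meshMoment_projMeasure hconn hrosc hp hq v i).congr fun δ => ?_
  rw [← meshMoment_map hq (measurable_coordMap i)]
  rfl

lemma tau_terminal (hμ : G.IsSelfAffineFamily p μ) (hconn : G.StronglyConnected)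
    (hrosc : G.ROSC) (hp : G.IsProbVector p) (hq : 0 ≤ q) {v : V} {w : List E}
    (hw : G.IsPathFrom v w) (i : Fin 2) :
    tau μ q (G.terminal v w) (G.inputCoord w i) = tau μ q v i := by
  obtain ⟨C, hC, hcomp⟩ := hμ.exists_imageMoment_coordMap_comparable hconn hp hq
  refine tendsto_nhds_unique (hμ.tendsto_log_imageMoment_coordMap hconn hrosc hp hq _ _)
    (tendsto_log_div_of_abs_log_sub_le (C := |Real.log C.toReal|) (fun δ hδ => ?_)
      (hμ.tendsto_log_imageMoment_coordMap hconn hrosc hp hq v i))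
  exact abs_log_toReal_sub_le ((hμ.scaleRegular_coordMap hrosc hp hq _ _).pos δ hδ)
    ((hμ.scaleRegular_coordMap hrosc hp hq v i).pos δ hδ) hC (hcomp v w i hw δ hδ).1
    (hcomp v w i hw δ hδ).2

end IsSelfAffineFamily

end BoxLikeGIFS

lemma log_le_log_add_abs_log_of_le_mul {x y C : ℝ} (hx : 0 < x) (hy : 0 < y) (h : x ≤ C * y) :
    Real.log x ≤ Real.log y + |Real.log C| := by
  have hC : 0 < C := pos_of_mul_pos_left (hx.trans_le h) hy.le
  have hlog := Real.log_le_log hx h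
  rw [Real.log_mul hC.ne' hy.ne'] at hlog
  linarith [le_abs_self (Real.log C)]

/-! ### Sums of weights over words -/

/-- A positive function of a starting vertex and a word that is `1` at the empty word and changes at
most by the factor `C` with every letter. -/
structure IsWordWeight {V E : Type*} (f : V → List E → ℝ) (C : ℝ) : Prop where
  pos : ∀ v w, 0 < f v w
  nil : ∀ v, f v [] = 1
  one_le : 1 ≤ C
  snoc_le : ∀ v u e, f v (u ++ [e]) ≤ C * f v u
  le_snoc : ∀ v u e, f v u ≤ C * f v (u ++ [e])

namespace BoxLikeGIFS

variable {V E : Type*} {G : BoxLikeGIFS V E} {f : V → List E → ℝ} {C : ℝ}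

/-- The function `f` of words is submultiplicative along the paths of the graph. -/
def IsSubmul (G : BoxLikeGIFS V E) (f : V → List E → ℝ) : Prop :=
  ∀ v u w, G.IsPathFrom v (u ++ w) → f v (u ++ w) ≤ f v u * f (G.terminal v u) w

/-- The function `f` of words is supermultiplicative along the paths of the graph. -/
def IsSupermul (G : BoxLikeGIFS V E) (f : V → List E → ℝ) : Prop :=
  ∀ v u w, G.IsPathFrom v (u ++ w) → f v u * f (G.terminal v u) w ≤ f v (u ++ w)

section Edges

variable [Fintype E]

/-- The sum of `f` over the extensions of the word `u` from `v` by `n` letters. -/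
noncomputable def extSum (G : BoxLikeGIFS V E) (f : V → List E → ℝ) (n : ℕ) (v : V)
    (u : List E) : ℝ :=
  ∑ w ∈ G.paths n (G.terminal v u), f v (u ++ w)

lemma extSum_zero (f : V → List E → ℝ) (v : V) (u : List E) : G.extSum f 0 v u = f v u := by
  simp [extSum, paths_zero]

lemma extSum_nil (f : V → List E → ℝ) (n : ℕ) (v : V) :
    G.extSum f n v [] = ∑ w ∈ G.paths n v, f v w := by
  simp [extSum]

lemma sum_extSum_snoc (f : V → List E → ℝ) (n : ℕ) (v : V) (u : List E) :
    ∑ e ∈ G.outEdges (G.terminal v u), G.extSum f n v (u ++ [e]) = G.extSum f (n + 1) v u := by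
  simp only [extSum, sum_paths_succ', terminal_append, terminal_singleton, List.append_assoc,
    List.singleton_append]

lemma extSum_add (f : V → List E → ℝ) (m n : ℕ) (v : V) :
    G.extSum f (m + n) v [] = ∑ u ∈ G.paths m v, G.extSum f n v u := by
  rw [extSum_nil, sum_paths_add]
  rfl

lemma IsSubmul.extSum_le (h : G.IsSubmul f) (n : ℕ) {v : V} {u : List E} (hu : G.IsPathFrom v u) :
    G.extSum f n v u ≤ f v u * G.extSum f n (G.terminal v u) [] := by
  rw [extSum_nil, extSum, Finset.mul_sum]
  exact Finset.sum_le_sum fun w hw =>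
    h v u w (G.isPathFrom_append.2 ⟨hu, (G.mem_paths.1 hw).2⟩)

lemma IsSupermul.le_extSum (h : G.IsSupermul f) (n : ℕ) {v : V} {u : List E}
    (hu : G.IsPathFrom v u) : f v u * G.extSum f n (G.terminal v u) [] ≤ G.extSum f n v u := by
  rw [extSum_nil, extSum, Finset.mul_sum]
  exact Finset.sum_le_sum fun w hw =>
    h v u w (G.isPathFrom_append.2 ⟨hu, (G.mem_paths.1 hw).2⟩)

lemma StronglyConnected.outEdges_nonempty (hconn : G.StronglyConnected) (v : V) :
    (G.outEdges v).Nonempty := by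
  obtain ⟨w, hne, hw⟩ := hconn v v
  cases w with
  | nil => exact (hne rfl).elim
  | cons e w => exact ⟨e, G.mem_outEdges.2 hw.1⟩

lemma extSum_nonneg (hf : IsWordWeight f C) (n : ℕ) (v : V) (u : List E) :
    0 ≤ G.extSum f n v u := Finset.sum_nonneg fun _ _ => (hf.pos _ _).le

lemma extSum_succ_le (hf : IsWordWeight f C) (n : ℕ) (v : V) (u : List E) :
    G.extSum f (n + 1) v u ≤ C * Fintype.card E * G.extSum f n v u := by
  have hC : 0 ≤ C := zero_le_one.trans hf.one_le
  rw [extSum, sum_paths_succ, extSum, Finset.mul_sum]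
  refine Finset.sum_le_sum fun w _ => ?_
  calc ∑ e ∈ G.outEdges (G.terminal (G.terminal v u) w), f v (u ++ (w ++ [e]))
      ≤ (G.outEdges (G.terminal (G.terminal v u) w)).card • (C * f v (u ++ w)) :=
        Finset.sum_le_card_nsmul _ _ _ fun e _ => by
          rw [← List.append_assoc]
          exact hf.snoc_le _ _ _
    _ ≤ Fintype.card E • (C * f v (u ++ w)) :=
        nsmul_le_nsmul_left (mul_nonneg hC (hf.pos _ _).le) (Finset.card_le_univ _)
    _ = C * Fintype.card E * f v (u ++ w) := by
        rw [nsmul_eq_mul]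
        ring

lemma extSum_le_succ (hf : IsWordWeight f C) (hconn : G.StronglyConnected) (n : ℕ) (v : V)
    (u : List E) : G.extSum f n v u ≤ C * G.extSum f (n + 1) v u := by
  have hC : 0 ≤ C := zero_le_one.trans hf.one_le
  rw [extSum, extSum, sum_paths_succ, Finset.mul_sum]
  refine Finset.sum_le_sum fun w _ => ?_
  obtain ⟨e, he⟩ := hconn.outEdges_nonempty (G.terminal (G.terminal v u) w)
  refine (hf.le_snoc v (u ++ w) e).trans (mul_le_mul_of_nonneg_left ?_ hC)
  rw [List.append_assoc]
  exact Finset.single_le_sum (f := fun e => f v (u ++ (w ++ [e]))) (fun _ _ => (hf.pos _ _).le) he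

lemma extSum_pos (hf : IsWordWeight f C) (hconn : G.StronglyConnected) (n : ℕ) (v : V)
    (u : List E) : 0 < G.extSum f n v u := by
  induction n with
  | zero => exact extSum_zero (G := G) f v u ▸ hf.pos v u
  | succ n ih =>
    exact pos_of_mul_pos_right (ih.trans_le (extSum_le_succ hf hconn n v u))
      (zero_le_one.trans hf.one_le)

lemma extSum_add_le (hf : IsWordWeight f C) (m n : ℕ) (v : V) (u : List E) :
    G.extSum f (n + m) v u ≤ (C * Fintype.card E) ^ m * G.extSum f n v u := by
  have hC : 0 ≤ C := zero_le_one.trans hf.one_le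
  induction m with
  | zero => simp
  | succ m ih =>
    refine (extSum_succ_le hf (n + m) v u).trans ?_
    rw [pow_succ', mul_assoc (C * _)]
    exact mul_le_mul_of_nonneg_left ih (by positivity)

lemma extSum_le_pow_mul (hf : IsWordWeight f C) (n : ℕ) (v : V) (u : List E) :
    G.extSum f n v u ≤ (C * Fintype.card E) ^ n * f v u := by
  simpa only [zero_add, extSum_zero] using extSum_add_le (G := G) hf n 0 v u

lemma IsSupermul.mul_extSum_terminal_le (hsup : G.IsSupermul f) (hf : IsWordWeight f C) (n : ℕ)
    {v : V} {u : List E} (hu : G.IsPathFrom v u) :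
    f v u * G.extSum f n (G.terminal v u) [] ≤
      (C * Fintype.card E) ^ u.length * G.extSum f n v [] :=
  calc f v u * G.extSum f n (G.terminal v u) [] ≤ G.extSum f n v u := hsup.le_extSum n hu
    _ ≤ ∑ u' ∈ G.paths u.length v, G.extSum f n v u' :=
        Finset.single_le_sum (f := fun u' => G.extSum f n v u')
          (fun _ _ => extSum_nonneg hf _ _ _) (G.mem_paths.2 ⟨rfl, hu⟩)
    _ = G.extSum f (n + u.length) v [] := by rw [add_comm, extSum_add]
    _ ≤ (C * Fintype.card E) ^ u.length * G.extSum f n v [] := extSum_add_le hf _ _ _ _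

lemma IsSupermul.exists_extSum_nil_le_mul [Finite V] (hsup : G.IsSupermul f)
    (hf : IsWordWeight f C) (hconn : G.StronglyConnected) :
    ∃ B : ℝ, 0 < B ∧ ∀ n v v', G.extSum f n v' [] ≤ B * G.extSum f n v [] := by
  have := Fintype.ofFinite V
  have hC : 0 ≤ C := zero_le_one.trans hf.one_le
  have hpair : ∀ x : V × V, ∃ B : ℝ, 0 ≤ B ∧
      ∀ n, G.extSum f n x.2 [] ≤ B * G.extSum f n x.1 [] := by
    rintro ⟨v, v'⟩
    obtain ⟨u, -, hu⟩ := hconn v v'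
    obtain ⟨hpath, rfl⟩ := G.isPath_iff.1 hu
    refine ⟨(C * Fintype.card E) ^ u.length / f v u,
      div_nonneg (by positivity) (hf.pos _ _).le, fun n => ?_⟩
    rw [div_mul_eq_mul_div, le_div_iff₀ (hf.pos _ _), mul_comm]
    exact hsup.mul_extSum_terminal_le hf n hpath
  choose B hB0 hB using hpair
  refine ⟨∑ x, B x + 1, add_pos_of_nonneg_of_pos (Finset.sum_nonneg fun x _ => hB0 x) one_pos,
    fun n v v' => (hB (v, v') n).trans ?_⟩
  have hle := Finset.single_le_sum (fun x _ => hB0 x) (Finset.mem_univ (v, v'))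
  exact mul_le_mul_of_nonneg_right (by linarith) (extSum_nonneg hf _ _ _)

lemma IsSupermul.sum_range_extSum_le (hsup : G.IsSupermul f) (hf : IsWordWeight f C) {N : ℕ}
    (hN : ∀ v, 1 ≤ G.extSum f N v []) {v : V} {u : List E} (hu : G.IsPathFrom v u) :
    ∑ n ∈ Finset.range N, G.extSum f n v u ≤
      ∑ e ∈ G.outEdges (G.terminal v u), ∑ n ∈ Finset.range N, G.extSum f n v (u ++ [e]) := by
  have hchildren : ∑ e ∈ G.outEdges (G.terminal v u), ∑ n ∈ Finset.range N,
      G.extSum f n v (u ++ [e]) = ∑ n ∈ Finset.range N, G.extSum f (n + 1) v u := by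
    rw [Finset.sum_comm]
    exact Finset.sum_congr rfl fun n _ => sum_extSum_snoc f n v u
  have htelescope := Finset.sum_range_succ (fun n => G.extSum f n v u) N
  rw [Finset.sum_range_succ', extSum_zero] at htelescope
  have hlast : f v u ≤ G.extSum f N v u :=
    (le_mul_of_one_le_right (hf.pos v u).le (hN _)).trans (hsup.le_extSum N hu)
  linarith

variable {ρ : List E → ℝ} {a b δ : ℝ}

lemma IsSubmul.extSum_nil_le_sum_stopSet (hsub : G.IsSubmul f) (hρ : IsScale ρ a b) (hδ : 0 < δ)
    (hδ1 : δ ≤ 1) {M n : ℕ} (hM : ∀ u : List E, δ ≤ ρ u → u.length < M) (hn : M ≤ n) (v : V) :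
    G.extSum f n v [] ≤
      ∑ w ∈ G.stopSet hρ hδ v, f v w * G.extSum f (n - w.length) (G.terminal v w) [] := by
  have hlive : ∀ u, G.IsLive ρ δ v u → G.extSum f (n - u.length) v u ≤
      ∑ e ∈ G.outEdges (G.terminal v u), G.extSum f (n - (u ++ [e]).length) v (u ++ [e]) := by
    intro u hu
    have hlength : n - u.length = n - (u.length + 1) + 1 := by
      have := hM u hu.2
      omega
    simp only [List.length_append, List.length_singleton]
    rw [sum_extSum_snoc, ← hlength]
  calc G.extSum f n v [] = G.extSum f (n - ([] : List E).length) v [] := rfl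
    _ ≤ ∑ w ∈ G.stopSet hρ hδ v, G.extSum f (n - w.length) v w :=
        le_sum_stopSet (f := fun u => G.extSum f (n - u.length) v u) hρ hδ hδ1 v hlive
    _ ≤ _ := Finset.sum_le_sum fun w hw => hsub.extSum_le _ (mem_stopSet.1 hw).1

lemma IsSubmul.extSum_nil_le_of_sum_stopSet_le_one (hsub : G.IsSubmul f) (hf : IsWordWeight f C)
    (hρ : IsScale ρ a b) (hδ : 0 < δ) (hδ1 : δ ≤ 1) {M : ℕ}
    (hM : ∀ u : List E, δ ≤ ρ u → u.length < M) {B : ℝ} (hB : ∀ n < M, ∀ v, G.extSum f n v [] ≤ B)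
    (hle : ∀ v, ∑ w ∈ G.stopSet hρ hδ v, f v w ≤ 1) (n : ℕ) (v : V) : G.extSum f n v [] ≤ B := by
  induction n using Nat.strong_induction_on generalizing v with
  | _ n ih =>
    rcases lt_or_ge n M with hn | hn
    · exact hB n hn v
    have hB0 : 0 ≤ B :=
      (extSum_nonneg hf _ _ _).trans (hB 0 (Nat.pos_of_ne_zero fun hM0 => by
        simpa [hM0] using hM [] (hρ.nil ▸ hδ1)) v)
    calc G.extSum f n v []
        ≤ ∑ w ∈ G.stopSet hρ hδ v, f v w * G.extSum f (n - w.length) (G.terminal v w) [] :=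
          hsub.extSum_nil_le_sum_stopSet hρ hδ hδ1 hM hn v
      _ ≤ ∑ w ∈ G.stopSet hρ hδ v, f v w * B := Finset.sum_le_sum fun w hw => by
          have hne : w ≠ [] := fun h => not_isStop_nil v (h ▸ mem_stopSet.1 hw)
          have hlength := List.length_pos_of_ne_nil hne
          have hnpos : 0 < M := lt_of_le_of_lt (Nat.zero_le _) (hM [] (hρ.nil ▸ hδ1))
          exact mul_le_mul_of_nonneg_left (ih _ (by omega) _) (hf.pos _ _).le
      _ = (∑ w ∈ G.stopSet hρ hδ v, f v w) * B := (Finset.sum_mul _ _ _).symm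
      _ ≤ B := mul_le_of_le_one_left hB0 (hle v)

end Edges

section Graph

variable [Fintype E] [Fintype V]

/-- The sum of `f` over all paths of length `n`. -/
noncomputable def total (G : BoxLikeGIFS V E) (f : V → List E → ℝ) (n : ℕ) : ℝ :=
  ∑ v, G.extSum f n v []

lemma extSum_nil_le_total (hf : IsWordWeight f C) (n : ℕ) (v : V) :
    G.extSum f n v [] ≤ G.total f n :=
  Finset.single_le_sum (f := fun v => G.extSum f n v []) (fun _ _ => extSum_nonneg hf _ _ _)
    (Finset.mem_univ v)

lemma total_pos [Nonempty V] (hf : IsWordWeight f C) (hconn : G.StronglyConnected) (n : ℕ) :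
    0 < G.total f n :=
  Finset.sum_pos (fun v _ => extSum_pos hf hconn n v []) Finset.univ_nonempty

lemma total_succ_le (hf : IsWordWeight f C) (n : ℕ) :
    G.total f (n + 1) ≤ C * Fintype.card E * G.total f n := by
  rw [total, total, Finset.mul_sum]
  exact Finset.sum_le_sum fun v _ => extSum_succ_le hf n v []

lemma total_le_succ (hf : IsWordWeight f C) (hconn : G.StronglyConnected) (n : ℕ) :
    G.total f n ≤ C * G.total f (n + 1) := by
  rw [total, total, Finset.mul_sum]
  exact Finset.sum_le_sum fun v _ => extSum_le_succ hf hconn n v []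

lemma total_le_of_extSum_nil_le {B : ℝ} {n : ℕ} (hB : ∀ v, G.extSum f n v [] ≤ B) :
    G.total f n ≤ Fintype.card V * B := by
  simpa only [total, nsmul_eq_mul, Finset.card_univ] using
    Finset.sum_le_card_nsmul Finset.univ (fun v => G.extSum f n v []) B fun v _ => hB v

lemma IsSubmul.total_add_le (hsub : G.IsSubmul f) (hf : IsWordWeight f C) (m n : ℕ) :
    G.total f (m + n) ≤ G.total f m * G.total f n := by
  rw [total, total, Finset.sum_mul]
  refine Finset.sum_le_sum fun v _ => ?_
  rw [extSum_add, extSum_nil, Finset.sum_mul]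
  refine Finset.sum_le_sum fun u hu => (hsub.extSum_le n (G.mem_paths.1 hu).2).trans ?_
  exact mul_le_mul_of_nonneg_left (extSum_nil_le_total hf n _) (hf.pos _ _).le

lemma IsSupermul.total_mul_le (hsup : G.IsSupermul f) (hf : IsWordWeight f C) {B : ℝ}
    (hB0 : 0 < B) (hB : ∀ n v v', G.extSum f n v' [] ≤ B * G.extSum f n v []) (m n : ℕ) :
    G.total f m * G.total f n ≤ Fintype.card V * B * G.total f (m + n) := by
  rw [total, total.eq_def G f (m + n), Finset.sum_mul, Finset.mul_sum]
  refine Finset.sum_le_sum fun v _ => ?_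
  rw [extSum_add, extSum_nil, Finset.sum_mul, Finset.mul_sum]
  refine Finset.sum_le_sum fun u hu => ?_
  calc f v u * G.total f n
      ≤ f v u * (Fintype.card V * (B * G.extSum f n (G.terminal v u) [])) :=
        mul_le_mul_of_nonneg_left (total_le_of_extSum_nil_le (hB n _)) (hf.pos _ _).le
    _ = Fintype.card V * B * (f v u * G.extSum f n (G.terminal v u) []) := by ring
    _ ≤ Fintype.card V * B * G.extSum f n v u :=
        mul_le_mul_of_nonneg_left (hsup.le_extSum n (G.mem_paths.1 hu).2) (by positivity)

lemma IsSubmul.exists_tendsto_log_total [Nonempty V] (hsub : G.IsSubmul f)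
    (hf : IsWordWeight f C) (hconn : G.StronglyConnected) :
    ∃ L, Tendsto (fun n : ℕ => Real.log (G.total f n) / n) atTop (𝓝 L) := by
  have hpos := total_pos hf hconn
  refine exists_tendsto_div_of_almost_subadditive (C := |Real.log C|) (fun n => ?_) fun m n => ?_
  · rw [sub_le_iff_le_add]
    exact log_le_log_add_abs_log_of_le_mul (hpos n) (hpos (n + 1)) (total_le_succ hf hconn n)
  · have hlog := Real.log_le_log (hpos _) (hsub.total_add_le hf m n)
    rw [Real.log_mul (hpos m).ne' (hpos n).ne'] at hlog
    exact hlog.trans (le_add_of_nonneg_right (abs_nonneg _))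

lemma IsSupermul.exists_tendsto_log_total [Nonempty V] (hsup : G.IsSupermul f)
    (hf : IsWordWeight f C) (hconn : G.StronglyConnected) :
    ∃ L, Tendsto (fun n : ℕ => Real.log (G.total f n) / n) atTop (𝓝 L) := by
  have hpos := total_pos hf hconn
  obtain ⟨B, hB0, hB⟩ := hsup.exists_extSum_nil_le_mul hf hconn
  refine exists_tendsto_div_of_almost_superadditive
    (C := |Real.log (C * Fintype.card E)| + |Real.log (Fintype.card V * B)|) (fun n => ?_)
    fun m n => ?_
  · have hlog := log_le_log_add_abs_log_of_le_mul (hpos (n + 1)) (hpos n) (total_succ_le hf n)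
    linarith [abs_nonneg (Real.log (Fintype.card V * B))]
  · have hlog := log_le_log_add_abs_log_of_le_mul (mul_pos (hpos m) (hpos n)) (hpos (m + n))
      (hsup.total_mul_le hf hB0 hB m n)
    rw [Real.log_mul (hpos m).ne' (hpos n).ne'] at hlog
    linarith [abs_nonneg (Real.log (C * Fintype.card E))]

/-! ### Sums of weights over stopping words -/

lemma exists_lt_total [Nonempty V] (hf : IsWordWeight f C) (hconn : G.StronglyConnected) {L : ℝ}
    (hL : Tendsto (fun n : ℕ => Real.log (G.total f n) / n) atTop (𝓝 L)) (hL0 : 0 < L) (K : ℝ) :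
    ∃ n, 1 ≤ n ∧ K < G.total f n := by
  have hlim : Tendsto (fun n : ℕ => Real.log (G.total f n) / n * n) atTop atTop :=
    hL.pos_mul_atTop hL0 tendsto_natCast_atTop_atTop
  obtain ⟨n, hn, hn1⟩ := ((hlim.eventually_gt_atTop (Real.log (|K| + 1))).and
    (eventually_ge_atTop 1)).exists
  refine ⟨n, hn1, ?_⟩
  rw [div_mul_cancel₀ _ (Nat.cast_ne_zero.2 (Nat.one_le_iff_ne_zero.1 hn1))] at hn
  have hlt := (Real.log_lt_log_iff (by positivity) (total_pos hf hconn n)).1 hn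
  linarith [le_abs_self K]

lemma summable_total [Nonempty V] (hf : IsWordWeight f C) (hconn : G.StronglyConnected) {L : ℝ}
    (hL : Tendsto (fun n : ℕ => Real.log (G.total f n) / n) atTop (𝓝 L)) (hL0 : L < 0) :
    Summable (G.total f) := by
  have hpos := total_pos hf hconn
  have hr : Real.exp (L / 2) < 1 := Real.exp_lt_one_iff.2 (by linarith)
  refine summable_of_isBigO_nat (summable_geometric_of_lt_one (Real.exp_pos _).le hr)
    (Asymptotics.IsBigO.of_bound 1 ?_)
  filter_upwards [hL.eventually_lt_const (show L < L / 2 by linarith), eventually_ge_atTop 1]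
    with n hn hn1
  rw [div_lt_iff₀ (Nat.cast_pos.2 hn1)] at hn
  rw [one_mul, Real.norm_of_nonneg (hpos n).le, Real.norm_of_nonneg (by positivity),
    ← Real.exp_nat_mul, ← Real.log_le_iff_le_exp (hpos n)]
  linarith

lemma sum_le_tsum_total (hf : IsWordWeight f C) (hsum : Summable (G.total f)) {v : V}
    {S : Finset (List E)} (hS : ∀ w ∈ S, G.IsPathFrom v w) :
    ∑ w ∈ S, f v w ≤ ∑' n, G.total f n := by
  classical
  rw [← Finset.sum_fiberwise_of_maps_to (g := List.length)
    fun w hw => Finset.mem_image_of_mem List.length hw]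
  refine (Finset.sum_le_sum fun n _ => ?_).trans (hsum.sum_le_tsum (S.image List.length)
    fun n _ => Finset.sum_nonneg fun v _ => extSum_nonneg hf _ _ _)
  refine le_trans ?_ (extSum_nil_le_total hf n v)
  rw [extSum_nil]
  refine Finset.sum_le_sum_of_subset_of_nonneg (fun w hw => ?_) fun _ _ _ => (hf.pos _ _).le
  rw [Finset.mem_filter] at hw
  exact G.mem_paths.2 ⟨hw.2, hS w hw.1⟩

variable {ρ : List E → ℝ} {a b δ : ℝ}

lemma exists_sum_stopSet_le [Nonempty V] (hf : IsWordWeight f C) (hconn : G.StronglyConnected)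
    (hρ : IsScale ρ a b) {L : ℝ}
    (hL : Tendsto (fun n : ℕ => Real.log (G.total f n) / n) atTop (𝓝 L)) (hL0 : L < 0) :
    ∃ B : ℝ, ∀ δ (hδ : 0 < δ) v, ∑ w ∈ G.stopSet hρ hδ v, f v w ≤ B :=
  ⟨∑' n, G.total f n, fun _ _ _ => sum_le_tsum_total hf (summable_total hf hconn hL hL0)
    fun _ hw => (mem_stopSet.1 hw).1⟩

/-- Summing `f` over the extensions by fewer than `N` letters gives a function of words that is
comparable to `f` and increases when a live word is replaced by its children, provided that the
sums over the paths of length `N` are at least `1`. -/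
lemma IsSupermul.exists_forall_le_sum_stopSet [Nonempty V] (hsup : G.IsSupermul f)
    (hf : IsWordWeight f C) (hconn : G.StronglyConnected) (hρ : IsScale ρ a b) {L : ℝ}
    (hL : Tendsto (fun n : ℕ => Real.log (G.total f n) / n) atTop (𝓝 L)) (hL0 : 0 < L) :
    ∃ c : ℝ, 0 < c ∧ ∀ δ (hδ : 0 < δ), δ ≤ 1 → ∀ v, c ≤ ∑ w ∈ G.stopSet hρ hδ v, f v w := by
  have hC : 0 ≤ C := zero_le_one.trans hf.one_le
  obtain ⟨B, hB0, hB⟩ := hsup.exists_extSum_nil_le_mul hf hconn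
  obtain ⟨N, hN1, hlarge⟩ := exists_lt_total hf hconn hL hL0 (Fintype.card V * B)
  have hN : ∀ v, 1 ≤ G.extSum f N v [] := fun v => by
    have hle := hlarge.le.trans (total_le_of_extSum_nil_le (hB N v))
    rw [← mul_assoc] at hle
    exact le_of_mul_le_mul_left (by rwa [mul_one]) (by positivity)
  set K : ℝ := ∑ n ∈ Finset.range N, (C * Fintype.card E) ^ n
  have hwindow : ∀ δ (hδ : 0 < δ), δ ≤ 1 → ∀ v, 1 ≤ K * ∑ w ∈ G.stopSet hρ hδ v, f v w := by
    intro δ hδ hδ1 v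
    calc 1 = G.extSum f 0 v [] := by rw [extSum_zero, hf.nil]
      _ ≤ ∑ n ∈ Finset.range N, G.extSum f n v [] :=
          Finset.single_le_sum (f := fun n => G.extSum f n v [])
            (fun n _ => extSum_nonneg hf _ _ _) (Finset.mem_range.2 hN1)
      _ ≤ ∑ w ∈ G.stopSet hρ hδ v, ∑ n ∈ Finset.range N, G.extSum f n v w :=
          le_sum_stopSet (f := fun u => ∑ n ∈ Finset.range N, G.extSum f n v u) hρ hδ hδ1 v
            fun u hu => hsup.sum_range_extSum_le hf hN hu.1
      _ ≤ ∑ w ∈ G.stopSet hρ hδ v, K * f v w := Finset.sum_le_sum fun w _ => by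
          rw [Finset.sum_mul]
          exact Finset.sum_le_sum fun n _ => extSum_le_pow_mul hf n v w
      _ = K * ∑ w ∈ G.stopSet hρ hδ v, f v w := (Finset.mul_sum _ _ _).symm
  have hK : 0 < K := one_pos.trans_le <| by
    simpa only [pow_zero] using
      Finset.single_le_sum (f := fun n => (C * Fintype.card E) ^ n) (fun n _ => by positivity)
        (Finset.mem_range.2 hN1)
  exact ⟨1 / K, by positivity, fun δ hδ hδ1 v => (div_le_iff₀' hK).2 (hwindow δ hδ hδ1 v)⟩

lemma IsSubmul.exists_one_le_sum_stopSet [Nonempty V] (hsub : G.IsSubmul f)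
    (hf : IsWordWeight f C) (hconn : G.StronglyConnected) (hρ : IsScale ρ a b) {L : ℝ}
    (hL : Tendsto (fun n : ℕ => Real.log (G.total f n) / n) atTop (𝓝 L)) (hL0 : 0 < L)
    (hδ : 0 < δ) (hδ1 : δ ≤ 1) : ∃ v, 1 ≤ ∑ w ∈ G.stopSet hρ hδ v, f v w := by
  by_contra! hlt
  obtain ⟨M, hM⟩ := hρ.exists_length_lt hδ
  set B : ℝ := ∑ n ∈ Finset.range M, G.total f n
  have hB : ∀ n < M, ∀ v, G.extSum f n v [] ≤ B := fun n hn v =>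
    (extSum_nil_le_total hf n v).trans (Finset.single_le_sum (f := G.total f)
      (fun n _ => (total_pos hf hconn n).le) (Finset.mem_range.2 hn))
  obtain ⟨n, -, hn⟩ := exists_lt_total hf hconn hL hL0 (Fintype.card V * B)
  exact hn.not_ge (total_le_of_extSum_nil_le
    (hsub.extSum_nil_le_of_sum_stopSet_le_one hf hρ hδ hδ1 hM hB (fun v => (hlt v).le) n))

lemma exists_le_sum_stopSet [Nonempty V] (hf : IsWordWeight f C) (hconn : G.StronglyConnected)
    (h : G.IsSubmul f ∨ G.IsSupermul f) (hρ : IsScale ρ a b) {L : ℝ}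
    (hL : Tendsto (fun n : ℕ => Real.log (G.total f n) / n) atTop (𝓝 L)) (hL0 : 0 < L) :
    ∃ c : ℝ, 0 < c ∧ ∀ δ (hδ : 0 < δ), δ ≤ 1 → ∃ v, c ≤ ∑ w ∈ G.stopSet hρ hδ v, f v w := by
  rcases h with hsub | hsup
  · exact ⟨1, one_pos, fun δ hδ hδ1 => hsub.exists_one_le_sum_stopSet hf hconn hρ hL hL0 hδ hδ1⟩
  · obtain ⟨c, hc, h⟩ := hsup.exists_forall_le_sum_stopSet hf hconn hρ hL hL0
    exact ⟨c, hc, fun δ hδ hδ1 => ⟨Classical.arbitrary V, h δ hδ hδ1 _⟩⟩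

end Graph

end BoxLikeGIFS

/-! ### The modified singular value function -/

lemma continuous_of_slope_bounds {L : ℝ → ℝ} {x y : ℝ}
    (hle : ∀ s s', s ≤ s' → L s' ≤ L s + (s' - s) * x)
    (hge : ∀ s s', s ≤ s' → L s + (s' - s) * y ≤ L s') : Continuous L := by
  refine (LipschitzWith.of_le_add_mul (‖x‖₊ + ‖y‖₊) fun s s' => ?_).continuous
  rw [NNReal.coe_add, coe_nnnorm, coe_nnnorm, Real.norm_eq_abs, Real.norm_eq_abs, Real.dist_eq]
  rcases le_total s s' with h | h
  · rw [abs_sub_comm, abs_of_nonneg (sub_nonneg.2 h)]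
    nlinarith [hge s s' h, neg_abs_le y, abs_nonneg x, sub_nonneg.2 h]
  · rw [abs_of_nonneg (sub_nonneg.2 h)]
    nlinarith [hle s' s h, le_abs_self x, abs_nonneg y, sub_nonneg.2 h]

lemma strictAnti_of_slope_le {L : ℝ → ℝ} {x : ℝ} (hx : x < 0)
    (hle : ∀ s s', s ≤ s' → L s' ≤ L s + (s' - s) * x) : StrictAnti L := fun s s' h =>
  (hle s s' h.le).trans_lt (by linarith [mul_neg_of_pos_of_neg (sub_pos.2 h) hx])

lemma exists_eq_zero_of_slope_bounds {L : ℝ → ℝ} {x y : ℝ} (hx : x < 0)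
    (hle : ∀ s s', s ≤ s' → L s' ≤ L s + (s' - s) * x)
    (hge : ∀ s s', s ≤ s' → L s + (s' - s) * y ≤ L s') : ∃ γ, L γ = 0 := by
  have hmul : |L 0| / x * x = |L 0| := div_mul_cancel₀ _ hx.ne
  have hdiv : |L 0| / x ≤ 0 := div_nonpos_of_nonneg_of_nonpos (abs_nonneg _) hx.le
  refine mem_range_of_exists_le_of_exists_ge (continuous_of_slope_bounds hle hge)
    ⟨-(|L 0| / x), ?_⟩ ⟨|L 0| / x, ?_⟩
  · linarith [hle 0 (-(|L 0| / x)) (by linarith), le_abs_self (L 0)]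
  · linarith [hle (|L 0| / x) 0 hdiv, neg_abs_le (L 0)]

lemma rpow_le_rpow_mul_rpow_of_abs_le {x y C t T : ℝ} (hx : 0 < x) (hy : 0 < y) (hC : 1 ≤ C)
    (hxy : x ≤ C * y) (hyx : y ≤ C * x) (ht : |t| ≤ T) : x ^ t ≤ C ^ T * y ^ t := by
  have hC0 : 0 < C := one_pos.trans_le hC
  rcases le_total 0 t with h | h
  · calc x ^ t ≤ (C * y) ^ t := Real.rpow_le_rpow hx.le hxy h
      _ = C ^ t * y ^ t := Real.mul_rpow hC0.le hy.le
      _ ≤ C ^ T * y ^ t := by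
        gcongr
        exact (le_abs_self t).trans ht
  · calc x ^ t ≤ (C⁻¹ * y) ^ t := Real.rpow_le_rpow_of_nonpos (by positivity)
          ((inv_mul_le_iff₀ hC0).2 hyx) h
      _ = C ^ (-t) * y ^ t := by
        rw [Real.mul_rpow (by positivity) hy.le, Real.inv_rpow hC0.le, Real.rpow_neg hC0.le]
      _ ≤ C ^ T * y ^ t := by
        gcongr
        exact (neg_le_abs t).trans ht

namespace IsWordWeight

variable {V E : Type*} {f g : V → List E → ℝ} {C D : ℝ}

lemma mul (hf : IsWordWeight f C) (hg : IsWordWeight g D) :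
    IsWordWeight (fun v w => f v w * g v w) (C * D) where
  pos v w := mul_pos (hf.pos v w) (hg.pos v w)
  nil v := by rw [hf.nil, hg.nil, one_mul]
  one_le := one_le_mul_of_one_le_of_one_le hf.one_le hg.one_le
  snoc_le v u e := by
    rw [mul_mul_mul_comm]
    exact mul_le_mul (hf.snoc_le v u e) (hg.snoc_le v u e) (hg.pos _ _).le
      ((hf.pos _ _).le.trans (hf.snoc_le v u e))
  le_snoc v u e := by
    rw [mul_mul_mul_comm]
    exact mul_le_mul (hf.le_snoc v u e) (hg.le_snoc v u e) (hg.pos _ _).le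
      ((hf.pos _ _).le.trans (hf.le_snoc v u e))

lemma exists_rpow [Finite V] (hf : IsWordWeight f C) (t : V → ℝ) :
    ∃ D, IsWordWeight (fun v w => f v w ^ t v) D := by
  obtain ⟨T, hT⟩ := (Set.finite_range fun v => |t v|).bddAbove
  have ht (v) : |t v| ≤ max T 0 := (hT ⟨v, rfl⟩).trans (le_max_left _ _)
  refine ⟨C ^ max T 0, fun v w => Real.rpow_pos_of_pos (hf.pos v w) _, fun v => ?_,
    Real.one_le_rpow hf.one_le (le_max_right _ _), fun v u e => ?_, fun v u e => ?_⟩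
  · rw [hf.nil, Real.one_rpow]
  · exact rpow_le_rpow_mul_rpow_of_abs_le (hf.pos _ _) (hf.pos _ _) hf.one_le (hf.snoc_le v u e)
      (hf.le_snoc v u e) (ht v)
  · exact rpow_le_rpow_mul_rpow_of_abs_le (hf.pos _ _) (hf.pos _ _) hf.one_le (hf.le_snoc v u e)
      (hf.snoc_le v u e) (ht v)

end IsWordWeight

lemma IsScale.isWordWeight {V E : Type*} {ρ : List E → ℝ} {a b : ℝ} (hρ : IsScale ρ a b) :
    IsWordWeight (fun _ : V => ρ) (max a⁻¹ 1) where
  pos _ := hρ.pos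
  nil _ := hρ.nil
  one_le := le_max_right _ _
  snoc_le _ u e := (hρ.snoc_lt u e).le.trans
    (le_mul_of_one_le_left (hρ.pos u).le (le_max_right _ _))
  le_snoc _ u e := ((le_inv_mul_iff₀ hρ.lower_pos).2 (hρ.le_snoc u e)).trans
    (mul_le_mul_of_nonneg_right (le_max_left _ _) (hρ.pos _).le)

namespace BoxLikeGIFS

variable {V E : Type*} {G : BoxLikeGIFS V E} {p : E → ℝ} {μ : V → Measure (Fin 2 → ℝ)} {q : ℝ}
  {t : V → Fin 2 → ℝ}

lemma IsProbVector.le_one [Fintype E] (hp : G.IsProbVector p) (e : E) : p e ≤ 1 := by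
  classical
  rw [← hp.2 (G.src e)]
  exact Finset.single_le_sum (fun e _ => (hp.1 e).le) (by simp)

lemma IsProbVector.exists_isWordWeight [Fintype E] (hp : G.IsProbVector p) :
    ∃ C, IsWordWeight (fun _ : V => weight p) C := by
  obtain ⟨c, hc⟩ := (Set.finite_range fun e => (p e)⁻¹).bddAbove
  have hinv (e) : (p e)⁻¹ ≤ max c 1 := (hc ⟨e, rfl⟩).trans (le_max_left _ _)
  refine ⟨max c 1, fun _ => hp.weight_pos, fun _ => weight_nil p, le_max_right _ _,
    fun _ u e => ?_, fun _ u e => ?_⟩ <;>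
    rw [weight_append, weight, weight, List.map_singleton, List.prod_singleton, mul_comm _ (p e),
      ← weight]
  · exact mul_le_mul_of_nonneg_right ((hp.le_one e).trans (le_max_right _ _))
      (hp.weight_pos u).le
  · rw [← mul_assoc]
    exact le_mul_of_one_le_left (hp.weight_pos u).le
      ((inv_le_iff_one_le_mul₀ (hp.1 e)).1 (hinv e))

/-- The modified singular value function of the words from `v`. All factors but the last one are
multiplicative along paths, and `phi_eq_singularValueFn` identifies it with `φ^{s,q}` when `t` is
the family of `L^q`-spectra of the projected measures. -/
noncomputable def singularValueFn (G : BoxLikeGIFS V E) (p : E → ℝ) (q : ℝ) (t : V → Fin 2 → ℝ)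
    (s : ℝ) (v : V) (w : List E) : ℝ :=
  weight p w ^ q * (∏ i, G.side w i ^ t v i) * G.shortSide w ^ (s - ∑ i, t v i)

/-- The exponents `t` are invariant under the action of the paths on the coordinates. -/
def IsCompatible (G : BoxLikeGIFS V E) (t : V → Fin 2 → ℝ) : Prop :=
  ∀ v w i, G.IsPathFrom v w → t (G.terminal v w) (G.inputCoord w i) = t v i

lemma inputCoord_bijective (w : List E) : Function.Bijective (G.inputCoord w) :=
  Finite.injective_iff_bijective.1 (G.inputCoord_injective w)

namespace IsCompatible

lemma sum_terminal (ht : G.IsCompatible t) {v : V} {w : List E} (hw : G.IsPathFrom v w) :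
    ∑ i, t (G.terminal v w) i = ∑ i, t v i := by
  rw [← (inputCoord_bijective (G := G) w).sum_comp]
  exact Finset.sum_congr rfl fun i _ => ht v w i hw

lemma sum_eq_sum (ht : G.IsCompatible t) (hconn : G.StronglyConnected) (v v' : V) :
    ∑ i, t v' i = ∑ i, t v i := by
  obtain ⟨w, -, hw⟩ := hconn v v'
  rw [isPath_iff] at hw
  rw [← hw.2, ht.sum_terminal hw.1]

lemma prod_append (ht : G.IsCompatible t) {v : V} {u : List E} (hu : G.IsPathFrom v u)
    (w : List E) : ∏ i, G.side (u ++ w) i ^ t v i =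
      (∏ i, G.side u i ^ t v i) * ∏ i, G.side w i ^ t (G.terminal v u) i := by
  rw [← (inputCoord_bijective (G := G) u).prod_comp fun i => G.side w i ^ t (G.terminal v u) i,
    ← Finset.prod_mul_distrib]
  refine Finset.prod_congr rfl fun i _ => ?_
  rw [side_append, Real.mul_rpow (G.side_pos _ _).le (G.side_pos _ _).le, ht v u i hu]

end IsCompatible

lemma prod_side_rpow (t : Fin 2 → ℝ) (w : List E) : ∏ i, G.side w i ^ t i =
    G.longSide w ^ t (G.longDir w) * G.shortSide w ^ t (G.longDir w + 1) := by
  rw [← side_longDir, ← side_longDir_add_one, Fin.prod_univ_two]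
  rcases Fin.exists_fin_two.1 ⟨G.longDir w, rfl⟩ with h | h <;> rw [h]
  · rfl
  · rw [mul_comm]
    rfl

lemma sum_eq_longDir_add (t : Fin 2 → ℝ) (w : List E) :
    ∑ i, t i = t (G.longDir w) + t (G.longDir w + 1) := by
  rw [Fin.sum_univ_two]
  rcases Fin.exists_fin_two.1 ⟨G.longDir w, rfl⟩ with h | h <;> rw [h]
  · rfl
  · rw [add_comm]
    rfl

lemma singularValueFn_eq_longSide_rpow_mul (p : E → ℝ) (q : ℝ) (t : V → Fin 2 → ℝ) (s : ℝ) (v : V)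
    (w : List E) : G.singularValueFn p q t s v w =
      weight p w ^ q * G.longSide w ^ t v (G.longDir w) *
        G.shortSide w ^ (s - t v (G.longDir w)) := by
  have hexp : s - t v (G.longDir w) = t v (G.longDir w + 1) + (s - ∑ i, t v i) := by
    rw [sum_eq_longDir_add (G := G) (t v) w]
    ring
  rw [singularValueFn, prod_side_rpow, hexp, Real.rpow_add (G.shortSide_pos w)]
  ring

lemma singularValueFn_eq_shortSide_rpow_mul (p : E → ℝ) (q : ℝ) (t : V → Fin 2 → ℝ) (s s' : ℝ)
    (v : V) (w : List E) : G.singularValueFn p q t s' v w =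
      G.shortSide w ^ (s' - s) * G.singularValueFn p q t s v w := by
  have hexp : s' - ∑ i, t v i = (s' - s) + (s - ∑ i, t v i) := by ring
  rw [singularValueFn, singularValueFn, hexp, Real.rpow_add (G.shortSide_pos w)]
  ring

lemma tauWord_terminal (ht : G.IsCompatible (tau μ q)) {v : V} {w : List E}
    (hw : G.IsPathFrom v w) :
    G.tauWord μ q w (G.terminal v w) = tau μ q v (G.longDir w) := by
  rw [← ht v w _ hw, ← projIndex_eq]
  rfl

lemma phi_eq_singularValueFn (ht : G.IsCompatible (tau μ q)) (s : ℝ) {v : V} {w : List E}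
    (hw : G.IsPathFrom v w) :
    G.phi p μ s q w (G.terminal v w) = G.singularValueFn p q (tau μ q) s v w := by
  rw [phi, tauWord_terminal ht hw, (G.alpha_eq w).1, (G.alpha_eq w).2,
    singularValueFn_eq_longSide_rpow_mul, weight]

section

variable [Fintype E]

lemma singularValueFn_pos (hp : G.IsProbVector p) (t : V → Fin 2 → ℝ) (s : ℝ) (v : V)
    (w : List E) : 0 < G.singularValueFn p q t s v w :=
  mul_pos (mul_pos (Real.rpow_pos_of_pos (hp.weight_pos w) _)
    (Finset.prod_pos fun i _ => Real.rpow_pos_of_pos (G.side_pos w i) _))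
    (Real.rpow_pos_of_pos (G.shortSide_pos w) _)

lemma exists_isWordWeight_singularValueFn [Finite V] (hp : G.IsProbVector p)
    (t : V → Fin 2 → ℝ) (s : ℝ) : ∃ C, IsWordWeight (G.singularValueFn p q t s) C := by
  obtain ⟨a, b, h⟩ := G.exists_hasRatioBounds
  obtain ⟨C, hC⟩ := (hp.exists_isWordWeight (V := V)).choose_spec.exists_rpow fun _ => q
  obtain ⟨C₀, hC₀⟩ := ((h.isScale_side 0).isWordWeight (V := V)).exists_rpow fun v => t v 0
  obtain ⟨C₁, hC₁⟩ := ((h.isScale_side 1).isWordWeight (V := V)).exists_rpow fun v => t v 1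
  obtain ⟨D, hD⟩ := (h.isScale_shortSide.isWordWeight (V := V)).exists_rpow
    fun v => s - ∑ i, t v i
  refine ⟨C * (C₀ * C₁) * D, ?_⟩
  have hfn : G.singularValueFn p q t s = fun v w => weight p w ^ q *
      (G.side w 0 ^ t v 0 * G.side w 1 ^ t v 1) * G.shortSide w ^ (s - ∑ i, t v i) := by
    ext v w
    rw [singularValueFn, Fin.prod_univ_two]
  exact hfn ▸ (hC.mul (hC₀.mul hC₁)).mul hD

lemma singularValueFn_append (hp : G.IsProbVector p) (ht : G.IsCompatible t) (s : ℝ)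
    {v : V} {u w : List E} (huw : G.IsPathFrom v (u ++ w)) :
    G.singularValueFn p q t s v (u ++ w) =
      G.singularValueFn p q t s v u * G.singularValueFn p q t s (G.terminal v u) w *
        (G.shortSide (u ++ w) / (G.shortSide u * G.shortSide w)) ^ (s - ∑ i, t v i) := by
  have hu := (G.isPathFrom_append.1 huw).1
  have hpu := G.shortSide_pos u
  have hpw := G.shortSide_pos w
  rw [singularValueFn, singularValueFn, singularValueFn, weight_append,
    Real.mul_rpow (hp.weight_pos u).le (hp.weight_pos w).le, ht.prod_append hu,
    ht.sum_terminal hu, Real.div_rpow (G.shortSide_pos _).le (by positivity),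
    Real.mul_rpow hpu.le hpw.le]
  field_simp

lemma isSubmul_singularValueFn (hp : G.IsProbVector p) (ht : G.IsCompatible t) {s : ℝ}
    (hs : ∀ v, s ≤ ∑ i, t v i) : G.IsSubmul (G.singularValueFn p q t s) := by
  intro v u w huw
  rw [singularValueFn_append hp ht s huw]
  refine mul_le_of_le_one_right
    (mul_pos (singularValueFn_pos hp _ _ _ _) (singularValueFn_pos hp _ _ _ _)).le ?_
  refine Real.rpow_le_one_of_one_le_of_nonpos ?_ (by linarith [hs v])
  rw [one_le_div (mul_pos (G.shortSide_pos u) (G.shortSide_pos w))]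
  exact G.shortSide_mul_le u w

lemma isSupermul_singularValueFn (hp : G.IsProbVector p) (ht : G.IsCompatible t) {s : ℝ}
    (hs : ∀ v, ∑ i, t v i ≤ s) : G.IsSupermul (G.singularValueFn p q t s) := by
  intro v u w huw
  rw [singularValueFn_append hp ht s huw]
  refine le_mul_of_one_le_right
    (mul_pos (singularValueFn_pos hp _ _ _ _) (singularValueFn_pos hp _ _ _ _)).le ?_
  refine Real.one_le_rpow ?_ (by linarith [hs v])
  rw [one_le_div (mul_pos (G.shortSide_pos u) (G.shortSide_pos w))]
  exact G.shortSide_mul_le u w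

lemma isSubmul_or_isSupermul_singularValueFn (hconn : G.StronglyConnected)
    (hp : G.IsProbVector p) (ht : G.IsCompatible t) (s : ℝ) :
    G.IsSubmul (G.singularValueFn p q t s) ∨ G.IsSupermul (G.singularValueFn p q t s) := by
  by_cases h : ∀ v, s ≤ ∑ i, t v i
  · exact Or.inl (isSubmul_singularValueFn hp ht h)
  · push Not at h
    obtain ⟨v₀, hv₀⟩ := h
    exact Or.inr (isSupermul_singularValueFn hp ht fun v =>
      (ht.sum_eq_sum hconn v₀ v).trans_le hv₀.le)

/-! ### The pressure -/

lemma svMatrix_eq (ht : G.IsCompatible (tau μ q)) (s : ℝ) (k : ℕ) (v v' : V) :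
    G.svMatrix p μ s q k v v' = open Classical in
      ∑ w ∈ G.paths k v with G.terminal v w = v', G.singularValueFn p q (tau μ q) s v w := by
  classical
  rw [svMatrix, Matrix.of_apply]
  refine Finset.sum_bij (fun w _ => List.ofFn w) ?_ (fun _ _ _ _ h => List.ofFn_injective h) ?_ ?_
  · intro w hw
    rw [Finset.mem_filter, isPath_iff] at hw
    rw [Finset.mem_filter, mem_paths]
    exact ⟨⟨List.length_ofFn, hw.2.1⟩, hw.2.2⟩
  · intro w hw
    rw [Finset.mem_filter, mem_paths] at hw
    obtain ⟨⟨rfl, hpath⟩, hterm⟩ := hw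
    refine ⟨w.get, ?_, List.ofFn_get w⟩
    rw [Finset.mem_filter, List.ofFn_get, isPath_iff]
    exact ⟨Finset.mem_univ _, hpath, hterm⟩
  · intro w hw
    rw [Finset.mem_filter, isPath_iff] at hw
    rw [← phi_eq_singularValueFn ht s hw.2.1, hw.2.2]

variable [Fintype V]

lemma pressureSeq_eq (hp : G.IsProbVector p) (ht : G.IsCompatible (tau μ q)) (s : ℝ) (k : ℕ) :
    G.pressureSeq p μ s q k = G.total (G.singularValueFn p q (tau μ q) s) k ^ (1 / (k : ℝ)) := by
  classical
  rw [pressureSeq, total]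
  congr 1
  refine Finset.sum_congr rfl fun v _ => ?_
  rw [extSum_nil, ← Finset.sum_fiberwise_of_maps_to (s := G.paths k v) (t := Finset.univ)
    (g := G.terminal v) fun w _ => Finset.mem_univ _]
  refine Finset.sum_congr rfl fun v' _ => ?_
  rw [svMatrix_eq ht, abs_of_nonneg]
  exact Finset.sum_nonneg fun w _ => (singularValueFn_pos hp _ _ _ _).le

lemma total_singularValueFn_le {a b s s' : ℝ} (hρ : IsScale G.shortSide a b)
    (hp : G.IsProbVector p) (t : V → Fin 2 → ℝ) (hs : s ≤ s') (n : ℕ) :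
    G.total (G.singularValueFn p q t s') n ≤
      (b ^ n) ^ (s' - s) * G.total (G.singularValueFn p q t s) n := by
  simp only [total, extSum_nil, Finset.mul_sum]
  refine Finset.sum_le_sum fun v _ => Finset.sum_le_sum fun w hw => ?_
  rw [singularValueFn_eq_shortSide_rpow_mul p q t s s', ← (G.mem_paths.1 hw).1]
  exact mul_le_mul_of_nonneg_right
    (Real.rpow_le_rpow (G.shortSide_pos w).le (hρ.le_pow w) (sub_nonneg.2 hs))
    (singularValueFn_pos hp _ _ _ _).le

lemma le_total_singularValueFn {a b s s' : ℝ} (hρ : IsScale G.shortSide a b)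
    (hp : G.IsProbVector p) (t : V → Fin 2 → ℝ) (hs : s ≤ s') (n : ℕ) :
    (a ^ n) ^ (s' - s) * G.total (G.singularValueFn p q t s) n ≤
      G.total (G.singularValueFn p q t s') n := by
  simp only [total, extSum_nil, Finset.mul_sum]
  refine Finset.sum_le_sum fun v _ => Finset.sum_le_sum fun w hw => ?_
  rw [singularValueFn_eq_shortSide_rpow_mul p q t s s', ← (G.mem_paths.1 hw).1]
  exact mul_le_mul_of_nonneg_right
    (Real.rpow_le_rpow (pow_nonneg hρ.lower_pos.le _) (hρ.pow_le w) (sub_nonneg.2 hs))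
    (singularValueFn_pos hp _ _ _ _).le

variable [Nonempty V]

lemma total_singularValueFn_pos (hconn : G.StronglyConnected) (hp : G.IsProbVector p)
    (t : V → Fin 2 → ℝ) (s : ℝ) (n : ℕ) : 0 < G.total (G.singularValueFn p q t s) n := by
  obtain ⟨C, hC⟩ := exists_isWordWeight_singularValueFn (q := q) hp t s
  exact total_pos hC hconn n

lemma tendsto_pressureSeq (hconn : G.StronglyConnected) (hp : G.IsProbVector p)
    (ht : G.IsCompatible (tau μ q)) {s L : ℝ}
    (hL : Tendsto (fun n : ℕ => Real.log (G.total (G.singularValueFn p q (tau μ q) s) n) / n)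
      atTop (𝓝 L)) :
    Tendsto (G.pressureSeq p μ s q) atTop (𝓝 (Real.exp L)) := by
  refine ((Real.continuous_exp.tendsto L).comp hL).congr fun n => ?_
  rw [pressureSeq_eq hp ht, Real.rpow_def_of_pos (total_singularValueFn_pos hconn hp _ s n),
    Function.comp_apply, mul_one_div]

lemma exists_tendsto_log_total_singularValueFn (hconn : G.StronglyConnected)
    (hp : G.IsProbVector p) (ht : G.IsCompatible t) (s : ℝ) :
    ∃ L, Tendsto (fun n : ℕ => Real.log (G.total (G.singularValueFn p q t s) n) / n)
      atTop (𝓝 L) := by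
  obtain ⟨C, hC⟩ := exists_isWordWeight_singularValueFn (q := q) hp t s
  rcases isSubmul_or_isSupermul_singularValueFn hconn hp ht s with h | h
  · exact h.exists_tendsto_log_total hC hconn
  · exact h.exists_tendsto_log_total hC hconn

end

end BoxLikeGIFS

lemma log_pow_rpow_mul_div {x y : ℝ} (hx : 0 < x) (hy : 0 < y) (r : ℝ) {n : ℕ} (hn : n ≠ 0) :
    Real.log ((x ^ n) ^ r * y) / n = Real.log y / n + r * Real.log x := by
  have hn : (n : ℝ) ≠ 0 := Nat.cast_ne_zero.2 hn
  rw [Real.log_mul (Real.rpow_pos_of_pos (by positivity) _).ne' hy.ne',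
    Real.log_rpow (by positivity), Real.log_pow]
  field_simp
  ring

namespace BoxLikeGIFS

variable {V E : Type*} {G : BoxLikeGIFS V E} {p : E → ℝ} {q : ℝ} {t : V → Fin 2 → ℝ} [Fintype E]
  [Fintype V] [Nonempty V]

lemma exists_log_pressure (hconn : G.StronglyConnected) (hp : G.IsProbVector p)
    (ht : G.IsCompatible t) :
    ∃ L : ℝ → ℝ, (∀ s, Tendsto
      (fun n : ℕ => Real.log (G.total (G.singularValueFn p q t s) n) / n) atTop (𝓝 (L s))) ∧
      StrictAnti L ∧ ∃ γ, L γ = 0 := by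
  obtain ⟨a, b, hab⟩ := G.exists_hasRatioBounds
  have hρ := hab.isScale_shortSide
  have hpos := total_singularValueFn_pos (q := q) hconn hp t
  choose L hL using exists_tendsto_log_total_singularValueFn (q := q) hconn hp ht
  have hle (s s') (hs : s ≤ s') : L s' ≤ L s + (s' - s) * Real.log b := by
    refine le_of_tendsto_of_tendsto (hL s') ((hL s).add_const _) ?_
    filter_upwards [eventually_ne_atTop 0] with n hn
    rw [← log_pow_rpow_mul_div hρ.upper_pos (hpos s n) _ hn]
    gcongr
    exacts [hpos s' n, total_singularValueFn_le hρ hp t hs n]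
  have hge (s s') (hs : s ≤ s') : L s + (s' - s) * Real.log a ≤ L s' := by
    refine le_of_tendsto_of_tendsto ((hL s).add_const _) (hL s') ?_
    filter_upwards [eventually_ne_atTop 0] with n hn
    rw [← log_pow_rpow_mul_div hρ.lower_pos (hpos s n) _ hn]
    have hlow : 0 < (a ^ n) ^ (s' - s) := Real.rpow_pos_of_pos (pow_pos hρ.lower_pos n) _
    gcongr
    exacts [mul_pos hlow (hpos s n), le_total_singularValueFn hρ hp t hs n]
  have hlog := Real.log_neg hρ.upper_pos hρ.upper_lt_one
  exact ⟨L, hL, strictAnti_of_slope_le hlog hle, exists_eq_zero_of_slope_bounds hlog hle hge⟩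

end BoxLikeGIFS

/-! ### Moments in the plane -/

lemma exists_lattice_point_of_pos {o c l u : ℝ} (hl : 0 < l) (hc : l ≤ c) (hu : u ∈ Set.Icc 0 1) :
    ∃ z : ℤ, ∃ x ∈ Set.Ioo (0 : ℝ) 1, o + c * x = z * (l / 2) ∧
      |z * (l / 2) - (o + c * u)| ≤ l := by
  have hc0 : 0 < c := hl.trans_le hc
  obtain ⟨hu0, hu1⟩ := hu
  set y := o + c * u
  -- The leftmost point of the segment from `y - l` on still leaves room for a full length `l`.
  set m := max o (y - l) with hm
  have hom : o ≤ m := le_max_left _ _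
  have hylm : y - l ≤ m := le_max_right _ _
  have hoy : o ≤ y := by nlinarith
  have hyoc : y ≤ o + c := by nlinarith
  have hmy : m ≤ y := max_le hoy (by linarith)
  have hmoc : m + l ≤ o + c := by
    rcases max_choice o (y - l) with h | h <;> rw [hm, h] <;> linarith
  have hfloor := Int.floor_le (m / (l / 2))
  have hlt_floor := Int.lt_floor_add_one (m / (l / 2))
  rw [le_div_iff₀ (by linarith)] at hfloor
  rw [div_lt_iff₀ (by linarith)] at hlt_floor
  refine ⟨⌊m / (l / 2)⌋ + 1, ((⌊m / (l / 2)⌋ + 1 : ℤ) * (l / 2) - o) / c,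
    ⟨div_pos ?_ hc0, (div_lt_one hc0).2 ?_⟩, by rw [mul_div_cancel₀ _ hc0.ne']; ring,
    abs_le.2 ⟨?_, ?_⟩⟩ <;> push_cast <;> linarith

lemma exists_lattice_point {o c l u : ℝ} (hl : 0 < l) (hc : l ≤ |c|) (hu : u ∈ Set.Icc 0 1) :
    ∃ z : ℤ, ∃ x ∈ Set.Ioo (0 : ℝ) 1, o + c * x = z * (l / 2) ∧
      |z * (l / 2) - (o + c * u)| ≤ l := by
  rcases le_total 0 c with h | h
  · rw [abs_of_nonneg h] at hc
    exact exists_lattice_point_of_pos hl hc hu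
  · rw [abs_of_nonpos h] at hc
    obtain ⟨z, x, hx, hxz, hdist⟩ := exists_lattice_point_of_pos (o := o + c) hl hc
      (u := 1 - u) ⟨by linarith [hu.2], by linarith [hu.1]⟩
    refine ⟨z, 1 - x, ⟨by linarith [hx.2], by linarith [hx.1]⟩, by linarith, ?_⟩
    convert hdist using 2
    ring

lemma qpow_sum_le_of_card_filter_le {κ : Type*} {q : ℝ} (hq : 0 ≤ q) (S : Finset κ) (y : κ → ℝ≥0∞)
    {N : ℕ} (hN : (S.filter fun w => y w ≠ 0).card ≤ N) :
    qpow q (∑ w ∈ S, y w) ≤ (N : ℝ≥0∞) ^ q * ∑ w ∈ S, qpow q (y w) := by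
  rw [← Finset.sum_filter_ne_zero]
  exact (qpow_sum_le hq _ _ hN).trans
    (mul_le_mul_right (Finset.sum_le_sum_of_subset (Finset.filter_subset _ _)) _)

lemma sum_qpow_le_of_card_filter_le {κ : Type*} {q : ℝ} (hq : 0 ≤ q) (S : Finset κ) (y : κ → ℝ≥0∞)
    {N : ℕ} (hN : (S.filter fun w => y w ≠ 0).card ≤ N) :
    ∑ w ∈ S, qpow q (y w) ≤ N * qpow q (∑ w ∈ S, y w) := by
  rw [← Finset.sum_filter_ne_zero S (f := y),
    ← Finset.sum_subset (Finset.filter_subset (fun w => y w ≠ 0) S)]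
  · exact sum_qpow_le hq _ _ hN
  · intro w hw hwN
    rw [not_not.1 fun h => hwN (Finset.mem_filter.2 ⟨hw, h⟩), qpow_zero_right]

namespace BoxLikeGIFS

variable {V E : Type*} {G : BoxLikeGIFS V E} {p : E → ℝ} {μ : V → Measure (Fin 2 → ℝ)} {q : ℝ}

lemma psiWord_apply (w : List E) (ξ : Fin 2 → ℝ) (i : Fin 2) :
    G.psiWord w ξ i = G.psiWord w 0 i + G.coef w i * ξ (G.inputCoord w i) := by
  have hsub := G.psiWord_sub w ξ 0 i
  rw [Pi.zero_apply, sub_zero] at hsub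
  linarith

lemma exists_lattice_point_mem_psiWord (w : List E) {l : ℝ} (hl : 0 < l) (hw : l ≤ G.shortSide w)
    {ξ : Fin 2 → ℝ} (hξ : ξ ∈ Set.Icc (0 : Fin 2 → ℝ) 1) :
    ∃ z : Fin 2 → ℤ, (fun i => z i * (l / 2)) ∈ G.psiWord w '' openSquare ∧
      dist (fun i => (z i : ℝ) * (l / 2)) (G.psiWord w ξ) ≤ l := by
  choose z x hx hxz hdist using fun i => exists_lattice_point (o := G.psiWord w 0 i) hl
    (hw.trans (G.shortSide_le_side w i)) ⟨hξ.1 (G.inputCoord w i), hξ.2 (G.inputCoord w i)⟩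
  refine ⟨z, ⟨fun j => x (j - G.flipWord w), fun j _ => hx _, ?_⟩, ?_⟩
  · ext i
    rw [psiWord_apply, ← hxz, inputCoord, add_sub_cancel_right]
  · refine (dist_pi_le_iff hl.le).2 fun i => ?_
    rw [Real.dist_eq, psiWord_apply w ξ]
    exact hdist i

lemma exists_mem_nearIndices_psiWord (w : List E) {l δ : ℝ} (hl : 0 < l) (hw : l ≤ G.shortSide w)
    (hδ : 0 < δ) {C : ℕ} (hC : l + δ ≤ C * (l / 2)) {k : Fin 2 → ℤ} {ξ : Fin 2 → ℝ}
    (hξ : ξ ∈ Set.Icc (0 : Fin 2 → ℝ) 1) (hk : G.psiWord w ξ ∈ meshCube δ k) :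
    ∃ z ∈ nearIndices (C + 1) (meshCell (l / 2) fun i => (k i : ℝ) * δ),
      (fun i => z i * (l / 2)) ∈ G.psiWord w '' openSquare := by
  obtain ⟨z, hz, hdist⟩ := exists_lattice_point_mem_psiWord w hl hw hξ
  refine ⟨z, mem_nearIndices_of_dist_le (half_pos hl) (mem_meshCube_meshCell (half_pos hl) _)
    (y := fun i => (z i : ℝ) * (l / 2)) (fun i => ⟨le_rfl, by linarith⟩) ?_, hz⟩
  have hcorner : (fun i => (k i : ℝ) * δ) ∈ meshCube δ k := fun i => ⟨le_rfl, by linarith⟩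
  linarith [dist_le_of_mem_meshCube hδ.le hcorner hk, dist_triangle_right
    (fun i => (k i : ℝ) * δ) (fun i => (z i : ℝ) * (l / 2)) (G.psiWord w ξ)]

lemma dist_coordMap_projIndex (w : List E) (ξ η : Fin 2 → ℝ) :
    G.longSide w * dist (coordMap (G.projIndex w) ξ) (coordMap (G.projIndex w) η) =
      dist (G.psiWord w ξ (G.longDir w)) (G.psiWord w η (G.longDir w)) := by
  rw [dist_psiWord, side_longDir, ← projIndex_eq, dist_coordMap]

lemma dist_psiWord_le {w : List E} {δ : ℝ} (hδ : G.shortSide w ≤ δ) {ξ η : Fin 2 → ℝ}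
    (hξ : ξ ∈ Set.Icc (0 : Fin 2 → ℝ) 1) (hη : η ∈ Set.Icc (0 : Fin 2 → ℝ) 1)
    (h : G.longSide w * dist (coordMap (G.projIndex w) ξ) (coordMap (G.projIndex w) η) ≤ δ) :
    dist (G.psiWord w ξ) (G.psiWord w η) ≤ δ := by
  refine (dist_pi_le_iff ((G.shortSide_pos w).le.trans hδ)).2 fun i => ?_
  rcases eq_or_ne i (G.longDir w) with rfl | hi
  · rwa [← dist_coordMap_projIndex]
  · have hi : i = G.longDir w + 1 := by omega
    rw [dist_psiWord, hi, side_longDir_add_one]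
    exact (mul_le_of_le_one_right (G.shortSide_pos w).le
      (dist_apply_le_one_of_mem_Icc hξ hη _)).trans hδ

lemma imageMoment_psiWord_comparable (hq : 0 ≤ q) {ν : Measure (Fin 2 → ℝ)}
    (hν : ν (Set.Icc 0 1)ᶜ = 0) {w : List E} {δ : ℝ} (hδ : 0 < δ) {C : ℕ} (hC : 1 ≤ C)
    (hle : δ ≤ C * G.shortSide w) (hge : G.shortSide w ≤ δ) :
    imageMoment q ν (G.psiWord w) δ ≤ momentRatio q C 2 1 *
        imageMoment q ν (coordMap (G.projIndex w)) (G.shortSide w / G.longSide w) ∧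
      imageMoment q ν (coordMap (G.projIndex w)) (G.shortSide w / G.longSide w) ≤
        momentRatio q C 1 2 * imageMoment q ν (G.psiWord w) δ := by
  have hs := G.shortSide_pos w
  have hl : 0 < G.longSide w := hs.trans_le (G.shortSide_le_longSide w)
  have hδC : δ ≤ C * δ := le_mul_of_one_le_left hδ.le (by exact_mod_cast hC)
  have hproj : ∀ x ∈ Set.Icc (0 : Fin 2 → ℝ) 1, ∀ y ∈ Set.Icc (0 : Fin 2 → ℝ) 1,
      dist (G.psiWord w x) (G.psiWord w y) ≤ δ →
      dist (coordMap (G.projIndex w) x) (coordMap (G.projIndex w) y) ≤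
        C * (G.shortSide w / G.longSide w) := by
    intro x _ y _ h
    rw [← mul_div_assoc, le_div_iff₀' hl, dist_coordMap_projIndex]
    exact (dist_le_pi_dist _ _ _).trans (h.trans hle)
  have hlift : ∀ x ∈ Set.Icc (0 : Fin 2 → ℝ) 1, ∀ y ∈ Set.Icc (0 : Fin 2 → ℝ) 1,
      dist (coordMap (G.projIndex w) x) (coordMap (G.projIndex w) y) ≤
        G.shortSide w / G.longSide w →
      dist (G.psiWord w x) (G.psiWord w y) ≤ C * δ := by
    intro x hx y hy h
    rw [le_div_iff₀' hl] at h
    exact (dist_psiWord_le hge hx hy (h.trans hge)).trans hδC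
  exact ⟨imageMoment_le_of_dist_le hq hν hδ (by positivity) hproj hlift,
    imageMoment_le_of_dist_le hq hν (by positivity) hδ hlift hproj⟩

/-- Each rectangle meeting the cube contains a point of the lattice `(a δ / 2) ℤ²` near the cube,
and the rectangles of distinct stopping words are disjoint. -/
lemma exists_forall_card_le_of_mem_meshCube [Finite E] (hrosc : G.ROSC) {a b : ℝ}
    (hρ : IsScale G.shortSide a b) :
    ∃ N : ℕ, ∀ δ (hδ : 0 < δ) v (k : Fin 2 → ℤ), ∀ T ⊆ G.stopSet hρ hδ v,
      (∀ w ∈ T, ∃ ξ ∈ Set.Icc (0 : Fin 2 → ℝ) 1, G.psiWord w ξ ∈ meshCube δ k) → T.card ≤ N := by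
  have ha := hρ.lower_pos
  obtain ⟨C, hC⟩ := exists_nat_ge (2 + 2 / a)
  refine ⟨(2 * (C + 1) + 1) ^ 2, fun δ hδ v k T hT hmeet => ?_⟩
  have hl : 0 < a * δ := mul_pos ha hδ
  have hCδ : a * δ + δ ≤ C * (a * δ / 2) :=
    calc a * δ + δ = (2 + 2 / a) * (a * δ / 2) := by field_simp
      _ ≤ C * (a * δ / 2) := by gcongr
  have hfirst : ∀ w ∈ T, G.IsStop G.shortSide δ v w := fun w hw => mem_stopSet.1 (hT hw)
  have hex : ∀ w ∈ T, ∃ z ∈ nearIndices (C + 1) (meshCell (a * δ / 2) fun i => (k i : ℝ) * δ),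
      (fun i => z i * (a * δ / 2)) ∈ G.psiWord w '' openSquare := fun w hw => by
    obtain ⟨ξ, hξ, hξk⟩ := hmeet w hw
    exact exists_mem_nearIndices_psiWord w hl ((hfirst w hw).mul_le hρ) hδ hCδ hξ hξk
  choose! z hznear hz using hex
  rw [← card_nearIndices (C + 1) (meshCell (a * δ / 2) fun i => (k i : ℝ) * δ)]
  refine Finset.card_le_card_of_injOn z hznear fun w hw w' hw' heq => ?_
  by_contra hne
  have hdisj := hrosc.disjoint_psiWord (hfirst w hw).1 (hfirst w' hw').1
    ((hfirst w hw).not_isPrefix hρ (hfirst w' hw') hne)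
    ((hfirst w' hw').not_isPrefix hρ (hfirst w hw) (Ne.symm hne))
  exact Set.disjoint_left.1 hdisj (hz w hw) (heq ▸ hz w' hw')

/-- The `q`-th moment of the piece `p_w μ_{t(w)} ∘ ψ_w⁻¹` of `μ_v` at scale `δ`. -/
noncomputable def pieceMoment (G : BoxLikeGIFS V E) (p : E → ℝ) (μ : V → Measure (Fin 2 → ℝ))
    (q : ℝ) (v : V) (δ : ℝ) (w : List E) : ℝ≥0∞ :=
  ENNReal.ofReal (weight p w) ^ q * imageMoment q (μ (G.terminal v w)) (G.psiWord w) δ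

variable [Fintype E] {a b : ℝ}

lemma sum_pieceMoment (hp : G.IsProbVector p) (hq : 0 ≤ q) (v : V) (δ : ℝ) (S : Finset (List E)) :
    ∑ w ∈ S, G.pieceMoment p μ q v δ w = ∑' k, ∑ w ∈ S, qpow q
      (ENNReal.ofReal (weight p w) * μ (G.terminal v w) (G.psiWord w ⁻¹' meshCube δ k)) := by
  rw [Summable.tsum_finsetSum fun _ _ => ENNReal.summable]
  refine Finset.sum_congr rfl fun w _ => ?_
  rw [pieceMoment, imageMoment, ← ENNReal.tsum_mul_left]
  exact tsum_congr fun k => (qpow_mul hq (by simpa using hp.weight_pos w) _).symm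

variable [Finite V]

namespace IsSelfAffineFamily

lemma exists_card_filter_ne_zero_le (hμ : G.IsSelfAffineFamily p μ) (hrosc : G.ROSC)
    (hp : G.IsProbVector p) (hρ : IsScale G.shortSide a b) :
    ∃ N : ℕ, ∀ δ (hδ : 0 < δ) v (k : Fin 2 → ℤ), ((G.stopSet hρ hδ v).filter fun w =>
      ENNReal.ofReal (weight p w) *
        μ (G.terminal v w) (G.psiWord w ⁻¹' meshCube δ k) ≠ 0).card ≤ N := by
  obtain ⟨N, hN⟩ := exists_forall_card_le_of_mem_meshCube hrosc hρ
  refine ⟨N, fun δ hδ v k => hN δ hδ v k _ (Finset.filter_subset _ _) fun w hw => ?_⟩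
  by_contra! hmiss
  refine right_ne_zero_of_mul (Finset.mem_filter.1 hw).2 (measure_mono_null ?_
    (hμ.measure_compl_eq_zero hrosc hp (G.terminal v w)))
  exact fun ξ hξk hξ => hmiss ξ hξ hξk

lemma exists_imageMoment_comparable_sum_stopSet (hμ : G.IsSelfAffineFamily p μ) (hrosc : G.ROSC)
    (hp : G.IsProbVector p) (hq : 0 ≤ q) (hρ : IsScale G.shortSide a b) :
    ∃ B : ℝ≥0∞, B ≠ ∞ ∧ ∀ δ (hδ : 0 < δ), δ ≤ 1 → ∀ v,
      imageMoment q (μ v) id δ ≤ B * ∑ w ∈ G.stopSet hρ hδ v, G.pieceMoment p μ q v δ w ∧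
      ∑ w ∈ G.stopSet hρ hδ v, G.pieceMoment p μ q v δ w ≤ B * imageMoment q (μ v) id δ := by
  obtain ⟨N, hN⟩ := hμ.exists_card_filter_ne_zero_le hrosc hp hρ
  refine ⟨(N : ℝ≥0∞) ^ q + N, ENNReal.add_ne_top.2
    ⟨ENNReal.rpow_ne_top_of_nonneg hq (ENNReal.natCast_ne_top _), ENNReal.natCast_ne_top _⟩,
    fun δ hδ hδ1 v => ?_⟩
  have hcube : ∀ k, μ v (meshCube δ k) = _ := fun k =>
    hμ.apply_eq_sum_stopSet hp hρ hδ hδ1 v (measurableSet_meshCube δ k)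
  simp_rw [sum_pieceMoment hp hq, imageMoment, Set.preimage_id, hcube, ← ENNReal.tsum_mul_left]
  constructor
  · refine ENNReal.tsum_le_tsum fun k =>
      (qpow_sum_le_of_card_filter_le hq _ _ (hN δ hδ v k)).trans ?_
    gcongr
    exact le_self_add
  · refine ENNReal.tsum_le_tsum fun k =>
      (sum_qpow_le_of_card_filter_le hq _ _ (hN δ hδ v k)).trans ?_
    gcongr
    exact le_add_self

end IsSelfAffineFamily

end BoxLikeGIFS

/-! ### The growth exponent of the moments of `μ_v` -/

lemma log_sum_le_add_log_sum {ι : Type*} {S : Finset ι} (hS : S.Nonempty) {x y : ι → ℝ} {K : ℝ}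
    (hx : ∀ w ∈ S, 0 < x w) (hy : ∀ w ∈ S, 0 < y w)
    (h : ∀ w ∈ S, Real.log (x w) ≤ K + Real.log (y w)) :
    Real.log (∑ w ∈ S, x w) ≤ K + Real.log (∑ w ∈ S, y w) := by
  have hterm : ∀ w ∈ S, x w ≤ Real.exp K * y w := fun w hw =>
    calc x w = Real.exp (Real.log (x w)) := (Real.exp_log (hx w hw)).symm
      _ ≤ Real.exp (K + Real.log (y w)) := Real.exp_le_exp.2 (h w hw)
      _ = Real.exp K * y w := by rw [Real.exp_add, Real.exp_log (hy w hw)]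
  calc Real.log (∑ w ∈ S, x w) ≤ Real.log (Real.exp K * ∑ w ∈ S, y w) := by
        rw [Finset.mul_sum]
        exact Real.log_le_log (Finset.sum_pos hx hS) (Finset.sum_le_sum hterm)
    _ = K + Real.log (∑ w ∈ S, y w) := by
        rw [Real.log_mul (Real.exp_pos K).ne' (Finset.sum_pos hy hS).ne', Real.log_exp]

namespace BoxLikeGIFS

variable {V E : Type*} {G : BoxLikeGIFS V E} {p : E → ℝ} {μ : V → Measure (Fin 2 → ℝ)} {q a b : ℝ}

lemma HasRatioBounds.longSide_le_one (hab : G.HasRatioBounds a b) (w : List E) :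
    G.longSide w ≤ 1 := by
  simpa [side_longDir] using (hab.isScale_side (G.longDir w)).append_le [] w

variable [Fintype E]

lemma log_singularValueFn (hp : G.IsProbVector p) (t : V → Fin 2 → ℝ) (s : ℝ) (v : V)
    (w : List E) : Real.log (G.singularValueFn p q t s v w) =
      q * Real.log (weight p w) + t v (G.longDir w) * Real.log (G.longSide w) +
        (s - t v (G.longDir w)) * Real.log (G.shortSide w) := by
  have hs := G.shortSide_pos w
  have hl : 0 < G.longSide w := hs.trans_le (G.shortSide_le_longSide w)
  have hw := hp.weight_pos w
  rw [singularValueFn_eq_longSide_rpow_mul, Real.log_mul (by positivity) (by positivity),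
    Real.log_mul (by positivity) (by positivity), Real.log_rpow hw, Real.log_rpow hl,
    Real.log_rpow hs]

lemma toReal_pieceMoment (hp : G.IsProbVector p) (v : V) (δ : ℝ) (w : List E) :
    (G.pieceMoment p μ q v δ w).toReal =
      weight p w ^ q * (imageMoment q (μ (G.terminal v w)) (G.psiWord w) δ).toReal := by
  rw [pieceMoment, ENNReal.toReal_mul, ← ENNReal.toReal_rpow,
    ENNReal.toReal_ofReal (hp.weight_pos w).le]

namespace IsSelfAffineFamily

lemma stopSet_nonempty (hμ : G.IsSelfAffineFamily p μ) (hp : G.IsProbVector p) {ρ : List E → ℝ}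
    (hρ : IsScale ρ a b) {δ : ℝ} (hδ : 0 < δ) (hδ1 : δ ≤ 1) (v : V) :
    (G.stopSet hρ hδ v).Nonempty := by
  have := hμ.1 v
  by_contra! hempty
  have hmass := hμ.apply_eq_sum_stopSet hp hρ hδ hδ1 v MeasurableSet.univ
  rw [hempty, measure_univ, Finset.sum_empty] at hmass
  exact one_ne_zero hmass

variable [Finite V]

lemma toReal_imageMoment_psiWord_pos (hμ : G.IsSelfAffineFamily p μ) (hrosc : G.ROSC)
    (hp : G.IsProbVector p) (hq : 0 ≤ q) (v : V) (w : List E) {δ : ℝ} (hδ : 0 < δ) :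
    0 < (imageMoment q (μ v) (G.psiWord w) δ).toReal := by
  have := hμ.1 v
  have hl : 0 ≤ G.longSide w := (G.shortSide_pos w).le.trans (G.shortSide_le_longSide w)
  refine ENNReal.toReal_pos (imageMoment_ne_zero hq _ hδ)
    (imageMoment_ne_top hq (hμ.measure_compl_eq_zero hrosc hp v) hδ (B := G.longSide w)
      fun x hx y hy => dist_psiWord_le (G.shortSide_le_longSide w) hx hy ?_)
  rw [dist_coordMap]
  exact mul_le_of_le_one_right hl (dist_apply_le_one_of_mem_Icc hx hy _)

lemma toReal_pieceMoment_pos (hμ : G.IsSelfAffineFamily p μ) (hrosc : G.ROSC)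
    (hp : G.IsProbVector p) (hq : 0 ≤ q) (v : V) (w : List E) {δ : ℝ} (hδ : 0 < δ) :
    0 < (G.pieceMoment p μ q v δ w).toReal := by
  rw [toReal_pieceMoment hp]
  exact mul_pos (Real.rpow_pos_of_pos (hp.weight_pos w) q)
    (hμ.toReal_imageMoment_psiWord_pos hrosc hp hq _ w hδ)

lemma exists_abs_log_imageMoment_psiWord_sub_le (hμ : G.IsSelfAffineFamily p μ) (hrosc : G.ROSC)
    (hp : G.IsProbVector p) (hq : 0 ≤ q) (ha : 0 < a) :
    ∃ M : ℝ, ∀ v w δ, 0 < δ → a * δ ≤ G.shortSide w → G.shortSide w ≤ δ →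
      |Real.log (imageMoment q (μ v) (G.psiWord w) δ).toReal -
        Real.log (imageMoment q (μ v) (coordMap (G.projIndex w))
          (G.shortSide w / G.longSide w)).toReal| ≤ M := by
  obtain ⟨C, hC⟩ := exists_nat_ge (max 1 (1 / a))
  have hC1 : 1 ≤ C := by exact_mod_cast (le_max_left _ _).trans hC
  have hCa : 1 ≤ C * a := (div_le_iff₀ ha).1 ((le_max_right _ _).trans hC)
  set R := momentRatio q C 2 1 + momentRatio q C 1 2
  have hR : R ≠ ∞ :=
    ENNReal.add_ne_top.2 ⟨momentRatio_ne_top hq C 2 1, momentRatio_ne_top hq C 1 2⟩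
  refine ⟨|Real.log R.toReal|, fun v w δ hδ hle hge => ?_⟩
  have hs := G.shortSide_pos w
  have hl : 0 < G.longSide w := hs.trans_le (G.shortSide_le_longSide w)
  have hcomp := imageMoment_psiWord_comparable hq (hμ.measure_compl_eq_zero hrosc hp v) hδ hC1
    (by nlinarith) hge
  exact abs_log_toReal_sub_le (hμ.toReal_imageMoment_psiWord_pos hrosc hp hq v w hδ)
    ((hμ.scaleRegular_coordMap hrosc hp hq v _).pos _ (by positivity)) hR
    (hcomp.1.trans (mul_le_mul_left le_self_add _)) (hcomp.2.trans (mul_le_mul_left le_add_self _))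

lemma exists_abs_log_imageMoment_coordMap_add_le (hμ : G.IsSelfAffineFamily p μ)
    (hconn : G.StronglyConnected) (hrosc : G.ROSC) (hp : G.IsProbVector p) (hq : 0 ≤ q) {η : ℝ}
    (hη : 0 < η) : ∃ c : ℝ, ∀ v i δ, 0 < δ → δ ≤ 1 →
      |Real.log (imageMoment q (μ v) (coordMap i) δ).toReal + tau μ q v i * Real.log δ| ≤
        c + η * (-Real.log δ) := by
  choose c hc using fun x : V × Fin 2 => (hμ.scaleRegular_coordMap hrosc hp hq x.1
    x.2).exists_abs_log_add_le (hμ.tendsto_log_imageMoment_coordMap hconn hrosc hp hq x.1 x.2) hη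
  obtain ⟨c₀, hc₀⟩ := (Set.finite_range c).bddAbove
  exact ⟨c₀, fun v i δ hδ hδ1 => (hc (v, i) δ hδ hδ1).trans
    (add_le_add_left (hc₀ (Set.mem_range_self _)) _)⟩

lemma exists_abs_log_imageMoment_psiWord_add_le (hμ : G.IsSelfAffineFamily p μ)
    (hconn : G.StronglyConnected) (hrosc : G.ROSC) (hp : G.IsProbVector p) (hq : 0 ≤ q)
    (hab : G.HasRatioBounds a b) {η : ℝ} (hη : 0 < η) :
    ∃ c : ℝ, ∀ v w δ, 0 < δ → G.IsStop G.shortSide δ v w →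
      |Real.log (imageMoment q (μ (G.terminal v w)) (G.psiWord w) δ).toReal +
        tau μ q v (G.longDir w) * (Real.log (G.shortSide w) - Real.log (G.longSide w))| ≤
          c + η * (-Real.log δ) := by
  obtain ⟨M, hM⟩ := hμ.exists_abs_log_imageMoment_psiWord_sub_le hrosc hp hq hab.lower_pos
  obtain ⟨c, hc⟩ := hμ.exists_abs_log_imageMoment_coordMap_add_le hconn hrosc hp hq hη
  refine ⟨M + c + η * (-Real.log a), fun v w δ hδ hw => ?_⟩
  have hs := G.shortSide_pos w
  have hl : 0 < G.longSide w := hs.trans_le (G.shortSide_le_longSide w)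
  have hfirst : a * δ ≤ G.shortSide w := hw.mul_le hab.isScale_shortSide
  have hpiece := hM (G.terminal v w) w δ hδ hfirst hw.2.1.le
  have hproj := hc (G.terminal v w) (G.projIndex w) (G.shortSide w / G.longSide w)
    (div_pos hs hl) ((div_le_one hl).2 (G.shortSide_le_longSide w))
  rw [projIndex_eq, hμ.tau_terminal hconn hrosc hp hq hw.1, ← projIndex_eq,
    Real.log_div hs.ne' hl.ne'] at hproj
  have hscale : η * (-(Real.log (G.shortSide w) - Real.log (G.longSide w))) ≤
      η * (-Real.log a + -Real.log δ) := by
    have hlog := Real.log_le_log (mul_pos hab.lower_pos hδ) hfirst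
    rw [Real.log_mul hab.lower_pos.ne' hδ.ne'] at hlog
    exact mul_le_mul_of_nonneg_left
      (by linarith [Real.log_nonpos hl.le (hab.longSide_le_one w)]) hη.le
  rw [abs_le] at hpiece hproj ⊢
  constructor <;> linarith

lemma exists_abs_log_pieceMoment_sub_le (hμ : G.IsSelfAffineFamily p μ)
    (hconn : G.StronglyConnected) (hrosc : G.ROSC) (hp : G.IsProbVector p) (hq : 0 ≤ q)
    (hab : G.HasRatioBounds a b) (s : ℝ) {η : ℝ} (hη : 0 < η) :
    ∃ c : ℝ, ∀ v w δ, 0 < δ → G.IsStop G.shortSide δ v w →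
      |Real.log (G.pieceMoment p μ q v δ w).toReal + s * Real.log δ -
        Real.log (G.singularValueFn p q (tau μ q) s v w)| ≤ c + η * (-Real.log δ) := by
  obtain ⟨c, hc⟩ := hμ.exists_abs_log_imageMoment_psiWord_add_le hconn hrosc hp hq hab hη
  refine ⟨c + |s| * (-Real.log a), fun v w δ hδ hw => ?_⟩
  have hpiece := hc v w δ hδ hw
  have hpos := hμ.toReal_imageMoment_psiWord_pos hrosc hp hq (G.terminal v w) w hδ
  have hscale : |s * (Real.log δ - Real.log (G.shortSide w))| ≤ |s| * (-Real.log a) := by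
    have hupper := Real.log_le_log (G.shortSide_pos w) hw.2.1.le
    have hlower := Real.log_le_log (mul_pos hab.lower_pos hδ) (hw.mul_le hab.isScale_shortSide)
    rw [Real.log_mul hab.lower_pos.ne' hδ.ne'] at hlower
    rw [abs_mul]
    exact mul_le_mul_of_nonneg_left (abs_le.2 ⟨by linarith, by linarith⟩) (abs_nonneg s)
  rw [toReal_pieceMoment hp, Real.log_mul (Real.rpow_pos_of_pos (hp.weight_pos w) q).ne' hpos.ne',
    Real.log_rpow (hp.weight_pos w), log_singularValueFn hp]
  rw [abs_le] at hpiece hscale ⊢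
  constructor <;> linarith

lemma toReal_sum_pieceMoment (hμ : G.IsSelfAffineFamily p μ) (hrosc : G.ROSC)
    (hp : G.IsProbVector p) (hq : 0 ≤ q) (v : V) {δ : ℝ} (hδ : 0 < δ) (S : Finset (List E)) :
    (∑ w ∈ S, G.pieceMoment p μ q v δ w).toReal =
      ∑ w ∈ S, (G.pieceMoment p μ q v δ w).toReal :=
  ENNReal.toReal_sum fun w _ =>
    (ENNReal.toReal_pos_iff.1 (hμ.toReal_pieceMoment_pos hrosc hp hq v w hδ)).2.ne

lemma exists_abs_log_imageMoment_sub_le (hμ : G.IsSelfAffineFamily p μ)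
    (hconn : G.StronglyConnected) (hrosc : G.ROSC) (hp : G.IsProbVector p) (hq : 0 ≤ q)
    (hab : G.HasRatioBounds a b) (s : ℝ) {η : ℝ} (hη : 0 < η) :
    ∃ c : ℝ, ∀ δ (hδ : 0 < δ), δ ≤ 1 → ∀ v,
      |Real.log (imageMoment q (μ v) id δ).toReal + s * Real.log δ -
        Real.log (∑ w ∈ G.stopSet hab.isScale_shortSide hδ v,
          G.singularValueFn p q (tau μ q) s v w)| ≤ c + η * (-Real.log δ) := by
  obtain ⟨c, hc⟩ := hμ.exists_abs_log_pieceMoment_sub_le hconn hrosc hp hq hab s hη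
  obtain ⟨B, hB, hcomp⟩ :=
    hμ.exists_imageMoment_comparable_sum_stopSet hrosc hp hq hab.isScale_shortSide
  refine ⟨|Real.log B.toReal| + c, fun δ hδ hδ1 v => ?_⟩
  set S := G.stopSet hab.isScale_shortSide hδ v
  have hS : S.Nonempty := hμ.stopSet_nonempty hp hab.isScale_shortSide hδ hδ1 v
  have hpiece : ∀ w ∈ S, _ := fun w hw => abs_le.1 (hc v w δ hδ (mem_stopSet.1 hw))
  have hpos : ∀ w ∈ S, 0 < (G.pieceMoment p μ q v δ w).toReal := fun w _ =>
    hμ.toReal_pieceMoment_pos hrosc hp hq v w hδ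
  have hsv : ∀ w ∈ S, 0 < G.singularValueFn p q (tau μ q) s v w := fun w _ =>
    singularValueFn_pos hp _ _ _ _
  have hsum := hμ.toReal_sum_pieceMoment hrosc hp hq v hδ S
  have hmoment := abs_log_toReal_sub_le ((hμ.scaleRegular_id hrosc hp hq v).pos δ hδ)
    (hsum ▸ Finset.sum_pos hpos hS) hB (hcomp δ hδ hδ1 v).1 (hcomp δ hδ hδ1 v).2
  rw [hsum] at hmoment
  have hupper := log_sum_le_add_log_sum hS hpos hsv (K := c + η * (-Real.log δ) - s * Real.log δ)
    fun w hw => by linarith [(hpiece w hw).2]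
  have hlower := log_sum_le_add_log_sum hS hsv hpos (K := c + η * (-Real.log δ) + s * Real.log δ)
    fun w hw => by linarith [(hpiece w hw).1]
  rw [abs_le] at hmoment ⊢
  constructor <;> linarith

end IsSelfAffineFamily

variable [Fintype V] [Nonempty V]

namespace IsSelfAffineFamily

lemma exists_log_imageMoment_le (hμ : G.IsSelfAffineFamily p μ) (hconn : G.StronglyConnected)
    (hrosc : G.ROSC) (hp : G.IsProbVector p) (hq : 0 ≤ q) {s L η : ℝ}
    (hL : Tendsto (fun n : ℕ => Real.log (G.total (G.singularValueFn p q (tau μ q) s) n) / n)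
      atTop (𝓝 L)) (hL0 : L < 0) (hη : 0 < η) (v : V) :
    ∃ c : ℝ, ∀ δ, 0 < δ → δ ≤ 1 →
      Real.log (imageMoment q (μ v) id δ).toReal + s * Real.log δ ≤ c + η * (-Real.log δ) := by
  obtain ⟨a, b, hab⟩ := G.exists_hasRatioBounds
  obtain ⟨c, hc⟩ := hμ.exists_abs_log_imageMoment_sub_le hconn hrosc hp hq hab s hη
  obtain ⟨C, hC⟩ := exists_isWordWeight_singularValueFn (q := q) hp (tau μ q) s
  obtain ⟨B, hB⟩ := exists_sum_stopSet_le hC hconn hab.isScale_shortSide hL hL0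
  refine ⟨c + Real.log B, fun δ hδ hδ1 => ?_⟩
  have hpos := Finset.sum_pos (fun w _ => singularValueFn_pos hp (q := q) (tau μ q) s v w)
    (hμ.stopSet_nonempty hp hab.isScale_shortSide hδ hδ1 v)
  linarith [(abs_le.1 (hc δ hδ hδ1 v)).2, Real.log_le_log hpos (hB δ hδ v)]

lemma exists_le_log_imageMoment (hμ : G.IsSelfAffineFamily p μ) (hconn : G.StronglyConnected)
    (hrosc : G.ROSC) (hp : G.IsProbVector p) (hq : 0 ≤ q) {s L η : ℝ}
    (hL : Tendsto (fun n : ℕ => Real.log (G.total (G.singularValueFn p q (tau μ q) s) n) / n)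
      atTop (𝓝 L)) (hL0 : 0 < L) (hη : 0 < η) (v : V) :
    ∃ c : ℝ, ∀ δ, 0 < δ → δ ≤ 1 →
      -(c + η * (-Real.log δ)) ≤ Real.log (imageMoment q (μ v) id δ).toReal + s * Real.log δ := by
  obtain ⟨a, b, hab⟩ := G.exists_hasRatioBounds
  have ht : G.IsCompatible (tau μ q) := fun v w i hw => hμ.tau_terminal hconn hrosc hp hq hw i
  obtain ⟨c, hc⟩ := hμ.exists_abs_log_imageMoment_sub_le hconn hrosc hp hq hab s hη
  obtain ⟨C, hC⟩ := exists_isWordWeight_singularValueFn (q := q) hp (tau μ q) s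
  obtain ⟨d, hd, hd_le⟩ := exists_le_sum_stopSet hC hconn
    (isSubmul_or_isSupermul_singularValueFn hconn hp ht s) hab.isScale_shortSide hL hL0
  obtain ⟨A, hA, hcomp⟩ := hμ.exists_imageMoment_id_comparable hconn hp hq
  refine ⟨c - Real.log d + |Real.log A.toReal|, fun δ hδ hδ1 => ?_⟩
  obtain ⟨v', hv'⟩ := hd_le δ hδ hδ1
  have hpos := fun v => (hμ.scaleRegular_id hrosc hp hq v).pos δ hδ
  linarith [(abs_le.1 (hc δ hδ hδ1 v')).1, Real.log_le_log hd hv',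
    log_toReal_le_of_le_mul (hpos v') (hpos v) hA (hcomp v v' δ hδ)]

lemma tendsto_log_imageMoment_id (hμ : G.IsSelfAffineFamily p μ) (hconn : G.StronglyConnected)
    (hrosc : G.ROSC) (hp : G.IsProbVector p) (hq : 0 ≤ q) {L : ℝ → ℝ} {γ : ℝ}
    (hL : ∀ s, Tendsto (fun n : ℕ => Real.log (G.total (G.singularValueFn p q (tau μ q) s) n) / n)
      atTop (𝓝 (L s))) (hanti : StrictAnti L) (hγ : L γ = 0) (v : V) :
    Tendsto (fun δ : ℝ => Real.log (imageMoment q (μ v) id δ).toReal / (-Real.log δ)) (𝓝[>] 0)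
      (𝓝 γ) := by
  refine tendsto_log_div_of_abs_le fun η hη => ?_
  have hη2 := half_pos hη
  obtain ⟨c₁, hc₁⟩ := hμ.exists_log_imageMoment_le hconn hrosc hp hq (hL (γ + η / 2))
    (hγ ▸ hanti (by linarith)) hη2 v
  obtain ⟨c₂, hc₂⟩ := hμ.exists_le_log_imageMoment hconn hrosc hp hq (hL (γ - η / 2))
    (hγ ▸ hanti (by linarith)) hη2 v
  refine ⟨max c₁ c₂, fun δ hδ hδ1 => abs_le.2 ⟨?_, ?_⟩⟩
  · linarith [hc₂ δ hδ hδ1, le_max_right c₁ c₂]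
  · linarith [hc₁ δ hδ hδ1, le_max_left c₁ c₂]

end IsSelfAffineFamily

end BoxLikeGIFS

/-- For all `q ≥ 0`: the `L^q`-spectra of the projections and the limits defining the pressure
exist, `P(·, q) = 1` has a unique root `γ`, and the `L^q`-spectrum of every `μ_v` exists and
equals `γ`. -/
theorem theorem2p2 {V E : Type*} [Fintype V] [Nonempty V] [Fintype E] (G : BoxLikeGIFS V E)
    (hconn : G.StronglyConnected) (hrosc : G.ROSC)
    (p : E → ℝ) (hp : G.IsProbVector p)
    (μ : V → Measure (Fin 2 → ℝ)) (hμ : G.IsSelfAffineFamily p μ)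
    (q : ℝ) (hq : 0 ≤ q) :
    (∀ (v : V) (i : Fin 2), HasLqSpectrum (projMeasure i (μ v)) q
      (lqSpectrum (projMeasure i (μ v)) q)) ∧
    (∀ s : ℝ, Tendsto (G.pressureSeq p μ s q) atTop (𝓝 (G.pressure p μ s q))) ∧
    ∃ γ : ℝ, (∀ s : ℝ, G.pressure p μ s q = 1 ↔ s = γ) ∧ ∀ v : V, HasLqSpectrum (μ v) q γ := by
  have ht : G.IsCompatible (BoxLikeGIFS.tau μ q) := fun v w i hw =>
    hμ.tau_terminal hconn hrosc hp hq hw i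
  obtain ⟨L, hL, hanti, γ, hγ⟩ := BoxLikeGIFS.exists_log_pressure (q := q) hconn hp ht
  have hlim := fun s => BoxLikeGIFS.tendsto_pressureSeq hconn hp ht (hL s)
  have hP : ∀ s, G.pressure p μ s q = Real.exp (L s) := fun s => (hlim s).limUnder_eq
  refine ⟨fun v i => hasLqSpectrum_of_tendsto
      (hμ.tendsto_log_meshMoment_projMeasure hconn hrosc hp hq v i),
    fun s => by rw [hP]; exact hlim s, γ, fun s => ?_, fun v => ?_⟩
  · rw [hP, Real.exp_eq_one_iff, ← hγ, hanti.injective.eq_iff]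
  · have := hμ.1 v
    refine hasLqSpectrum_of_tendsto
      ((hμ.tendsto_log_imageMoment_id hconn hrosc hp hq hL hanti hγ v).congr fun δ => ?_)
    rw [← meshMoment_map hq measurable_id, Measure.map_id]
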